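/- Let $X$ be a complex Banach space and let $A$ be a $0$-sectorial operator on $X$, i.e. $A$ is a closed operator with dense range such that for every $\omega\in(0,\pi)$ one has $\sigma(A)\subset\overline{\Sigma_\omega}$, where $\Sigma_\omega=\{z\neq 0: |\arg z|<\omega\}$, and for every $\theta\in(\omega,\pi)$ the operators $\lambda(\lambda-A)^{-1}$ are uniformly bounded for $\lambda\notin\overline{\Sigma_\theta}$. Write $\langle t\rangle=1+|t|$. Let $\alpha>0$ and $\beta_1,\beta_2\ge\alpha$. For $\beta\ge 0$ and $t\in\mathbb{R}$ the operator $(1+A)^{-\beta}e^{itA}$ is the one that the (extended) holomorphic functional calculus of $A$ assigns to the function $z\mapsto(1+z)^{-\beta}e^{itz}$. Suppose that $(1+A)^{-\beta_1}e^{itA}$ is a bounded operator for all $t\in\mathbb{R}$, with $$\|(1+A)^{-\beta_1}e^{itA}\|\le C\langle t\rangle^\alpha\qquad(t\in\mathbb{R}),$$ that $(1+A)^{-\beta_2}e^{itA}$ is a bounded operator for all $t\in[0,1]$, and that the set $\{(1+A)^{-\beta_2}e^{itA}: t\in[0,1]\}$ is $\gamma$-bounded. Here a set $\tau$ of bounded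 operators is $\gamma$-bounded if for some $C\ge 0$ and independent standard Gaussian variables $\gamma_k$ one has $\big(\mathbb{E}\|\sum_{k\le n}\gamma_kT_kx_k\|^2\big)^{1/2}\le C\big(\mathbb{E}\|\sum_{k\le n}\gamma_kx_k\|^2\big)^{1/2}$ for all $n$, $T_1,\dots,T_n\in\tau$ and $x_1,\dots,x_n\in X$. Let $\phi\in C_c^\infty(\mathbb{R})$ have support in $[-1,1]$ with $\sum_{n\in\mathbb{Z}}\phi(t-n)=1$ for all $t\in\mathbb{R}$, put $\phi_n=\phi(\cdot-n)$ and $\check\phi_n(x)=\frac1{2\pi}\int_{\mathbb{R}}\phi_n(t)e^{itx}\,dt$, and let $E^\alpha_\infty$ be the space of (locally integrable) functions $f:\mathbb{R}\to\mathbb{C}$ for which the convolutions $f*\check\phi_n$ exist and $$\|f\|_{E^\alpha_\infty}=\sum_{n\in\mathbb{Z}}\langle n\rangle^\alpha\|f*\check\phi_n\|_\infty<\infty.$$ For $f:\mathbb{R}\to\mathbb{C}$ with compact support in $(0,\infty)$, the operator $f(A)$ is defined by extending the holomorphic functional calculus through approximation: $f(A)x=\lim_{\varepsilon\to0+}(f*g_\varepsilon)(A)x$,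 where $g_\varepsilon(z)=(4\pi\varepsilon)^{-1/2}e^{-z^2/(4\varepsilon)}$ and $f*g_\varepsilon$ is an entire function. Then, for $\beta=\beta_1+2\beta_2$, the operator $(1+A)^{-\beta}$ is bounded, and there is a constant $C$ such that for every $f\in E^\alpha_\infty$ with compact support in $(0,\infty)$ the operator $f(A)$ exists as a bounded operator on $X$ and $$\|(1+A)^{-\beta}f(A)\|\le C\|f\|_{E^\alpha_\infty}.$$ -/

import Mathlib

open MeasureTheory Filter Topology Set Complex
open scoped ContDiff Convolution

noncomputable section

namespace SmoothedCalculus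

/-! Closed operators, resolvents, sectorial operators. -/

section Operators

variable {X : Type*} [NormedAddCommGroup X] [NormedSpace ℂ X]

/-- The bounded operator `R` is the two-sided inverse `(z - A)⁻¹ : X → D(A)`. -/
def IsResolventAt (A : X →ₗ.[ℂ] X) (z : ℂ) (R : X →L[ℂ] X) : Prop :=
  (∀ x : A.domain, R (z • (x : X) - A x) = x) ∧
    ∀ y : X, ∃ x : A.domain, (x : X) = R y ∧ z • (x : X) - A x = y

/-- The spectrum `σ(A)`: the `z` for which `z - A` has no bounded inverse. -/
def spec (A : X →ₗ.[ℂ] X) : Set ℂ := {z | ¬ ∃ R : X →L[ℂ] X, IsResolventAt A z R}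

open Classical in
/-- The resolvent `(z - A)⁻¹` for `z ∉ σ(A)` (and `0` on the spectrum). -/
def resolv (A : X →ₗ.[ℂ] X) (z : ℂ) : X →L[ℂ] X :=
  if h : ∃ R : X →L[ℂ] X, IsResolventAt A z R then h.choose else 0

/-- The open sector `Σ_θ = {z ≠ 0 : |arg z| < θ}`. -/
def sector (θ : ℝ) : Set ℂ := {z | z ≠ 0 ∧ |z.arg| < θ}

/-- `ω₀`-sectorial operators. -/
structure IsSectorial (ω₀ : ℝ) (A : X →ₗ.[ℂ] X) : Prop where
  isClosed : A.IsClosed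
  spec_subset : spec A ⊆ closure (sector ω₀)
  dense_range : Dense (Set.range fun x : A.domain => A x)
  bound : ∀ θ, ω₀ < θ → θ < Real.pi → ∃ C : ℝ, 0 < C ∧
    ∀ z : ℂ, z ∉ closure (sector θ) → ‖z • resolv A z‖ ≤ C

/-- `0`-sectorial operators: `ω₀`-sectorial for every `ω₀ > 0`. -/
def IsZeroSectorial (A : X →ₗ.[ℂ] X) : Prop :=
  ∀ ω₀ : ℝ, 0 < ω₀ → ω₀ < Real.pi → IsSectorial ω₀ A

/-! The holomorphic functional calculus. -/

/-- The class `H₀^∞(Σ_θ)` of holomorphic functions on `Σ_θ` with polynomial decay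
at `0` and at `∞`. -/
structure MemHZero (θ : ℝ) (g : ℂ → ℂ) : Prop where
  holo : DifferentiableOn ℂ g (sector θ)
  decay : ∃ C s : ℝ, 0 < s ∧ ∀ z ∈ sector θ, ‖g z‖ ≤ C * min (‖z‖ ^ s) (‖z‖ ^ (-s))

/-- The Cauchy integral `(2πi)⁻¹ ∫ g(z) (z - A)⁻¹ dz` along the boundary of `Σ_ν`, oriented
counterclockwise around the sector. -/
def cauchyInt (A : X →ₗ.[ℂ] X) (ν : ℝ) (g : ℂ → ℂ) : X →L[ℂ] X :=
  (2 * (Real.pi : ℂ) * I)⁻¹ •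
    ((∫ r in Ioi (0 : ℝ),
        (g (r * exp (-(ν * I))) * exp (-(ν * I))) • resolv A (r * exp (-(ν * I)))) -
      ∫ r in Ioi (0 : ℝ),
        (g (r * exp (ν * I)) * exp (ν * I)) • resolv A (r * exp (ν * I)))

/-- `T = F(A)` in the extended holomorphic functional calculus of a `0`-sectorial operator:
`F` is holomorphic on some sector `Σ_θ`, and for a regularizer `e ∈ H₀^∞(Σ_θ)`, that is
`e F ∈ H₀^∞(Σ_θ)` and `e(A)` injective, the closed operator `e(A)⁻¹ (e F)(A)` is the
bounded everywhere defined operator `T`. -/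
def IsHolValue (A : X →ₗ.[ℂ] X) (F : ℂ → ℂ) (T : X →L[ℂ] X) : Prop :=
  ∃ (θ ν : ℝ) (e : ℂ → ℂ), 0 < ν ∧ ν < θ ∧ θ < Real.pi ∧
    DifferentiableOn ℂ F (sector θ) ∧
    MemHZero θ e ∧ MemHZero θ (fun z => e z * F z) ∧
    Function.Injective (cauchyInt A ν e) ∧
    ∀ x : X, cauchyInt A ν e (T x) = cauchyInt A ν (fun z => e z * F z) x

/-- The function `z ↦ (1 + z)^{-β} e^{itz}`. -/
def waveFun (β t : ℝ) (z : ℂ) : ℂ := (1 + z) ^ (-(β : ℂ)) * exp (I * t * z)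

/-- The function `z ↦ (1 + z)^{-β}`. -/
def powFun (β : ℝ) (z : ℂ) : ℂ := (1 + z) ^ (-(β : ℂ))

/-- The entire function `f * g_ε`, where `g_ε(z) = (4πε)^{-1/2} exp(-z² / (4ε))` is the Gaussian
approximate identity. -/
def gaussMollify (f : ℝ → ℂ) (ε : ℝ) (z : ℂ) : ℂ :=
  ∫ y : ℝ, f y * (((Real.sqrt (4 * Real.pi * ε) : ℝ) : ℂ)⁻¹ * exp (-(z - y) ^ 2 / (4 * ε)))

/-- `T = f(A)` for a function `f` with compact support in `(0,∞)`: the extension of the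
holomorphic functional calculus by approximation, `f(A) x = lim_{ε → 0} (f * g_ε)(A) x`. -/
def IsFunValue (A : X →ₗ.[ℂ] X) (f : ℝ → ℂ) (T : X →L[ℂ] X) : Prop :=
  ∃ U : ℝ → X →L[ℂ] X, (∀ ε, 0 < ε → IsHolValue A (gaussMollify f ε) (U ε)) ∧
    ∀ x : X, Tendsto (fun ε => U ε x) (𝓝[>] 0) (𝓝 (T x))

/-! Gaussian sums and `γ`-boundedness. -/

/-- `‖∑ γ_k ⊗ x_k‖_{Gauss(X)}` with independent standard Gaussians `γ_k`, realized as the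
coordinates of `ℝⁿ` with the standard Gaussian measure. -/
def gaussNorm {n : ℕ} (x : Fin n → X) : ℝ :=
  Real.sqrt (∫ γ : Fin n → ℝ, ‖∑ k, (γ k : ℂ) • x k‖ ^ 2
    ∂(Measure.pi fun _ => ProbabilityTheory.gaussianReal 0 1))

/-- `γ`-bounded sets of operators. -/
def IsGammaBounded (τ : Set (X →L[ℂ] X)) : Prop :=
  ∃ C : ℝ, 0 ≤ C ∧ ∀ (n : ℕ) (T : Fin n → X →L[ℂ] X) (x : Fin n → X),
    (∀ k, T k ∈ τ) → gaussNorm (fun k => T k (x k)) ≤ C * gaussNorm x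

end Operators

/-! The function space `E^α_∞`. -/

/-- `φ` generates the equidistant partition of unity `φ_n = φ(· - n)`. -/
structure IsEquidistantPartition (φ : ℝ → ℂ) : Prop where
  smooth : ContDiff ℝ ∞ φ
  supp : tsupport φ ⊆ Icc (-1) 1
  sum_eq_one : ∀ t : ℝ, HasSum (fun n : ℤ => φ (t - n)) 1

/-- The inverse Fourier transform of `φ_n = φ(· - n)`, namely
`x ↦ (2π)⁻¹ ∫ φ(t - n) e^{itx} dt`. -/
def checkPart (φ : ℝ → ℂ) (n : ℤ) (x : ℝ) : ℂ :=
  (2 * (Real.pi : ℂ))⁻¹ * ∫ t : ℝ, φ (t - n) * exp (I * t * x)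

/-- `‖f‖_{E^α_∞} = ∑_n ⟨n⟩^α ‖f * φ̌_n‖_∞ ∈ [0,∞]`, with `⟨n⟩ = 1 + |n|`. -/
def eNormE (φ : ℝ → ℂ) (α : ℝ) (f : ℝ → ℂ) : ENNReal :=
  ∑' n : ℤ, ENNReal.ofReal ((1 + |(n : ℝ)|) ^ α) *
    ⨆ x : ℝ, ‖(f ⋆[ContinuousLinearMap.mul ℝ ℂ, volume] checkPart φ n) x‖ₑ

/-- `f ∈ E^α_∞`: the convolutions `f * φ̌_n` make sense, and the norm is finite. -/
structure MemE (φ : ℝ → ℂ) (α : ℝ) (f : ℝ → ℂ) : Prop where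
  locInt : LocallyIntegrable f
  conv : ∀ n : ℤ, ConvolutionExists f (checkPart φ n) (ContinuousLinearMap.mul ℝ ℂ) volume
  finite : eNormE φ α f < ⊤

end SmoothedCalculus

end

open SmoothedCalculus

noncomputable section

namespace SmoothedCalculus

/-! ### Sectors and the resolvent off the positive half axis -/

section Resolvent

variable {X : Type*} [NormedAddCommGroup X] [NormedSpace ℂ X]

/-! Fourier inversion writes $(1+A)^{-\beta}f(A)$ as $(2\pi)^{-1}\int\hat
f(t)(1+A)^{-\beta}e^{itA}\,dt$, and the partition `φ` cuts this integral into pieces of unit length.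
Near $n$ one has $e^{itA}=e^{icA}e^{iuA}$ with $|c-n|\le 7/4$ and $u\in[0,1]$. The factor
$(1+A)^{-\beta_1}e^{icA}$ costs $\langle n\rangle^\alpha$, so it remains to bound $\int
k(u)(1+A)^{-2\beta_2}e^{iuA}x\,du$ by $\|f*\check\phi_n\|_\infty\|x\|$, where $k$ is the recentred
$\phi_n\hat f$, smoothly cut off to $[1/4,3/4]$.

Taking norms under the integral would only see the $L^1$ norm of $k$. Instead put
$S(x)=(1+A)^{-\beta_2}e^{ixA}$; then by `integral_integral_add_eq` the integral equals
$\iint_{[0,1]^2}h(x+y)S(x)S(y)\,dx\,dy$ with $h(u)=k(u)/u$. The Hankel operator with kernel $h(x+y)$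
has $L^2$ norm at most $\sup|\hat h|$ by Plancherel (`integral_norm_sq_hankel_le`). Cutting off and
dividing by $u$ cost a constant (`norm_integral_mul_le`), and the transform of $\phi_n\hat f$ is
$f*\check\phi_n$ up to reflection and $2\pi$. The scalar $L^2$ bound passes to $X$ after
discretization: γ-boundedness is used once for each factor $S$, and in between stands the ideal
property of Gaussian norms, `gaussNorm_matrix_le`. The outcome is `norm_integral_hankel_le`.

The rest gives the formula a meaning. Operators are identified by `Represents`, which tests them
against regularizers damped by $e^{-sz^4}$, so that unbounded symbols such as $e^{itz}$ enter the
multiplicative Cauchy calculus (`IsZeroSectorial.cauchyInt_mul`, `IsRegularizer.mul`,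
`IsRegularizer.ext`). No continuity of the wave operators is assumed; one factor $(1+A)^{-1}$ makes
them norm continuous (`IsRegularizer.continuousOn_wave_comp`), and then all integrals are Bochner
integrals. The operator $f(A)$ exists because $(1+z)^m(f*g_\varepsilon)(z)$ is a Fourier integral
whose weights converge dominatedly: $(1+y)^jf$ has a Fourier transform integrable against $\langle
t\rangle^\alpha$ (`integrable_ft_mul`). Finally $f(A)$ factors through $(1+A)^{-1}$, so the
auxiliary factor is removed by approximating with $r(r+A)^{-1}$
(`IsRegularizer.norm_comp_le_of_resApprox`). -/

lemma notMem_closure_sector {θ : ℝ} (hπ : θ ≤ Real.pi) {z : ℂ}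
    (hz : z.re < ‖z‖ * Real.cos θ) : z ∉ closure (sector θ) := by
  have hcl : IsClosed {z : ℂ | ‖z‖ * Real.cos θ ≤ z.re} :=
    isClosed_le (by fun_prop) (by fun_prop)
  have hsub : sector θ ⊆ {z : ℂ | ‖z‖ * Real.cos θ ≤ z.re} := by
    rintro w ⟨hw0, hw⟩
    have h1 : Real.cos θ ≤ Real.cos w.arg := by
      rw [← Real.cos_abs w.arg]
      exact Real.cos_le_cos_of_nonneg_of_le_pi (abs_nonneg _) hπ hw.le
    rw [Complex.cos_arg hw0] at h1
    have := norm_pos_iff.mpr hw0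
    rw [le_div_iff₀ this] at h1
    simpa [mul_comm] using h1
  intro h
  have := closure_minimal hsub hcl h
  simp only [mem_ofPred_eq] at this
  linarith

lemma exp_mem_sector {θ : ℝ} (hπ : θ ≤ Real.pi) {u : ℂ} (hu : |u.im| < θ) :
    exp u ∈ sector θ := by
  refine ⟨exp_ne_zero u, ?_⟩
  rw [abs_lt] at hu
  rw [Complex.arg_exp, (toIocMod_eq_self Real.two_pi_pos).2 ⟨by linarith, by linarith⟩]
  exact abs_lt.2 hu

lemma sector_eq {θ : ℝ} (h0 : 0 ≤ θ) (hπ : θ ≤ Real.pi) :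
    sector θ = {z : ℂ | ‖z‖ * Real.cos θ < z.re} := by
  ext z
  constructor
  · rintro ⟨hz0, hz⟩
    have h1 : Real.cos θ < Real.cos z.arg := by
      rw [← Real.cos_abs z.arg]
      exact Real.cos_lt_cos_of_nonneg_of_le_pi (abs_nonneg _) hπ hz
    rw [Complex.cos_arg hz0] at h1
    have := norm_pos_iff.mpr hz0
    rw [lt_div_iff₀ this] at h1
    simpa [mul_comm] using h1
  · intro hz
    simp only [mem_ofPred_eq] at hz
    have hz0 : z ≠ 0 := by rintro rfl; simp at hz
    refine ⟨hz0, ?_⟩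
    by_contra! h
    have h1 : Real.cos z.arg ≤ Real.cos θ := by
      rw [← Real.cos_abs z.arg]
      exact Real.cos_le_cos_of_nonneg_of_le_pi h0 (abs_arg_le_pi z) h
    rw [Complex.cos_arg hz0] at h1
    have := norm_pos_iff.mpr hz0
    rw [div_le_iff₀ this] at h1
    linarith

lemma isOpen_sector {θ : ℝ} (h0 : 0 ≤ θ) (hπ : θ ≤ Real.pi) : IsOpen (sector θ) := by
  rw [sector_eq h0 hπ]
  exact isOpen_lt (by fun_prop) (by fun_prop)

lemma sector_mono {θ θ' : ℝ} (h : θ ≤ θ') : sector θ ⊆ sector θ' :=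
  fun _ hz => ⟨hz.1, hz.2.trans_le h⟩

lemma re_pos_of_mem_sector {θ : ℝ} (hθ : θ ≤ Real.pi / 2) {z : ℂ} (hz : z ∈ sector θ) :
    0 < z.re := by
  rcases Complex.abs_arg_lt_pi_div_two_iff.1 (hz.2.trans_le hθ) with h | h
  · exact h
  · exact absurd h hz.1

lemma MemHZero.mono {θ θ' : ℝ} {g : ℂ → ℂ} (hg : MemHZero θ' g) (h : θ ≤ θ') : MemHZero θ g :=
  ⟨hg.holo.mono (sector_mono h), by
    obtain ⟨C, s, hs, hb⟩ := hg.decay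
    exact ⟨C, s, hs, fun z hz => hb z (sector_mono h hz)⟩⟩

/-- The complement of `[0,∞)`. -/
def offAxis : Set ℂ := {z | z.re < ‖z‖}

lemma isOpen_offAxis : IsOpen offAxis := isOpen_lt (by fun_prop) (by fun_prop)

/-- A point off the half axis leaves every sufficiently narrow closed sector. In this way
sectoriality for all angles yields statements on the whole complement of the half axis. -/
lemma exists_angle_of_mem_offAxis {z : ℂ} (hz : z ∈ offAxis) :
    ∃ θ, 0 < θ ∧ θ < Real.pi ∧ z.re < ‖z‖ * Real.cos θ := by
  have h : z.re < ‖z‖ * Real.cos 0 := by simpa [offAxis] using hz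
  have h1 : ∀ᶠ θ in 𝓝 (0 : ℝ), z.re < ‖z‖ * Real.cos θ :=
    ContinuousAt.eventually_lt (by fun_prop) (by fun_prop) h
  have h2 : ∀ᶠ θ in 𝓝 (0 : ℝ), θ < Real.pi := eventually_lt_nhds Real.pi_pos
  have h3 := (h1.and h2).filter_mono (nhdsWithin_le_nhds (s := Ioi 0))
  obtain ⟨θ, ⟨h4, h5⟩, h6⟩ := (h3.and self_mem_nhdsWithin).exists
  exact ⟨θ, h6, h5, h4⟩

lemma IsZeroSectorial.isResolventAt {A : X →ₗ.[ℂ] X} (hA : IsZeroSectorial A) {z : ℂ}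
    (hz : z ∈ offAxis) : IsResolventAt A z (resolv A z) := by
  obtain ⟨θ, h0, hπ, h⟩ := exists_angle_of_mem_offAxis hz
  have h1 : z ∉ spec A := fun h2 =>
    notMem_closure_sector hπ.le h ((hA θ h0 hπ).spec_subset h2)
  simp only [spec, mem_ofPred_eq, not_not] at h1
  rw [resolv, dif_pos h1]
  exact h1.choose_spec

lemma IsZeroSectorial.exists_bound {A : X →ₗ.[ℂ] X} (hA : IsZeroSectorial A) {θ : ℝ}
    (h0 : 0 < θ) (hπ : θ < Real.pi) : ∃ C : ℝ, 0 < C ∧ ∀ z : ℂ, z.re < ‖z‖ * Real.cos θ →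
      ‖z‖ * ‖resolv A z‖ ≤ C := by
  -- The bound outside the sector of angle `θ` is available only for a strictly smaller sectoriality
  -- angle.
  obtain ⟨C, hC, h⟩ := (hA (θ / 2) (by linarith) (by linarith)).bound θ (by linarith) hπ
  refine ⟨C, hC, fun z hz => ?_⟩
  rw [← norm_smul]
  exact h z (notMem_closure_sector hπ.le hz)

lemma IsZeroSectorial.resolvent_identity {A : X →ₗ.[ℂ] X} (hA : IsZeroSectorial A) {z w : ℂ}
    (hz : z ∈ offAxis) (hw : w ∈ offAxis) :
    resolv A z - resolv A w = (w - z) • (resolv A z ∘L resolv A w) := by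
  ext y
  obtain ⟨x, hx, hxy⟩ := (hA.isResolventAt hw).2 y
  have h := (hA.isResolventAt hz).1 x
  have e : z • (x : X) - A x = y + (z - w) • (x : X) := by rw [← hxy]; module
  rw [e, map_add, map_smul, hx] at h
  simp only [sub_apply, smul_apply,
    ContinuousLinearMap.comp_apply]
  rw [← sub_eq_zero] at h ⊢
  rw [← h]; module

lemma IsZeroSectorial.resolv_comm {A : X →ₗ.[ℂ] X} (hA : IsZeroSectorial A) {z w : ℂ}
    (hz : z ∈ offAxis) (hw : w ∈ offAxis) :
    resolv A z ∘L resolv A w = resolv A w ∘L resolv A z := by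
  rcases eq_or_ne z w with rfl | hne
  · rfl
  have h1 := hA.resolvent_identity hz hw
  have h2 := hA.resolvent_identity hw hz
  have h3 : (w - z) • (resolv A z ∘L resolv A w - resolv A w ∘L resolv A z) = 0 := by
    have : (w - z) • (resolv A z ∘L resolv A w) + (z - w) • (resolv A w ∘L resolv A z) = 0 := by
      rw [← h1, ← h2]; abel
    rw [← this]; module
  have := (smul_eq_zero.1 h3).resolve_left (sub_ne_zero.2 hne.symm)
  exact sub_eq_zero.1 this

/-- By the resolvent identity the difference quotient is minus the product of the resolvents at `w`
and `z`. Only continuity is then needed, and it follows from the same identity and the sectorial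
bound, which is locally uniform off the axis. -/
lemma IsZeroSectorial.hasDerivAt_resolv {A : X →ₗ.[ℂ] X} (hA : IsZeroSectorial A) {z : ℂ}
    (hz : z ∈ offAxis) :
    HasDerivAt (resolv A) (-(resolv A z ∘L resolv A z)) z := by
  obtain ⟨θ, h0, hπ, h⟩ := exists_angle_of_mem_offAxis hz
  obtain ⟨C, hC, hb⟩ := hA.exists_bound h0 hπ
  have hz0 : 0 < ‖z‖ := by
    rcases (norm_nonneg z).eq_or_lt' with h1 | h1
    · rw [offAxis, mem_ofPred_eq, norm_eq_zero.1 h1] at hz; simp at hz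
    · exact h1
  have e1 : ∀ᶠ w in 𝓝 z, w.re < ‖w‖ * Real.cos θ :=
    ContinuousAt.eventually_lt (by fun_prop) (by fun_prop) h
  have e2 : ∀ᶠ w in 𝓝 z, ‖z‖ / 2 < ‖w‖ :=
    ContinuousAt.eventually_lt (by fun_prop) (by fun_prop) (by linarith)
  have e3 : ∀ᶠ w in 𝓝 z, w ∈ offAxis := isOpen_offAxis.mem_nhds hz
  have hcont : Tendsto (resolv A) (𝓝 z) (𝓝 (resolv A z)) := by
    rw [tendsto_iff_norm_sub_tendsto_zero]
    have hlim : Tendsto (fun w => ‖z - w‖ * ((C / (‖z‖ / 2)) * ‖resolv A z‖)) (𝓝 z) (𝓝 0) := by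
      have : Tendsto (fun w => ‖z - w‖ * ((C / (‖z‖ / 2)) * ‖resolv A z‖)) (𝓝 z)
          (𝓝 (‖z - z‖ * ((C / (‖z‖ / 2)) * ‖resolv A z‖))) :=
        (Continuous.tendsto (by fun_prop) z)
      simpa using this
    refine squeeze_zero' (Eventually.of_forall fun _ => norm_nonneg _) ?_ hlim
    filter_upwards [e1, e2, e3] with w hw1 hw2 hw3
    rw [hA.resolvent_identity hw3 hz, norm_smul]
    gcongr
    refine (ContinuousLinearMap.opNorm_comp_le _ _).trans ?_
    gcongr
    rw [le_div_iff₀ (by linarith)]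
    calc _ ≤ ‖resolv A w‖ * ‖w‖ := by gcongr
      _ ≤ C := by rw [mul_comm]; exact hb w hw1
  rw [hasDerivAt_iff_tendsto_slope]
  have h4 : Tendsto (fun w => -(resolv A w ∘L resolv A z)) (𝓝[≠] z)
      (𝓝 (-(resolv A z ∘L resolv A z))) := by
    refine Tendsto.neg ?_
    have := ((ContinuousLinearMap.compL ℂ X X X).flip (resolv A z)).continuous.tendsto (resolv A z)
    exact (this.comp hcont).mono_left nhdsWithin_le_nhds
  refine h4.congr' ?_
  filter_upwards [e3.filter_mono nhdsWithin_le_nhds, self_mem_nhdsWithin] with w hw hne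
  rw [slope_def_module, hA.resolvent_identity hw hz, smul_smul]
  have : (w - z)⁻¹ * (z - w) = -1 := by
    have : w - z ≠ 0 := sub_ne_zero.2 hne
    field_simp; ring
  rw [this]; simp

lemma exp_mem_offAxis {u : ℂ} (h0 : u.im ≠ 0) (hπ : |u.im| ≤ Real.pi) : exp u ∈ offAxis := by
  have h1 : Real.cos u.im < 1 := by
    rw [← Real.cos_abs, ← Real.cos_zero]
    exact Real.cos_lt_cos_of_nonneg_of_le_pi le_rfl hπ (abs_pos.2 h0)
  rw [offAxis, mem_ofPred_eq, exp_re, norm_exp]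
  have := Real.exp_pos u.re
  nlinarith

lemma neg_ofReal_mem_offAxis {r : ℝ} (hr : 0 < r) : (-(r : ℂ)) ∈ offAxis := by
  simp [offAxis, abs_of_pos hr]; linarith

end Resolvent

end SmoothedCalculus

end

noncomputable section

namespace SmoothedCalculus

/-! ### Contour shifts in horizontal strips -/

section LineIntegrals

variable {E : Type*} [NormedAddCommGroup E] [NormedSpace ℂ E]

lemma integrable_exp_neg_mul_abs {s : ℝ} (hs : 0 < s) :
    Integrable (fun x : ℝ => Real.exp (-s * |x|)) := by
  have h1 : IntegrableOn (fun x : ℝ => Real.exp (-s * |x|)) (Ioi 0) :=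
    (integrableOn_exp_mul_Ioi (by linarith : -s < 0) 0).congr_fun
      (fun x hx => by simp only; rw [abs_of_pos hx]) measurableSet_Ioi
  have h2 : IntegrableOn (fun x : ℝ => Real.exp (-s * |x|)) (Iic 0) :=
    (integrableOn_exp_mul_Iic hs 0).congr_fun
      (fun x hx => by
        simp only; rw [abs_of_nonpos hx]; congr 1; ring) measurableSet_Iic
  rw [← integrableOn_univ, ← Iic_union_Ioi (a := (0 : ℝ))]
  exact h2.union h1

lemma integrable_of_exp_decay {E : Type*} [NormedAddCommGroup E] {f : ℝ → E} (hf : Continuous f) {C s x₀ : ℝ} (hs : 0 < s)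
    (h : ∀ x, x₀ ≤ |x| → ‖f x‖ ≤ C * Real.exp (-s * |x|)) : Integrable f := by
  have h1 : LocallyIntegrable f := hf.locallyIntegrable
  have ho : f =O[cocompact ℝ] fun x => Real.exp (-s * |x|) := by
    refine Asymptotics.IsBigO.of_bound C ?_
    have : ∀ᶠ x : ℝ in cocompact ℝ, x₀ ≤ |x| := by
      have := tendsto_norm_cocompact_atTop (E := ℝ)
      exact (this.eventually_ge_atTop x₀)
    filter_upwards [this] with x hx
    rw [Real.norm_of_nonneg (Real.exp_pos _).le]
    exact h x hx
  exact h1.integrable_of_isBigO_cocompact ho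
    ((integrable_exp_neg_mul_abs hs).integrableAtFilter _)

/-- Shifting the line of integration in a strip. -/
lemma integral_line_eq [CompleteSpace E] {G : ℂ → E} {a b : ℝ} (hab : a ≤ b)
    (hd : ∀ u : ℂ, a ≤ u.im → u.im ≤ b → DifferentiableAt ℂ G u)
    {C s x₀ : ℝ} (hs : 0 < s)
    (hb : ∀ u : ℂ, a ≤ u.im → u.im ≤ b → x₀ ≤ |u.re| → ‖G u‖ ≤ C * Real.exp (-s * |u.re|)) :
    ∫ x : ℝ, G (x + a * I) = ∫ x : ℝ, G (x + b * I) := by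
  have hint : ∀ y, a ≤ y → y ≤ b → Integrable (fun x : ℝ => G (x + y * I)) := by
    intro y h1 h2
    refine integrable_of_exp_decay (C := C) (x₀ := x₀) ?_ hs fun x hx => ?_
    · rw [continuous_iff_continuousAt]
      intro x
      have : ContinuousAt G ((x : ℂ) + y * I) := (hd _ (by simpa) (by simpa)).continuousAt
      exact ContinuousAt.comp (f := fun x : ℝ => (x : ℂ) + y * I) this (by fun_prop)
    · simpa using hb (x + y * I) (by simpa) (by simpa) (by simpa)
  -- Cauchy's theorem on the rectangle with real part in `[-T, T]`: the horizontal sides differ by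
  -- the vertical ones, which vanish as `T` grows.
  have hrect : ∀ T : ℝ, (∫ x : ℝ in -T..T, G (x + a * I)) - (∫ x : ℝ in -T..T, G (x + b * I)) =
      I • (∫ y : ℝ in a..b, G (((-T : ℝ) : ℂ) + y * I)) -
      I • (∫ y : ℝ in a..b, G ((T : ℂ) + y * I)) := by
    intro T
    have := integral_boundary_rect_eq_zero_of_differentiableOn G (⟨-T, a⟩ : ℂ) (⟨T, b⟩ : ℂ) ?_
    · simp only at this
      rw [← sub_eq_zero, ← this]
      abel
    · intro u hu
      rw [mem_reProdIm] at hu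
      simp only [uIcc_of_le hab] at hu
      exact (hd u hu.2.1 hu.2.2).differentiableWithinAt
  have hside : ∀ σ : ℝ, |σ| = 1 →
      Tendsto (fun T : ℝ => ∫ y : ℝ in a..b, G (((σ * T : ℝ) : ℂ) + y * I)) atTop (𝓝 0) := by
    intro σ hσ
    have hlim : Tendsto (fun T : ℝ => (C * Real.exp (-s * T)) * |b - a|) atTop (𝓝 0) := by
      have h1 : Tendsto (fun T : ℝ => Real.exp (-s * T)) atTop (𝓝 0) := by
        refine Real.tendsto_exp_atBot.comp ?_
        exact tendsto_id.const_mul_atTop_of_neg (by linarith)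
      simpa using (h1.const_mul C).mul_const |b - a|
    refine squeeze_zero_norm' ?_ hlim
    filter_upwards [eventually_ge_atTop x₀, eventually_ge_atTop 0] with T h1 h2
    refine intervalIntegral.norm_integral_le_of_norm_le_const fun y hy => ?_
    rw [uIoc_of_le hab] at hy
    have e : |σ * T| = T := by rw [abs_mul, hσ, one_mul, abs_of_nonneg h2]
    have := hb (((σ * T : ℝ) : ℂ) + y * I) (by simpa using hy.1.le) (by simpa using hy.2)
      (by simp only [add_re, ofReal_re, mul_re, I_re, mul_zero, ofReal_im, I_im, mul_one, sub_self,
            add_zero]; rw [e]; exact h1)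
    simpa [-ofReal_mul, e] using this
  have hR : Tendsto (fun T : ℝ => (∫ x : ℝ in -T..T, G (x + a * I)) -
      (∫ x : ℝ in -T..T, G (x + b * I))) atTop (𝓝 0) := by
    have h1 := (hside (-1) (by simp)).const_smul I
    have h2 := (hside 1 (by simp)).const_smul I
    have h3 := h1.sub h2
    simp only [smul_zero, sub_zero] at h3
    refine h3.congr fun T => ?_
    rw [hrect T]; simp
  have hL := (intervalIntegral_tendsto_integral (hint a le_rfl hab) tendsto_neg_atTop_atBot
    tendsto_id).sub (intervalIntegral_tendsto_integral (hint b hab le_rfl)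
    tendsto_neg_atTop_atBot tendsto_id)
  exact sub_eq_zero.1 (tendsto_nhds_unique hL hR)

lemma integral_Ioi_eq_integral_exp (f : ℝ → E) :
    ∫ r in Ioi (0 : ℝ), f r = ∫ x : ℝ, Real.exp x • f (Real.exp x) := by
  have := integral_image_eq_integral_abs_deriv_smul (s := univ) (f := Real.exp) (f' := Real.exp)
    MeasurableSet.univ (fun x _ => (Real.hasDerivAt_exp x).hasDerivWithinAt)
    Real.exp_injective.injOn f
  rw [image_univ, Real.range_exp] at this
  rw [this]
  simp

end LineIntegrals

/-! ### The kernel 1 / sinh on horizontal lines -/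

section SinhKernel

lemma exp_abs_le_norm_sinh {w : ℂ} : (Real.exp |w.re| - Real.exp (-|w.re|)) / 2 ≤ ‖sinh w‖ := by
  have h1 : ‖sinh w‖ = ‖exp w - exp (-w)‖ / 2 := by
    rw [Complex.sinh, norm_div]; simp
  rw [h1]
  gcongr
  rcases le_total 0 w.re with h | h
  · rw [abs_of_nonneg h]
    have := norm_sub_norm_le (exp w) (exp (-w))
    simpa [norm_exp] using this
  · rw [abs_of_nonpos h]
    have := norm_sub_norm_le (exp (-w)) (exp w)
    rw [norm_sub_rev]
    simpa [norm_exp] using this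

lemma exp_div_four_le_norm_sinh {w : ℂ} (hw : 1 ≤ |w.re|) : Real.exp |w.re| / 4 ≤ ‖sinh w‖ := by
  refine le_trans ?_ exp_abs_le_norm_sinh
  have h1 : (2 : ℝ) ≤ Real.exp |w.re| := by
    have := Real.add_one_le_exp |w.re|; linarith
  have h2 : Real.exp (-|w.re|) ≤ 1 := Real.exp_le_one_iff.2 (by simp)
  linarith

lemma sinh_ne_zero_of_abs_im_lt {w : ℂ} (hw : w ≠ 0) (hπ : |w.im| < Real.pi) : sinh w ≠ 0 := by
  rcases eq_or_ne w.re 0 with h | h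
  · have hw' : w = w.im * I := by apply Complex.ext <;> simp [h]
    have him : w.im ≠ 0 := fun h0 => hw (Complex.ext (by simp [h]) (by simp [h0]))
    rw [hw', sinh_mul_I]
    refine mul_ne_zero ?_ I_ne_zero
    rw [← ofReal_sin, ofReal_ne_zero]
    rw [abs_lt] at hπ
    rcases him.lt_or_gt with h1 | h1
    · exact (Real.sin_neg_of_neg_of_neg_pi_lt h1 hπ.1).ne
    · exact (Real.sin_pos_of_pos_of_lt_pi h1 hπ.2).ne'
  · intro h0
    have := exp_abs_le_norm_sinh (w := w)
    rw [h0, norm_zero] at this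
    have h2 : Real.exp (-|w.re|) < Real.exp |w.re| :=
      Real.exp_lt_exp.2 (by have := abs_pos.2 h; linarith)
    linarith

/-- An antiderivative is `2 arctan (exp x)`. -/
lemma integral_inv_cosh : ∫ x : ℝ, (Real.cosh x)⁻¹ = Real.pi := by
  have hd : ∀ x : ℝ, HasDerivAt (fun x => 2 * Real.arctan (Real.exp x)) (Real.cosh x)⁻¹ x := by
    intro x
    have := ((Real.hasDerivAt_exp x).arctan).const_mul 2
    refine this.congr_deriv ?_
    rw [Real.cosh_eq, Real.exp_neg]
    have := Real.exp_pos x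
    field_simp
    ring
  have hb : ∀ x : ℝ, ‖(Real.cosh x)⁻¹‖ ≤ 2 * Real.exp (-1 * |x|) := by
    intro x
    rw [Real.norm_of_nonneg (inv_nonneg.2 (Real.cosh_pos x).le), ← Real.cosh_abs, Real.cosh_eq,
      inv_le_iff_one_le_mul₀ (by positivity), neg_one_mul]
    have : Real.exp (-|x|) * Real.exp |x| = 1 := by rw [← Real.exp_add]; simp
    nlinarith [Real.exp_pos (-|x|)]
  have hi : Integrable fun x : ℝ => (Real.cosh x)⁻¹ :=
    integrable_of_exp_decay (x₀ := 0) (Real.continuous_cosh.inv₀ fun x => (Real.cosh_pos x).ne')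
      one_pos fun x _ => hb x
  rw [integral_of_hasDerivAt_of_tendsto hd hi (m := 0) (n := Real.pi)]
  · simp
  · have : Tendsto (fun x => 2 * Real.arctan (Real.exp x)) atBot (𝓝 (2 * Real.arctan 0)) :=
      ((Real.continuous_arctan.tendsto 0).comp Real.tendsto_exp_atBot).const_mul 2
    simpa using this
  · have : Tendsto (fun x => 2 * Real.arctan (Real.exp x)) atTop (𝓝 (2 * (Real.pi / 2))) :=
      ((tendsto_nhds_of_tendsto_nhdsWithin Real.tendsto_arctan_atTop).comp
        Real.tendsto_exp_atTop).const_mul 2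
    simpa [mul_div_cancel₀] using this

lemma norm_inv_sinh_le {w : ℂ} (hw : 1 ≤ |w.re|) :
    ‖(sinh w)⁻¹‖ ≤ 4 * Real.exp (-1 * |w.re|) := by
  rw [norm_inv, neg_one_mul, Real.exp_neg, ← div_eq_mul_inv]
  have := exp_div_four_le_norm_sinh hw
  rw [inv_le_comm₀ (lt_of_lt_of_le (by positivity) this) (by positivity), inv_div]
  exact this

/-- The line may be moved to height `π / 2`, as `sinh` has no zero strictly between the heights `0`
and `π`. There `sinh` becomes `I cosh`. This integral and its reflection supply the residue in the
scalar Cauchy formula. -/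
lemma integral_inv_sinh_line {b : ℝ} (h0 : 0 < b) (hπ : b < Real.pi) :
    ∫ x : ℝ, (sinh (x + b * I))⁻¹ = -(Real.pi * I) := by
  have hd : ∀ u : ℂ, 0 < u.im → u.im < Real.pi → DifferentiableAt ℂ (fun u => (sinh u)⁻¹) u := by
    intro u h1 h2
    refine DifferentiableAt.inv (by fun_prop) (sinh_ne_zero_of_abs_im_lt ?_ ?_)
    · rintro rfl; simp at h1
    · rwa [abs_of_pos h1]
  have key : ∫ x : ℝ, (sinh (x + b * I))⁻¹ = ∫ x : ℝ, (sinh (x + ((Real.pi / 2 : ℝ) : ℂ) * I))⁻¹ := by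
    have hπ0 := Real.pi_pos
    rcases le_total b (Real.pi / 2) with h | h
    · exact integral_line_eq (G := fun u => (sinh u)⁻¹) h
        (fun u h1 h2 => hd u (by linarith) (by linarith)) one_pos (x₀ := 1)
        (fun u _ _ h3 => norm_inv_sinh_le h3)
    · exact (integral_line_eq (G := fun u => (sinh u)⁻¹) h
        (fun u h1 h2 => hd u (by linarith) (by linarith)) one_pos (x₀ := 1)
        (fun u _ _ h3 => norm_inv_sinh_le h3)).symm
  rw [key]
  have e : ∀ x : ℝ, (sinh (x + ((Real.pi / 2 : ℝ) : ℂ) * I))⁻¹ = -I * (((Real.cosh x)⁻¹ : ℝ) : ℂ) := by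
    intro x
    rw [sinh_add, sinh_mul_I, cosh_mul_I]
    push_cast
    rw [Complex.sin_pi_div_two, Complex.cos_pi_div_two]
    simp [mul_comm]
  simp_rw [e]
  rw [integral_const_mul, integral_complex_ofReal, integral_inv_cosh]
  ring

lemma integral_inv_sinh_line_neg {b : ℝ} (h0 : 0 < b) (hπ : b < Real.pi) :
    ∫ x : ℝ, (sinh (x + ((-b : ℝ) : ℂ) * I))⁻¹ = Real.pi * I := by
  rw [← integral_neg_eq_self]
  have e : ∀ x : ℝ, (sinh (((-x : ℝ) : ℂ) + ((-b : ℝ) : ℂ) * I))⁻¹ = -(sinh (x + b * I))⁻¹ := by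
    intro x
    rw [← inv_neg, ← sinh_neg]
    congr 2
    push_cast; ring
  simp_rw [e]
  rw [integral_neg, integral_inv_sinh_line h0 hπ, neg_neg]

end SinhKernel

end SmoothedCalculus

end

noncomputable section

namespace SmoothedCalculus

/-! ### The Cauchy integral in logarithmic coordinates -/

section CauchyIntegral

variable {X : Type*} [NormedAddCommGroup X] [NormedSpace ℂ X]

/-- The integrand of the Cauchy integral in the logarithmic coordinate `z = exp u`. -/
def cauchyKer (A : X →ₗ.[ℂ] X) (g : ℂ → ℂ) (u : ℂ) : X →L[ℂ] X :=
  (g (exp u) * exp u) • resolv A (exp u)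

/-- With `z = exp u`, polynomial decay at both `0` and `∞` becomes exponential decay in `|u.re|`,
which is what contour shifts in a strip need. -/
lemma MemHZero.exists_exp_bound {θ : ℝ} {g : ℂ → ℂ} (hg : MemHZero θ g) (hπ : θ ≤ Real.pi) :
    ∃ C s : ℝ, 0 < s ∧ 0 < C ∧ ∀ u : ℂ, |u.im| < θ → ‖g (exp u)‖ ≤ C * Real.exp (-s * |u.re|) := by
  obtain ⟨C, s, hs, hb⟩ := hg.decay
  refine ⟨|C| + 1, s, hs, by positivity, fun u hu => ?_⟩
  refine (hb _ (exp_mem_sector hπ hu)).trans ?_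
  have e : min (‖exp u‖ ^ s) (‖exp u‖ ^ (-s)) = Real.exp (-s * |u.re|) := by
    rw [norm_exp, ← Real.exp_mul, ← Real.exp_mul]
    rcases le_total 0 u.re with h | h
    · rw [min_eq_right (Real.exp_le_exp.2 (by nlinarith)), abs_of_nonneg h]; ring_nf
    · rw [min_eq_left (Real.exp_le_exp.2 (by nlinarith)), abs_of_nonpos h]; ring_nf
  rw [e]
  gcongr
  exact (le_abs_self C).trans (by linarith)

lemma MemHZero.differentiableAt_exp {θ : ℝ} {g : ℂ → ℂ} (hg : MemHZero θ g) (h0 : 0 ≤ θ)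
    (hπ : θ ≤ Real.pi) {u : ℂ} (hu : |u.im| < θ) : DifferentiableAt ℂ (fun u => g (exp u)) u :=
  DifferentiableAt.comp u (hg.holo.differentiableAt
    ((isOpen_sector h0 hπ).mem_nhds (exp_mem_sector hπ hu))) differentiable_exp.differentiableAt

lemma IsZeroSectorial.exists_bound_exp {A : X →ₗ.[ℂ] X} (hA : IsZeroSectorial A) {b : ℝ}
    (hb : 0 < b) : ∃ C : ℝ, 0 < C ∧ ∀ u : ℂ, b ≤ |u.im| → |u.im| ≤ Real.pi →
      ‖exp u‖ * ‖resolv A (exp u)‖ ≤ C := by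
  rcases lt_or_ge b (2 * Real.pi) with hb2 | hb2
  -- Halving `b` makes the cosine comparison strict; for `b ≥ 2π` the claim is vacuous.
  · obtain ⟨C, hC, h⟩ := hA.exists_bound (θ := b / 2) (by linarith) (by linarith)
    refine ⟨C, hC, fun u h1 h2 => h _ ?_⟩
    rw [exp_re, norm_exp]
    refine mul_lt_mul_of_pos_left ?_ (Real.exp_pos _)
    rw [← Real.cos_abs u.im]
    exact Real.cos_lt_cos_of_nonneg_of_le_pi (by linarith) h2 (by linarith)
  · exact ⟨1, one_pos, fun u h1 h2 => by linarith [Real.pi_pos]⟩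

lemma IsZeroSectorial.exists_cauchyKer_bound {A : X →ₗ.[ℂ] X} (hA : IsZeroSectorial A) {θ b : ℝ}
    {g : ℂ → ℂ} (hg : MemHZero θ g) (hπ : θ ≤ Real.pi) (hb : 0 < b) :
    ∃ C s : ℝ, 0 < s ∧ 0 < C ∧ ∀ u : ℂ, b ≤ |u.im| → |u.im| < θ →
      ‖cauchyKer A g u‖ ≤ C * Real.exp (-s * |u.re|) := by
  obtain ⟨C, s, hs, hC, h⟩ := hg.exists_exp_bound hπ
  obtain ⟨C', hC', h'⟩ := hA.exists_bound_exp hb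
  refine ⟨C * C', s, hs, by positivity, fun u h1 h2 => ?_⟩
  rw [cauchyKer, norm_smul, norm_mul]
  calc _ = ‖g (exp u)‖ * (‖exp u‖ * ‖resolv A (exp u)‖) := by ring
    _ ≤ (C * Real.exp (-s * |u.re|)) * C' := by
        gcongr
        · exact h u h2
        · exact h' u h1 (by linarith)
    _ = _ := by ring

lemma IsZeroSectorial.differentiableAt_cauchyKer {A : X →ₗ.[ℂ] X} (hA : IsZeroSectorial A)
    {θ : ℝ} {g : ℂ → ℂ} (hg : MemHZero θ g) (hπ : θ ≤ Real.pi) {u : ℂ} (h0 : u.im ≠ 0)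
    (hu : |u.im| < θ) : DifferentiableAt ℂ (cauchyKer A g) u := by
  have hθ : 0 ≤ θ := (abs_nonneg _).trans hu.le
  refine ((hg.differentiableAt_exp hθ hπ hu).mul differentiable_exp.differentiableAt).smul ?_
  exact DifferentiableAt.comp u
    (hA.hasDerivAt_resolv (exp_mem_offAxis h0 (by linarith))).differentiableAt
    differentiable_exp.differentiableAt

lemma continuous_line {E : Type*} [NormedAddCommGroup E] [NormedSpace ℂ E] {G : ℂ → E} {b : ℝ}
    (h : ∀ u : ℂ, u.im = b → DifferentiableAt ℂ G u) : Continuous fun x : ℝ => G (x + b * I) := by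
  rw [continuous_iff_continuousAt]
  intro x
  have : ContinuousAt G ((x : ℂ) + b * I) := (h _ (by simp)).continuousAt
  exact ContinuousAt.comp (f := fun x : ℝ => (x : ℂ) + b * I) this (by fun_prop)

lemma IsZeroSectorial.continuous_cauchyKer {A : X →ₗ.[ℂ] X} (hA : IsZeroSectorial A)
    {θ b : ℝ} {g : ℂ → ℂ} (hg : MemHZero θ g) (hπ : θ ≤ Real.pi) (hb0 : b ≠ 0) (hb : |b| < θ) :
    Continuous fun x : ℝ => cauchyKer A g (x + b * I) :=
  continuous_line fun u hu => hA.differentiableAt_cauchyKer hg hπ (by rwa [hu]) (by rwa [hu])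

lemma IsZeroSectorial.integrable_cauchyKer {A : X →ₗ.[ℂ] X} (hA : IsZeroSectorial A)
    {θ b : ℝ} {g : ℂ → ℂ} (hg : MemHZero θ g) (hπ : θ ≤ Real.pi) (hb0 : b ≠ 0) (hb : |b| < θ) :
    Integrable fun x : ℝ => cauchyKer A g (x + b * I) := by
  obtain ⟨C, s, hs, _, h⟩ := hA.exists_cauchyKer_bound hg hπ (abs_pos.2 hb0)
  refine integrable_of_exp_decay (C := C) (x₀ := 0) (hA.continuous_cauchyKer hg hπ hb0 hb) hs
    fun x _ => ?_
  simpa using h (x + b * I) (by simp) (by simpa using hb)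

/-- The substitution `r = exp x` turns the rays of angle `±ν` into the horizontal lines of height
`±ν`; the Jacobian is absorbed in `cauchyKer`. -/
lemma cauchyInt_eq (A : X →ₗ.[ℂ] X) (ν : ℝ) (g : ℂ → ℂ) :
    cauchyInt A ν g = (2 * (Real.pi : ℂ) * I)⁻¹ •
      ((∫ x : ℝ, cauchyKer A g (x + ((-ν : ℝ) : ℂ) * I)) -
        ∫ x : ℝ, cauchyKer A g (x + (ν : ℂ) * I)) := by
  have key : ∀ b : ℝ, (∫ r in Ioi (0 : ℝ), (g (r * exp (b * I)) * exp (b * I)) •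
      resolv A (r * exp (b * I))) = ∫ x : ℝ, cauchyKer A g (x + (b : ℂ) * I) := by
    intro b
    rw [integral_Ioi_eq_integral_exp]
    refine integral_congr_ae (Eventually.of_forall fun x => ?_)
    simp only [cauchyKer, exp_add, ofReal_exp]
    rw [← algebraMap_smul ℂ (Real.exp x), smul_smul]
    simp only [coe_algebraMap, ofReal_exp]
    congr 1
    ring
  rw [cauchyInt, ← key, ← key]
  simp [neg_mul]

/-- The Cauchy integral does not depend on the angle of the contour. -/
lemma IsZeroSectorial.cauchyInt_congr_angle [CompleteSpace X] {A : X →ₗ.[ℂ] X}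
    (hA : IsZeroSectorial A) {θ ν ν' : ℝ} {g : ℂ → ℂ} (hg : MemHZero θ g) (hπ : θ ≤ Real.pi)
    (h0 : 0 < ν) (h1 : ν < θ) (h0' : 0 < ν') (h1' : ν' < θ) :
    cauchyInt A ν g = cauchyInt A ν' g := by
  wlog hle : ν ≤ ν' generalizing ν ν'
  · exact (this h0' h1' h0 h1 (le_of_not_ge hle)).symm
  obtain ⟨C, s, hs, _, h⟩ := hA.exists_cauchyKer_bound hg hπ h0
  rw [cauchyInt_eq, cauchyInt_eq]
  congr 2
  · refine (integral_line_eq (neg_le_neg hle) (C := C) (x₀ := 0) (fun u h2 h3 => ?_) hs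
      fun u h2 h3 _ => ?_).symm
    · exact hA.differentiableAt_cauchyKer hg hπ (by linarith) (by rw [abs_lt]; constructor <;> linarith)
    · exact h u (by rw [abs_of_nonpos] <;> linarith) (by rw [abs_lt]; constructor <;> linarith)
  · refine integral_line_eq hle (C := C) (x₀ := 0) (fun u h2 h3 => ?_) hs
      fun u h2 h3 _ => ?_
    · exact hA.differentiableAt_cauchyKer hg hπ (by linarith) (by rw [abs_lt]; constructor <;> linarith)
    · exact h u (by rw [abs_of_nonneg] <;> linarith) (by rw [abs_lt]; constructor <;> linarith)

lemma cauchyInt_congr (A : X →ₗ.[ℂ] X) {θ ν : ℝ} (hπ : θ ≤ Real.pi) (h0 : 0 < ν) (h1 : ν < θ)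
    {g g' : ℂ → ℂ} (h : ∀ z ∈ sector θ, g z = g' z) : cauchyInt A ν g = cauchyInt A ν g' := by
  rw [cauchyInt_eq, cauchyInt_eq]
  have key : ∀ b : ℝ, |b| < θ → (fun x : ℝ => cauchyKer A g (x + (b : ℂ) * I)) =
      fun x : ℝ => cauchyKer A g' (x + (b : ℂ) * I) := by
    intro b hb
    ext1 x
    rw [cauchyKer, cauchyKer, h _ (exp_mem_sector hπ (by simpa using hb))]
  rw [key, key]
  · rwa [abs_of_pos h0]
  · rwa [abs_neg, abs_of_pos h0]

/-- The left side is the distance from `exp u` to the line through `0` and `exp v`. It bounds Cauchy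
denominators from below, uniformly along two distinct rays. -/
lemma abs_sin_mul_exp_le (u v : ℂ) :
    |Real.sin (v.im - u.im)| * Real.exp u.re ≤ ‖exp v - exp u‖ := by
  have h1 : ‖exp v - exp u‖ = ‖exp u‖ * ‖exp (v - u) - 1‖ := by
    rw [← norm_mul, mul_sub, ← exp_add]; simp
  rw [h1, norm_exp, mul_comm]
  gcongr
  have h2 : |Real.sin (v.im - u.im)| ^ 2 ≤ ‖exp (v - u) - 1‖ ^ 2 := by
    rw [← Complex.normSq_eq_norm_sq, Complex.normSq_apply, sq_abs]
    simp only [sub_re, exp_re, one_re, sub_im, exp_im, one_im, sub_zero]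
    set p := Real.exp (v.re - u.re)
    have := Real.sin_sq_add_cos_sq (v.im - u.im)
    nlinarith [sq_nonneg (p - Real.cos (v.im - u.im))]
  exact (sq_le_sq₀ (abs_nonneg _) (norm_nonneg _)).1 h2

lemma abs_sin_mul_exp_le' (u v : ℂ) :
    |Real.sin (v.im - u.im)| * Real.exp v.re ≤ ‖exp v - exp u‖ := by
  have := abs_sin_mul_exp_le v u
  rwa [norm_sub_rev, ← neg_sub u.im v.im, Real.sin_neg, abs_neg]

/-- The scalar Cauchy integral over the boundary of a sector vanishes at exterior points. -/
lemma MemHZero.integral_eq_of_not_mem {θ ν : ℝ} {g : ℂ → ℂ} (hg : MemHZero θ g)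
    (hπ : θ ≤ Real.pi) (h0 : 0 < ν) (h1 : ν < θ) {w : ℂ} {c : ℝ} (hc : 0 < c)
    (hw : ∀ u : ℂ, |u.im| ≤ ν → c * ‖exp u‖ ≤ ‖w - exp u‖) :
    ∫ x : ℝ, g (exp (x + ((-ν : ℝ) : ℂ) * I)) * exp (x + ((-ν : ℝ) : ℂ) * I) /
        (w - exp (x + ((-ν : ℝ) : ℂ) * I)) =
      ∫ x : ℝ, g (exp (x + (ν : ℂ) * I)) * exp (x + (ν : ℂ) * I) /
        (w - exp (x + (ν : ℂ) * I)) := by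
  obtain ⟨C, s, hs, hC, h⟩ := hg.exists_exp_bound hπ
  refine integral_line_eq (G := fun u => g (exp u) * exp u / (w - exp u)) (by linarith)
    (C := C / c) (x₀ := 0) (s := s) (fun u h2 h3 => ?_) hs fun u h2 h3 _ => ?_
  · have hu : |u.im| ≤ ν := abs_le.2 ⟨h2, h3⟩
    refine ((hg.differentiableAt_exp (by linarith) hπ (by linarith)).mul
      differentiable_exp.differentiableAt).div (by fun_prop) ?_
    rw [← norm_pos_iff]
    exact lt_of_lt_of_le (mul_pos hc (norm_pos_iff.2 (exp_ne_zero u))) (hw u hu)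
  · have hu : |u.im| ≤ ν := abs_le.2 ⟨h2, h3⟩
    have h4 := hw u hu
    have h5 : 0 < ‖exp u‖ := norm_pos_iff.2 (exp_ne_zero u)
    rw [norm_div, norm_mul, div_le_iff₀ (lt_of_lt_of_le (by positivity) h4)]
    calc _ ≤ (C * Real.exp (-s * |u.re|)) * ‖exp u‖ := by
          gcongr; exact h u (by linarith)
      _ = (C / c * Real.exp (-s * |u.re|)) * (c * ‖exp u‖) := by field_simp
      _ ≤ _ := by gcongr

/-- The scalar Cauchy formula for the boundary of a sector. -/
lemma MemHZero.integral_sub_integral {θ ν : ℝ} {g : ℂ → ℂ} (hg : MemHZero θ g)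
    (hπ : θ ≤ Real.pi / 2) (h0 : 0 < ν) (h1 : ν < θ) {u : ℂ} (hu : |u.im| < ν) :
    (∫ x : ℝ, g (exp (x + ((-ν : ℝ) : ℂ) * I)) * exp (x + ((-ν : ℝ) : ℂ) * I) /
        (exp (x + ((-ν : ℝ) : ℂ) * I) - exp u)) -
      (∫ x : ℝ, g (exp (x + (ν : ℂ) * I)) * exp (x + (ν : ℂ) * I) /
        (exp (x + (ν : ℂ) * I) - exp u)) = 2 * Real.pi * I * g (exp u) := by
  have hpi := Real.pi_pos
  have hπ' : θ ≤ Real.pi := by linarith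
  have hu' := abs_lt.1 hu
  obtain ⟨C, s, hs, hC, h⟩ := hg.exists_exp_bound hπ'
  -- Since `2 exp w sinh w = (exp w - 1)(exp w + 1)`, the Cauchy integrand is `a v / sinh (v - u)`.
  -- Subtracting `a u` from the numerator removes the pole. The resulting `K` can be shifted from
  -- one line to the other, and the subtracted term is an explicit integral of `1 / sinh`.
  set a : ℂ → ℂ := fun v => g (exp v) * ((exp (v - u) + 1) / 2) with ha
  set sh : ℂ → ℂ := fun v => sinh (v - u) with hsh
  set K : ℂ → ℂ := fun v => dslope a u v / dslope sh u v with hK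
  have hadiff : ∀ v : ℂ, |v.im| < θ → DifferentiableAt ℂ a v := fun v hv =>
    (hg.differentiableAt_exp (by linarith) hπ' hv).mul (by fun_prop)
  have hstrip : IsOpen {v : ℂ | |v.im| < θ} := isOpen_lt (by fun_prop) (by fun_prop)
  have humem : {v : ℂ | |v.im| < θ} ∈ 𝓝 u := hstrip.mem_nhds (by simp only [mem_ofPred_eq]; linarith)
  have hdsa : DifferentiableOn ℂ (dslope a u) {v : ℂ | |v.im| < θ} :=
    (differentiableOn_dslope humem).2 fun v hv => (hadiff v hv).differentiableWithinAt
  have hdss : DifferentiableOn ℂ (dslope sh u) {v : ℂ | |v.im| < θ} :=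
    (differentiableOn_dslope humem).2 fun v hv => by
      refine DifferentiableAt.differentiableWithinAt ?_
      simp only [hsh]; fun_prop
  have hsh0 : sh u = 0 := by simp [hsh]
  have hne : ∀ v : ℂ, |v.im| ≤ ν → v ≠ u → sinh (v - u) ≠ 0 := by
    intro v hv hvu
    refine sinh_ne_zero_of_abs_im_lt (sub_ne_zero.2 hvu) ?_
    have := abs_le.1 hv
    rw [sub_im, abs_lt]; constructor <;> linarith
  have hdsne : ∀ v : ℂ, |v.im| ≤ ν → dslope sh u v ≠ 0 := by
    intro v hv
    rcases eq_or_ne v u with rfl | hvu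
    · rw [dslope_same]
      have : HasDerivAt sh (cosh (v - v) * 1) v := ((hasDerivAt_id v).sub_const v).csinh
      rw [this.deriv]; simp
    · rw [dslope_of_ne _ hvu, slope_def_field, hsh0, sub_zero]
      exact div_ne_zero (hne v hv hvu) (sub_ne_zero.2 hvu)
  have hKeq : ∀ v : ℂ, v ≠ u → K v = (a v - a u) * (sinh (v - u))⁻¹ := by
    intro v hvu
    simp only [hK]
    rw [dslope_of_ne _ hvu, dslope_of_ne _ hvu, slope_def_field, slope_def_field, hsh0, sub_zero,
      div_div_div_cancel_right₀ (sub_ne_zero.2 hvu), div_eq_mul_inv]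
  have hau : a u = g (exp u) := by simp [ha]
  -- The rate is `min s 1`: the part with `a v` inherits the decay of `g`, while the constant `a u`
  -- only has the decay of `1 / sinh`.
  have hKbound : ∀ v : ℂ, |v.im| ≤ ν → |u.re| + 1 ≤ |v.re| →
      ‖K v‖ ≤ (4 * C + 4 * ‖a u‖ * Real.exp |u.re|) * Real.exp (-(min s 1) * |v.re|) := by
    intro v hv hre
    have hr1 : 1 ≤ |(v - u).re| := by
      rw [sub_re]
      have := abs_sub_abs_le_abs_sub v.re u.re
      linarith
    have hvu : v ≠ u := by rintro rfl; simp at hr1; linarith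
    rw [hKeq v hvu, norm_mul]
    have h3 := norm_inv_sinh_le hr1
    have h4 : ‖a v‖ ≤ C * Real.exp (-s * |v.re|) * Real.exp |(v - u).re| := by
      simp only [ha]
      rw [norm_mul]
      gcongr
      · exact h v (by linarith)
      · rw [norm_div]
        have h5 : ‖exp (v - u) + 1‖ ≤ Real.exp |(v - u).re| + 1 := by
          refine (norm_add_le _ _).trans ?_
          rw [norm_exp, norm_one]
          gcongr; exact le_abs_self _
        have h6 : (1 : ℝ) ≤ Real.exp |(v - u).re| := Real.one_le_exp (abs_nonneg _)
        rw [Complex.norm_ofNat, div_le_iff₀ (by norm_num)]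
        linarith
    have h7 : Real.exp (-s * |v.re|) ≤ Real.exp (-(min s 1) * |v.re|) := by
      gcongr
      exact min_le_left _ _
    have h8 : Real.exp (-1 * |v.re|) ≤ Real.exp (-(min s 1) * |v.re|) := by
      gcongr
      exact min_le_right _ _
    have h9 : Real.exp (-1 * |(v - u).re|) ≤ Real.exp |u.re| * Real.exp (-1 * |v.re|) := by
      rw [← Real.exp_add]
      gcongr
      rw [sub_re]
      have := abs_sub_abs_le_abs_sub v.re u.re
      linarith
    have h10 : Real.exp |(v - u).re| * Real.exp (-1 * |(v - u).re|) = 1 := by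
      rw [← Real.exp_add]; simp
    calc ‖a v - a u‖ * ‖(sinh (v - u))⁻¹‖
        ≤ (C * Real.exp (-s * |v.re|) * Real.exp |(v - u).re| + ‖a u‖) *
          (4 * Real.exp (-1 * |(v - u).re|)) := by
          gcongr
          exact (norm_sub_le _ _).trans (by gcongr)
      _ = 4 * C * Real.exp (-s * |v.re|) *
          (Real.exp |(v - u).re| * Real.exp (-1 * |(v - u).re|)) +
          4 * ‖a u‖ * Real.exp (-1 * |(v - u).re|) := by ring
      _ ≤ 4 * C * Real.exp (-(min s 1) * |v.re|) +
          4 * ‖a u‖ * (Real.exp |u.re| * Real.exp (-(min s 1) * |v.re|)) := by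
          rw [h10, mul_one]
          gcongr
          exact h9.trans (by gcongr)
      _ = _ := by ring
  have hshift : ∫ x : ℝ, K (x + ((-ν : ℝ) : ℂ) * I) = ∫ x : ℝ, K (x + (ν : ℂ) * I) := by
    refine integral_line_eq (by linarith) (x₀ := |u.re| + 1) (fun v h2 h3 => ?_)
      (lt_min hs one_pos) fun v h2 h3 h4 => hKbound v (abs_le.2 ⟨h2, h3⟩) h4
    have hv : |v.im| ≤ ν := abs_le.2 ⟨h2, h3⟩
    have hm : {v : ℂ | |v.im| < θ} ∈ 𝓝 v := hstrip.mem_nhds (by simp only [mem_ofPred_eq]; linarith)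
    exact (hdsa.differentiableAt hm).div (hdss.differentiableAt hm) (hdsne v hv)
  have hline : ∀ b : ℝ, |b| = ν → (∫ x : ℝ, K (x + (b : ℂ) * I)) =
      (∫ x : ℝ, g (exp (x + (b : ℂ) * I)) * exp (x + (b : ℂ) * I) /
        (exp (x + (b : ℂ) * I) - exp u)) -
      g (exp u) * ∫ x : ℝ, (sinh (x + ((b - u.im : ℝ) : ℂ) * I))⁻¹ := by
    intro b hb
    have hbu : b ≠ u.im := by rintro rfl; linarith
    have hne2 : ∀ v : ℂ, v.im = b → v ≠ u := by rintro v hv rfl; exact hbu hv.symm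
    have e1 : ∀ v : ℂ, v.im = b →
        K v = g (exp v) * exp v / (exp v - exp u) - g (exp u) * (sinh (v - u))⁻¹ := by
      intro v hv
      have h2 := hne2 v hv
      rw [hKeq v h2, hau, sub_mul]
      congr 1
      have h3 : sinh (v - u) ≠ 0 := hne v (by rw [hv, hb]) h2
      have h5 : exp v - exp u = exp u * (exp (v - u) - 1) := by
        rw [mul_sub, ← exp_add]; simp
      have h6 : exp v = exp u * exp (v - u) := by rw [← exp_add]; simp
      have h7 : 2 * exp (v - u) * sinh (v - u) = (exp (v - u) - 1) * (exp (v - u) + 1) := by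
        rw [Complex.sinh]
        have : exp (v - u) * exp (-(v - u)) = 1 := by rw [← exp_add]; simp
        linear_combination -this
      have h8 : exp (v - u) - 1 ≠ 0 := by
        intro h8
        rw [h8, zero_mul] at h7
        exact h3 ((mul_eq_zero.1 h7).resolve_left (mul_ne_zero two_ne_zero (exp_ne_zero _)))
      have h9 : exp u ≠ 0 := exp_ne_zero u
      simp only [ha]
      rw [h5, h6]
      field_simp
      linear_combination (-g (exp u * exp (v - u))) * h7
    have hdg : ∀ v : ℂ, v.im = b → DifferentiableAt ℂ (fun v => g (exp u) * (sinh (v - u))⁻¹) v :=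
      fun v hv => (DifferentiableAt.inv (h := fun v => sinh (v - u)) (by fun_prop)
        (hne v (by rw [hv, hb]) (hne2 v hv))).const_mul _
    have hi2 : Integrable fun x : ℝ => g (exp u) * (sinh (x + (b : ℂ) * I - u))⁻¹ := by
      refine integrable_of_exp_decay (continuous_line hdg) one_pos
        (C := ‖g (exp u)‖ * (4 * Real.exp |u.re|)) (x₀ := |u.re| + 1) fun x hx => ?_
      rw [norm_mul, mul_assoc]
      gcongr
      have h4 := abs_sub_abs_le_abs_sub x u.re
      have e : ((x : ℂ) + b * I - u).re = x - u.re := by simp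
      refine (norm_inv_sinh_le (by rw [e]; linarith)).trans ?_
      rw [e, mul_assoc, ← Real.exp_add]
      gcongr
      linarith
    have hdf : ∀ v : ℂ, v.im = b → DifferentiableAt ℂ (fun v => g (exp v) * exp v / (exp v - exp u)) v := by
      intro v hv
      refine ((hg.differentiableAt_exp (by linarith) hπ' (by rw [hv]; linarith)).mul
        differentiable_exp.differentiableAt).div (by fun_prop) ?_
      have h2 := abs_sin_mul_exp_le u v
      rw [← norm_pos_iff]
      refine lt_of_lt_of_le (mul_pos (abs_pos.2 ?_) (Real.exp_pos _)) h2
      rw [hv]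
      have hb2 := abs_le.1 hb.le
      rcases hbu.lt_or_gt with h6 | h6
      · exact (Real.sin_neg_of_neg_of_neg_pi_lt (by linarith) (by linarith)).ne
      · exact (Real.sin_pos_of_pos_of_lt_pi (by linarith) (by linarith)).ne'
    have hi1 : Integrable fun x : ℝ => g (exp (x + (b : ℂ) * I)) * exp (x + (b : ℂ) * I) /
        (exp (x + (b : ℂ) * I) - exp u) := by
      have hsin : 0 < |Real.sin (b - u.im)| := by
        refine abs_pos.2 ?_
        have hb2 := abs_le.1 hb.le
        rcases hbu.lt_or_gt with h6 | h6
        · exact (Real.sin_neg_of_neg_of_neg_pi_lt (by linarith) (by linarith)).ne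
        · exact (Real.sin_pos_of_pos_of_lt_pi (by linarith) (by linarith)).ne'
      refine integrable_of_exp_decay (continuous_line hdf) hs
        (C := C / |Real.sin (b - u.im)|) (x₀ := 0) fun x _ => ?_
      have h2 := abs_sin_mul_exp_le' u (x + b * I)
      have h3 := h (x + b * I) (by simp only [add_im, ofReal_im, mul_im, ofReal_re, I_im, mul_one, I_re, mul_zero, add_zero, zero_add]; linarith)
      simp only [add_im, ofReal_im, mul_im, ofReal_re, I_im, mul_one, I_re, mul_zero, add_zero,
        zero_add, add_re, mul_re, sub_zero] at h2 h3
      rw [norm_div, norm_mul, norm_exp, div_le_iff₀ (lt_of_lt_of_le (by positivity) h2)]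
      simp only [add_re, ofReal_re, mul_re, I_re, mul_zero, ofReal_im, I_im, mul_one, sub_self, add_zero]
      calc _ ≤ (C * Real.exp (-s * |x|)) * Real.exp x := by gcongr
        _ = C / |Real.sin (b - u.im)| * Real.exp (-s * |x|) * (|Real.sin (b - u.im)| * Real.exp x) := by
            field_simp
        _ ≤ _ := by gcongr
    have e2 : ∀ x : ℝ, K (x + (b : ℂ) * I) = g (exp (x + (b : ℂ) * I)) * exp (x + (b : ℂ) * I) /
        (exp (x + (b : ℂ) * I) - exp u) - g (exp u) * (sinh (x + (b : ℂ) * I - u))⁻¹ :=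
      fun x => e1 _ (by simp)
    simp_rw [e2]
    rw [integral_sub hi1 hi2, integral_const_mul]
    congr 2
    rw [← integral_add_right_eq_self _ u.re]
    refine integral_congr_ae (Eventually.of_forall fun x => ?_)
    simp only
    congr 2
    apply Complex.ext <;> simp
  rw [hline (-ν) (by rw [abs_neg, abs_of_pos h0]), hline ν (abs_of_pos h0),
    integral_inv_sinh_line (b := ν - u.im) (by linarith) (by linarith),
    show (-ν - u.im) = -(ν + u.im) by ring,
    integral_inv_sinh_line_neg (b := ν + u.im) (by linarith) (by linarith)] at hshift
  linear_combination hshift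

end CauchyIntegral

end SmoothedCalculus

end

noncomputable section

namespace SmoothedCalculus

/-! ### Multiplicativity of the Cauchy integral -/

section Multiplicativity

variable {X : Type*} [NormedAddCommGroup X] [NormedSpace ℂ X]

lemma MemHZero.continuous_line {θ b : ℝ} {g : ℂ → ℂ} (hg : MemHZero θ g) (hπ : θ ≤ Real.pi)
    (hb : |b| < θ) : Continuous fun x : ℝ => g (exp (x + (b : ℂ) * I)) :=
  SmoothedCalculus.continuous_line (G := fun u => g (exp u)) fun _ hu =>
    hg.differentiableAt_exp ((abs_nonneg _).trans hb.le) hπ (by rwa [hu])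

lemma MemHZero.norm_div_sub_le {θ σ τ : ℝ} {g : ℂ → ℂ} (hg : MemHZero θ g) (hπ : θ ≤ Real.pi)
    (hτ : |τ| < θ) (hsin : Real.sin (τ - σ) ≠ 0) :
    ∃ C s : ℝ, 0 < s ∧ 0 < C ∧ ∀ x y : ℝ,
      ‖g (exp (y + (τ : ℂ) * I)) * exp (y + (τ : ℂ) * I) /
        (exp (y + (τ : ℂ) * I) - exp (x + (σ : ℂ) * I))‖ ≤ C * Real.exp (-s * |y|) := by
  obtain ⟨C, s, hs, hC, h⟩ := hg.exists_exp_bound hπ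
  have hc : 0 < |Real.sin (τ - σ)| := abs_pos.2 hsin
  refine ⟨C / |Real.sin (τ - σ)|, s, hs, by positivity, fun x y => ?_⟩
  have h2 := abs_sin_mul_exp_le' (x + σ * I) (y + τ * I)
  have h3 := h (y + τ * I) (by simpa using hτ)
  simp only [add_im, ofReal_im, mul_im, ofReal_re, I_im, mul_one, I_re, mul_zero, add_zero,
    zero_add, add_re, mul_re, sub_zero] at h2 h3
  rw [norm_div, norm_mul, norm_exp, div_le_iff₀ (lt_of_lt_of_le (by positivity) h2)]
  simp only [add_re, ofReal_re, mul_re, I_re, mul_zero, ofReal_im, I_im, mul_one, sub_self,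
    add_zero]
  calc _ ≤ (C * Real.exp (-s * |y|)) * Real.exp y := by gcongr
    _ = C / |Real.sin (τ - σ)| * Real.exp (-s * |y|) * (|Real.sin (τ - σ)| * Real.exp y) := by
        field_simp
    _ ≤ _ := by gcongr

lemma exp_line_sub_ne_zero {σ τ : ℝ} (hsin : Real.sin (τ - σ) ≠ 0) (x y : ℝ) :
    exp (y + (τ : ℂ) * I) - exp (x + (σ : ℂ) * I) ≠ 0 := by
  have h2 := abs_sin_mul_exp_le (x + σ * I) (y + τ * I)
  rw [← norm_pos_iff]
  refine lt_of_lt_of_le (mul_pos (abs_pos.2 ?_) (Real.exp_pos _)) h2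
  simpa using hsin

/-- The resolvent identity replaces a product of resolvents by their difference divided by `w - z`.
In each of the two resulting double integrals one variable occurs only in a scalar, and Fubini's
theorem isolates the scalar Cauchy integral. The condition on the sine keeps the two rays apart. -/
lemma IsZeroSectorial.integral_comp_integral [CompleteSpace X] {A : X →ₗ.[ℂ] X}
    (hA : IsZeroSectorial A) {θ σ τ : ℝ} {f g : ℂ → ℂ} (hf : MemHZero θ f) (hg : MemHZero θ g)
    (hπ : θ ≤ Real.pi) (hσ0 : σ ≠ 0) (hσ : |σ| < θ) (hτ0 : τ ≠ 0) (hτ : |τ| < θ)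
    (hsin : Real.sin (τ - σ) ≠ 0) :
    (∫ x : ℝ, cauchyKer A f (x + (σ : ℂ) * I)) ∘L (∫ y : ℝ, cauchyKer A g (y + (τ : ℂ) * I)) =
      (∫ x : ℝ, (∫ y : ℝ, g (exp (y + (τ : ℂ) * I)) * exp (y + (τ : ℂ) * I) /
        (exp (y + (τ : ℂ) * I) - exp (x + (σ : ℂ) * I))) • cauchyKer A f (x + (σ : ℂ) * I)) -
      ∫ y : ℝ, (∫ x : ℝ, f (exp (x + (σ : ℂ) * I)) * exp (x + (σ : ℂ) * I) /
        (exp (y + (τ : ℂ) * I) - exp (x + (σ : ℂ) * I))) • cauchyKer A g (y + (τ : ℂ) * I) := by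
  set a : ℝ → X →L[ℂ] X := fun x => cauchyKer A f (x + (σ : ℂ) * I) with ha
  set b : ℝ → X →L[ℂ] X := fun y => cauchyKer A g (y + (τ : ℂ) * I) with hb
  set Gk : ℝ → ℝ → ℂ := fun x y => g (exp (y + (τ : ℂ) * I)) * exp (y + (τ : ℂ) * I) /
        (exp (y + (τ : ℂ) * I) - exp (x + (σ : ℂ) * I)) with hGk
  set Fk : ℝ → ℝ → ℂ := fun x y => f (exp (x + (σ : ℂ) * I)) * exp (x + (σ : ℂ) * I) /
        (exp (y + (τ : ℂ) * I) - exp (x + (σ : ℂ) * I)) with hFk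
  have hac : Continuous a := hA.continuous_cauchyKer hf hπ hσ0 hσ
  have hbc : Continuous b := hA.continuous_cauchyKer hg hπ hτ0 hτ
  have hai : Integrable a := hA.integrable_cauchyKer hf hπ hσ0 hσ
  have hbi : Integrable b := hA.integrable_cauchyKer hg hπ hτ0 hτ
  have hfc := hf.continuous_line hπ hσ
  have hgc := hg.continuous_line hπ hτ
  have hGc : Continuous fun p : ℝ × ℝ => Gk p.1 p.2 :=
    ((hgc.comp continuous_snd).mul (by fun_prop)).div (by fun_prop)
      fun p => exp_line_sub_ne_zero hsin _ _
  have hFc : Continuous fun p : ℝ × ℝ => Fk p.1 p.2 :=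
    ((hfc.comp continuous_fst).mul (by fun_prop)).div (by fun_prop)
      fun p => exp_line_sub_ne_zero hsin _ _
  have hP : Integrable (fun p : ℝ × ℝ => Gk p.1 p.2 • a p.1) (volume.prod volume) := by
    obtain ⟨C, s, hs, hC, h⟩ := hg.norm_div_sub_le hπ hτ hsin
    refine Integrable.mono' (hai.norm.mul_prod ((integrable_exp_neg_mul_abs hs).const_mul C))
      (hGc.smul (hac.comp continuous_fst)).aestronglyMeasurable
      (Eventually.of_forall fun p => ?_)
    rw [norm_smul, mul_comm]
    gcongr
    exact h p.1 p.2
  have hN : Integrable (fun p : ℝ × ℝ => Fk p.1 p.2 • b p.2) (volume.prod volume) := by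
    have hsin' : Real.sin (σ - τ) ≠ 0 := by
      rw [← neg_sub, Real.sin_neg]; exact neg_ne_zero.2 hsin
    obtain ⟨C, s, hs, hC, h⟩ := hf.norm_div_sub_le hπ hσ hsin'
    refine Integrable.mono' (((integrable_exp_neg_mul_abs hs).const_mul C).mul_prod hbi.norm)
      (hFc.smul (hbc.comp continuous_snd)).aestronglyMeasurable
      (Eventually.of_forall fun p => ?_)
    rw [norm_smul]
    gcongr
    rw [hFk]
    simp only
    rw [norm_div, norm_sub_rev, ← norm_div]
    exact h p.2 p.1
  have hab : ∀ x y, a x ∘L b y = Gk x y • a x - Fk x y • b y := by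
    intro x y
    have hz : exp (x + (σ : ℂ) * I) ∈ offAxis := exp_mem_offAxis (by simpa using hσ0)
      (by simpa using hσ.le.trans hπ)
    have hw : exp (y + (τ : ℂ) * I) ∈ offAxis := exp_mem_offAxis (by simpa using hτ0)
      (by simpa using hτ.le.trans hπ)
    have hne := exp_line_sub_ne_zero hsin x y
    have hid := hA.resolvent_identity hz hw
    have hid2 : resolv A (exp (x + (σ : ℂ) * I)) ∘L resolv A (exp (y + (τ : ℂ) * I)) =
        (exp (y + (τ : ℂ) * I) - exp (x + (σ : ℂ) * I))⁻¹ •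
          (resolv A (exp (x + (σ : ℂ) * I)) - resolv A (exp (y + (τ : ℂ) * I))) := by
      rw [hid, smul_smul, inv_mul_cancel₀ hne, one_smul]
    simp only [ha, hb, hGk, hFk, cauchyKer, ContinuousLinearMap.smul_comp,
      ContinuousLinearMap.comp_smul, hid2, smul_sub, smul_smul, div_eq_mul_inv]
    congr 2 <;> ring
  have e1 : (∫ x, a x) ∘L (∫ y, b y) = ∫ x, ∫ y, a x ∘L b y := by
    have h1 := ((ContinuousLinearMap.compL ℂ X X X).flip (∫ y, b y)).integral_comp_comm hai
    simp only [ContinuousLinearMap.flip_apply, ContinuousLinearMap.compL_apply] at h1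
    rw [← h1]
    refine integral_congr_ae (Eventually.of_forall fun x => ?_)
    have h2 := (ContinuousLinearMap.compL ℂ X X X (a x)).integral_comp_comm hbi
    simp only [ContinuousLinearMap.compL_apply] at h2
    exact h2.symm
  rw [e1]
  simp_rw [hab]
  rw [integral_integral_sub hP hN]
  congr 1
  · refine integral_congr_ae (Eventually.of_forall fun x => ?_)
    exact integral_smul_const (fun y => Gk x y) (a x)
  · rw [integral_integral_swap hN]
    refine integral_congr_ae (Eventually.of_forall fun y => ?_)
    exact integral_smul_const (fun x => Fk x y) (b y)

/-- The Cauchy integral is multiplicative on `H₀^∞`. -/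
lemma IsZeroSectorial.cauchyInt_mul [CompleteSpace X] {A : X →ₗ.[ℂ] X}
    (hA : IsZeroSectorial A) {θ ν : ℝ} {f g : ℂ → ℂ} (hf : MemHZero θ f) (hg : MemHZero θ g)
    (hπ : θ ≤ Real.pi / 2) (h0 : 0 < ν) (h1 : ν < θ) :
    cauchyInt A ν (fun z => f z * g z) = cauchyInt A ν f ∘L cauchyInt A ν g := by
  have hpi := Real.pi_pos
  have hπ' : θ ≤ Real.pi := by linarith
  -- The contour for `g` is opened to a larger angle, so that it encloses the contour for `f`
  -- without meeting it.
  obtain ⟨ν', h2, h3⟩ := exists_between h1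
  have h0' : 0 < ν' := h0.trans h2
  rw [hA.cauchyInt_congr_angle hg hπ' h0 h1 h0' h3]
  simp only [cauchyInt_eq]
  have hs1 : ∀ τ : ℝ, 0 < τ → τ < Real.pi → Real.sin τ ≠ 0 :=
    fun τ h h' => (Real.sin_pos_of_pos_of_lt_pi h h').ne'
  have hs2 : ∀ τ : ℝ, τ < 0 → -Real.pi < τ → Real.sin τ ≠ 0 :=
    fun τ h h' => (Real.sin_neg_of_neg_of_neg_pi_lt h h').ne
  have hν : |ν| < θ := by rwa [abs_of_pos h0]
  have hν' : |ν'| < θ := by rwa [abs_of_pos h0']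
  have hnν : |-ν| < θ := by rwa [abs_neg]
  have hnν' : |-ν'| < θ := by rwa [abs_neg]
  have key := fun σ τ => hA.integral_comp_integral (σ := σ) (τ := τ) hf hg hπ'
  have k1 := key (-ν) (-ν') (by linarith) hnν (by linarith) hnν' (hs2 _ (by linarith) (by linarith))
  have k2 := key (-ν) ν' (by linarith) hnν (by linarith) hν' (hs1 _ (by linarith) (by linarith))
  have k3 := key ν (-ν') (by linarith) hν (by linarith) hnν' (hs2 _ (by linarith) (by linarith))
  have k4 := key ν ν' (by linarith) hν (by linarith) hν' (hs1 _ (by linarith) (by linarith))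
  have hint : ∀ σ τ : ℝ, σ ≠ 0 → |σ| < θ → |τ| < θ → Real.sin (τ - σ) ≠ 0 →
      Integrable fun x : ℝ => (∫ y : ℝ, g (exp (y + (τ : ℂ) * I)) * exp (y + (τ : ℂ) * I) /
        (exp (y + (τ : ℂ) * I) - exp (x + (σ : ℂ) * I))) • cauchyKer A f (x + (σ : ℂ) * I) := by
    intro σ τ hσ0 hσ hτ hsin
    have hai := hA.integrable_cauchyKer hf hπ' hσ0 hσ
    have hac := hA.continuous_cauchyKer hf hπ' hσ0 hσ
    have hgc := hg.continuous_line hπ' hτ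
    have hGc : Continuous fun p : ℝ × ℝ => g (exp (p.2 + (τ : ℂ) * I)) * exp (p.2 + (τ : ℂ) * I) /
        (exp (p.2 + (τ : ℂ) * I) - exp (p.1 + (σ : ℂ) * I)) :=
      ((hgc.comp continuous_snd).mul (by fun_prop)).div (by fun_prop)
        fun p => exp_line_sub_ne_zero hsin _ _
    obtain ⟨C, s, hs, hC, h⟩ := hg.norm_div_sub_le hπ' hτ hsin
    have hP : Integrable (fun p : ℝ × ℝ => (g (exp (p.2 + (τ : ℂ) * I)) * exp (p.2 + (τ : ℂ) * I) /
        (exp (p.2 + (τ : ℂ) * I) - exp (p.1 + (σ : ℂ) * I))) • cauchyKer A f (p.1 + (σ : ℂ) * I))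
        (volume.prod volume) := by
      refine Integrable.mono' (hai.norm.mul_prod ((integrable_exp_neg_mul_abs hs).const_mul C))
        (hGc.smul (hac.comp continuous_fst)).aestronglyMeasurable
        (Eventually.of_forall fun p => ?_)
      rw [norm_smul, mul_comm]
      gcongr
      exact h p.1 p.2
    refine hP.integral_prod_left.congr (Eventually.of_forall fun x => ?_)
    exact integral_smul_const (fun y : ℝ => g (exp (y + (τ : ℂ) * I)) * exp (y + (τ : ℂ) * I) /
        (exp (y + (τ : ℂ) * I) - exp (x + (σ : ℂ) * I))) (cauchyKer A f (x + (σ : ℂ) * I))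
  -- Points of the inner contour lie inside the outer one, so the scalar Cauchy formula reproduces
  -- `g` there.
  have hcomb : ∀ σ : ℝ, |σ| = ν → (∫ x : ℝ, (∫ y : ℝ, g (exp (y + ((-ν' : ℝ) : ℂ) * I)) *
      exp (y + ((-ν' : ℝ) : ℂ) * I) / (exp (y + ((-ν' : ℝ) : ℂ) * I) - exp (x + (σ : ℂ) * I))) •
        cauchyKer A f (x + (σ : ℂ) * I)) -
      (∫ x : ℝ, (∫ y : ℝ, g (exp (y + (ν' : ℂ) * I)) * exp (y + (ν' : ℂ) * I) /
        (exp (y + (ν' : ℂ) * I) - exp (x + (σ : ℂ) * I))) • cauchyKer A f (x + (σ : ℂ) * I)) =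
      (2 * Real.pi * I : ℂ) • ∫ x : ℝ, cauchyKer A (fun z => f z * g z) (x + (σ : ℂ) * I) := by
    intro σ hσ
    have hσ0 : σ ≠ 0 := by rintro rfl; simp at hσ; linarith
    have hb := abs_le.1 hσ.le
    rw [← integral_sub (hint σ (-ν') hσ0 (by rwa [hσ]) hnν' (hs2 _ (by linarith) (by linarith)))
      (hint σ ν' hσ0 (by rwa [hσ]) hν' (hs1 _ (by linarith) (by linarith))), ← integral_smul]
    refine integral_congr_ae (Eventually.of_forall fun x => ?_)
    simp only
    rw [← sub_smul, hg.integral_sub_integral hπ h0' h3 (by simpa [hσ] using h2)]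
    simp only [cauchyKer, smul_smul]
    congr 1; ring
  -- Points of the outer contour are exterior to the inner one, so the contributions of the two
  -- inner rays cancel.
  have hzero : ∀ τ : ℝ, |τ| = ν' → (∫ y : ℝ, (∫ x : ℝ, f (exp (x + ((-ν : ℝ) : ℂ) * I)) *
      exp (x + ((-ν : ℝ) : ℂ) * I) / (exp (y + (τ : ℂ) * I) - exp (x + ((-ν : ℝ) : ℂ) * I))) •
        cauchyKer A g (y + (τ : ℂ) * I)) =
      ∫ y : ℝ, (∫ x : ℝ, f (exp (x + (ν : ℂ) * I)) * exp (x + (ν : ℂ) * I) /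
        (exp (y + (τ : ℂ) * I) - exp (x + (ν : ℂ) * I))) • cauchyKer A g (y + (τ : ℂ) * I) := by
    intro τ hτ
    refine integral_congr_ae (Eventually.of_forall fun y => ?_)
    simp only
    congr 1
    have hs : ∀ u : ℂ, |u.im| ≤ ν → min (Real.sin (ν' - ν)) (Real.sin (ν' + ν)) * ‖exp u‖ ≤
        ‖exp (y + (τ : ℂ) * I) - exp u‖ := by
      intro u hu
      have h4 := abs_sin_mul_exp_le u (y + τ * I)
      rw [norm_exp]
      refine le_trans ?_ h4
      gcongr
      simp only [add_im, ofReal_im, mul_im, ofReal_re, I_im, mul_one, I_re, mul_zero, add_zero,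
        zero_add]
      have hu' := abs_le.1 hu
      -- Sine is concave on `[0, π]`, hence its minimum over the possible angle differences is
      -- attained at an endpoint.
      have hconc : ∀ q, ν' - ν ≤ q → q ≤ ν' + ν →
          min (Real.sin (ν' - ν)) (Real.sin (ν' + ν)) ≤ Real.sin q := fun q hq1 hq2 => by
        have hcon := strictConcaveOn_sin_Icc.concaveOn
        exact hcon.min_le_of_mem_Icc ⟨by linarith, by linarith⟩ ⟨by linarith, by linarith⟩ ⟨hq1, hq2⟩
      rcases abs_eq h0'.le |>.1 hτ with rfl | rfl
      · exact (hconc _ (by linarith) (by linarith)).trans (le_abs_self _)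
      · refine (hconc (ν' + u.im) (by linarith) (by linarith)).trans ?_
        rw [← abs_neg, ← Real.sin_neg]
        refine le_trans (le_of_eq ?_) (le_abs_self _)
        congr 1; ring
    refine hf.integral_eq_of_not_mem hπ' h0 h1 (c := min (Real.sin (ν' - ν)) (Real.sin (ν' + ν)))
      (lt_min ?_ ?_) hs
    · exact Real.sin_pos_of_pos_of_lt_pi (by linarith) (by linarith)
    · exact Real.sin_pos_of_pos_of_lt_pi (by linarith) (by linarith)
  simp only [ContinuousLinearMap.smul_comp, ContinuousLinearMap.comp_smul,
    ContinuousLinearMap.sub_comp, ContinuousLinearMap.comp_sub]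
  rw [k1, k2, k3, k4, hzero (-ν') (by rw [abs_neg, abs_of_pos h0']), hzero ν' (abs_of_pos h0')]
  have c1 := hcomb (-ν) (by rw [abs_neg, abs_of_pos h0])
  have c2 := hcomb ν (abs_of_pos h0)
  rw [sub_eq_iff_eq_add] at c1 c2
  rw [c1, c2]
  have h2pi : (2 * Real.pi * I : ℂ) ≠ 0 := by simp [Real.pi_ne_zero]
  simp only [smul_sub, smul_add, smul_smul]
  have e : (2 * (Real.pi : ℂ) * I)⁻¹ * ((2 * (Real.pi : ℂ) * I)⁻¹ * (2 * (Real.pi : ℂ) * I)) =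
    (2 * (Real.pi : ℂ) * I)⁻¹ := by rw [inv_mul_cancel₀ h2pi, mul_one]
  rw [e]
  abel

lemma IsZeroSectorial.cauchyInt_comm [CompleteSpace X] {A : X →ₗ.[ℂ] X}
    (hA : IsZeroSectorial A) {θ ν : ℝ} {f g : ℂ → ℂ} (hf : MemHZero θ f) (hg : MemHZero θ g)
    (hπ : θ ≤ Real.pi / 2) (h0 : 0 < ν) (h1 : ν < θ) :
    cauchyInt A ν f ∘L cauchyInt A ν g = cauchyInt A ν g ∘L cauchyInt A ν f := by
  rw [← hA.cauchyInt_mul hf hg hπ h0 h1, ← hA.cauchyInt_mul hg hf hπ h0 h1]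
  simp_rw [mul_comm]

/-- A resolvent at a negative point times a Cauchy integral. -/
lemma IsZeroSectorial.resolv_comp_cauchyInt [CompleteSpace X] {A : X →ₗ.[ℂ] X}
    (hA : IsZeroSectorial A) {θ ν : ℝ} {g : ℂ → ℂ} (hg : MemHZero θ g)
    (hπ : θ ≤ Real.pi / 2) (h0 : 0 < ν) (h1 : ν < θ) {r : ℝ} (hr : 0 < r) :
    resolv A (-(r : ℂ)) ∘L cauchyInt A ν g = cauchyInt A ν fun z => g z / (-(r : ℂ) - z) := by
  have hpi := Real.pi_pos
  have hπ' : θ ≤ Real.pi := by linarith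
  have hre : ∀ u : ℂ, |u.im| ≤ ν → 0 ≤ (exp u).re := fun u hu =>
    (re_pos_of_mem_sector hπ (exp_mem_sector hπ' (hu.trans_lt h1))).le
  -- As `exp u` has nonnegative real part, moving it by `r` to the right cannot shorten it. Thus
  -- `-r` is exterior to the contour with constant `1`.
  have hlow : ∀ u : ℂ, |u.im| ≤ ν → 1 * ‖exp u‖ ≤ ‖-(r : ℂ) - exp u‖ := by
    intro u hu
    rw [one_mul]
    refine (sq_le_sq₀ (norm_nonneg _) (norm_nonneg _)).1 ?_
    rw [← Complex.normSq_eq_norm_sq, ← Complex.normSq_eq_norm_sq, Complex.normSq_apply,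
      Complex.normSq_apply]
    have := hre u hu
    simp only [sub_re, neg_re, ofReal_re, sub_im, neg_im, ofReal_im]
    nlinarith
  have hlow2 : ∀ u : ℂ, |u.im| ≤ ν → r ≤ ‖-(r : ℂ) - exp u‖ := by
    intro u hu
    have := hre u hu
    have h2 := Complex.abs_re_le_norm (-(r : ℂ) - exp u)
    have h3 := neg_abs_le ((-(r : ℂ) - exp u).re)
    simp only [sub_re, neg_re, ofReal_re] at h2 h3
    linarith
  have hline : ∀ b : ℝ, b ≠ 0 → |b| = ν →
      resolv A (-(r : ℂ)) ∘L (∫ x : ℝ, cauchyKer A g (x + (b : ℂ) * I)) =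
      (∫ x : ℝ, cauchyKer A (fun z => g z / (-(r : ℂ) - z)) (x + (b : ℂ) * I)) -
      (∫ x : ℝ, g (exp (x + (b : ℂ) * I)) * exp (x + (b : ℂ) * I) /
        (-(r : ℂ) - exp (x + (b : ℂ) * I))) • resolv A (-(r : ℂ)) := by
    intro b hb0 hb
    have hbθ : |b| < θ := by rwa [hb]
    have hai := hA.integrable_cauchyKer hg hπ' hb0 hbθ
    have hne : ∀ x : ℝ, -(r : ℂ) - exp (x + (b : ℂ) * I) ≠ 0 := fun x => by
      rw [← norm_pos_iff]
      exact hr.trans_le (hlow2 _ (by simpa using hb.le))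
    have hac := hA.continuous_cauchyKer hg hπ' hb0 hbθ
    have hcc : Continuous fun x : ℝ => (-(r : ℂ) - exp (x + (b : ℂ) * I))⁻¹ :=
      Continuous.inv₀ (by fun_prop) hne
    have hi1 : Integrable fun x : ℝ => cauchyKer A (fun z => g z / (-(r : ℂ) - z)) (x + (b : ℂ) * I) := by
      have : Integrable fun x : ℝ => (-(r : ℂ) - exp (x + (b : ℂ) * I))⁻¹ •
          cauchyKer A g (x + (b : ℂ) * I) := by
        refine Integrable.mono' (hai.norm.const_mul r⁻¹)
          (hcc.smul hac).aestronglyMeasurable (Eventually.of_forall fun x => ?_)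
        rw [norm_smul, norm_inv]
        gcongr
        exact hlow2 _ (by simpa using hb.le)
      refine this.congr (Eventually.of_forall fun x => ?_)
      simp only [cauchyKer, smul_smul]
      congr 1
      field_simp
    have hi2 : Integrable fun x : ℝ => g (exp (x + (b : ℂ) * I)) * exp (x + (b : ℂ) * I) /
        (-(r : ℂ) - exp (x + (b : ℂ) * I)) := by
      obtain ⟨C, s, hs, hC, h⟩ := hg.exists_exp_bound hπ'
      refine integrable_of_exp_decay (((hg.continuous_line hπ' hbθ).mul (by fun_prop)).div
        (by fun_prop) hne) hs (C := C) (x₀ := 0) fun x _ => ?_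
      have h3 := h (x + b * I) (by simpa using hbθ)
      have h4 := hlow (x + b * I) (by simpa using hb.le)
      have h5 : 0 < ‖exp (x + b * I)‖ := norm_pos_iff.2 (exp_ne_zero _)
      rw [one_mul] at h4
      simp only [add_re, ofReal_re, mul_re, I_re, mul_zero, ofReal_im, I_im, mul_one, sub_self,
        add_zero] at h3
      rw [norm_div, norm_mul, div_le_iff₀ (h5.trans_le h4)]
      gcongr
    have h2 := (ContinuousLinearMap.compL ℂ X X X (resolv A (-(r : ℂ)))).integral_comp_comm hai
    simp only [ContinuousLinearMap.compL_apply] at h2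
    have h3 := integral_smul_const (μ := volume) (fun x : ℝ => g (exp (x + (b : ℂ) * I)) *
      exp (x + (b : ℂ) * I) / (-(r : ℂ) - exp (x + (b : ℂ) * I))) (resolv A (-(r : ℂ)))
    rw [← h2, ← h3, ← integral_sub hi1 (hi2.smul_const _)]
    refine integral_congr_ae (Eventually.of_forall fun x => ?_)
    simp only
    have hz : exp (x + (b : ℂ) * I) ∈ offAxis := exp_mem_offAxis (by simpa using hb0)
      (by simpa using hbθ.le.trans hπ')
    have hμ := neg_ofReal_mem_offAxis hr
    have hid := hA.resolvent_identity hz hμ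
    rw [hA.resolv_comm hz hμ] at hid
    have hid2 : resolv A (-(r : ℂ)) ∘L resolv A (exp (x + (b : ℂ) * I)) =
        (-(r : ℂ) - exp (x + (b : ℂ) * I))⁻¹ •
          (resolv A (exp (x + (b : ℂ) * I)) - resolv A (-(r : ℂ))) := by
      rw [hid, smul_smul, inv_mul_cancel₀ (hne x), one_smul]
    simp only [cauchyKer, ContinuousLinearMap.comp_smul, hid2, smul_sub, smul_smul, div_eq_mul_inv]
    congr 2; ring
  rw [cauchyInt_eq, cauchyInt_eq, ContinuousLinearMap.comp_smul, ContinuousLinearMap.comp_sub,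
    hline (-ν) (by linarith) (by rw [abs_neg, abs_of_pos h0]), hline ν h0.ne' (abs_of_pos h0),
    hg.integral_eq_of_not_mem hπ' h0 h1 one_pos hlow]
  congr 1
  abel

end Multiplicativity

end SmoothedCalculus

end

noncomputable section

namespace SmoothedCalculus

/-! ### Damping by exp (-s z⁴) on narrow sectors -/

section SectorEstimates

/-- The angle `1 / 8` keeps the argument of `z ^ 4` within `1 / 2`, where the cosine is at least `7
/ 8`. -/
lemma half_norm_pow_four_le {θ : ℝ} (hθ : θ ≤ 1 / 8) {z : ℂ} (hz : z ∈ sector θ) :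
    ‖z‖ ^ 4 / 2 ≤ (z ^ 4).re := by
  have h1 : z ^ 4 = ((‖z‖ ^ 4 : ℝ) : ℂ) * exp (((4 * z.arg : ℝ) : ℂ) * I) := by
    conv_lhs => rw [← Complex.norm_mul_exp_arg_mul_I z]
    rw [mul_pow, ← Complex.exp_nat_mul]
    push_cast
    congr 2
    ring
  rw [h1, re_ofReal_mul, exp_ofReal_mul_I_re, div_eq_mul_inv]
  gcongr
  have h2 := Real.one_sub_sq_div_two_le_cos (x := 4 * z.arg)
  have h3 := abs_lt.1 (hz.2.trans_le hθ)
  nlinarith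

lemma norm_exp_neg_mul_pow_four_le {θ s : ℝ} (hθ : θ ≤ 1 / 8) (hs : 0 ≤ s) {z : ℂ}
    (hz : z ∈ sector θ) : ‖exp (-(s : ℂ) * z ^ 4)‖ ≤ Real.exp (-(s / 2) * ‖z‖ ^ 4) := by
  rw [norm_exp, ← ofReal_neg, re_ofReal_mul]
  refine Real.exp_le_exp.2 ?_
  have := mul_le_mul_of_nonneg_left (half_norm_pow_four_le hθ hz) hs
  linarith

/-- Interpolates between the bounds by `2` and by `2‖w‖`. A small power `κ` gains smallness in `s`
from `w = s z⁴` at a low price in growth at infinity. -/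
lemma norm_one_sub_exp_neg_le {w : ℂ} (hw : 0 ≤ w.re) {κ : ℝ} (h0 : 0 ≤ κ) (h1 : κ ≤ 1) :
    ‖1 - exp (-w)‖ ≤ 2 * ‖w‖ ^ κ := by
  rcases le_total ‖w‖ 1 with h | h
  · rcases (norm_nonneg w).eq_or_lt' with h2 | h2
    · rw [norm_eq_zero.1 h2]; simp; positivity
    have := Complex.norm_exp_sub_one_le (x := -w) (by simpa)
    rw [norm_sub_rev]
    refine this.trans ?_
    rw [norm_neg]
    gcongr
    conv_lhs => rw [← Real.rpow_one ‖w‖]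
    exact Real.rpow_le_rpow_of_exponent_ge h2 h h1
  · calc ‖1 - exp (-w)‖ ≤ 1 + 1 := by
          refine (norm_sub_le _ _).trans ?_
          rw [norm_one, norm_exp]
          gcongr
          exact Real.exp_le_one_iff.2 (by simpa)
      _ ≤ 2 * ‖w‖ ^ κ := by
          have := Real.one_le_rpow h h0
          linarith

lemma exists_exp_mul_sub_le (K : ℝ) {s : ℝ} (hs : 0 < s) :
    ∃ B : ℝ, 0 < B ∧ ∀ r : ℝ, 0 ≤ r → Real.exp (K * r) * Real.exp (-s * r ^ 4) ≤ B := by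
  -- Beyond `R` the quartic wins, since `r ^ 4 ≥ r R` and `s R ≥ |K|`; below `R` the exponential is
  -- at most `exp (|K| R)`.
  set R := max 1 (|K| / s) with hR
  refine ⟨Real.exp (|K| * R), Real.exp_pos _, fun r hr => ?_⟩
  rw [← Real.exp_add]
  gcongr
  have hK := le_abs_self K
  have hK0 := abs_nonneg K
  have h1 : 1 ≤ R := le_max_left _ _
  have h2 : |K| ≤ s * R := by
    have := le_max_right 1 (|K| / s)
    rw [div_le_iff₀ hs, mul_comm] at this
    exact this
  rcases le_total r R with h | h
  · have : 0 ≤ s * r ^ 4 := by positivity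
    nlinarith
  · have h3 : r * R ≤ r ^ 4 := by
      have : r ^ 2 ≤ r ^ 4 := pow_le_pow_right₀ (h1.trans h) (by norm_num)
      nlinarith
    have : |K| * r ≤ s * r ^ 4 := by nlinarith
    have : 0 ≤ |K| * R := by positivity
    nlinarith

/-- Holomorphic functions on a sector of at most exponential growth. -/
structure ExpGrowth (θ : ℝ) (F : ℂ → ℂ) : Prop where
  holo : DifferentiableOn ℂ F (sector θ)
  growth : ∃ C K : ℝ, 0 ≤ C ∧ ∀ z ∈ sector θ, ‖F z‖ ≤ C * Real.exp (K * ‖z‖)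

lemma ExpGrowth.of_bounded {θ : ℝ} {F : ℂ → ℂ} (hF : DifferentiableOn ℂ F (sector θ)) {C : ℝ}
    (h : ∀ z ∈ sector θ, ‖F z‖ ≤ C) : ExpGrowth θ F :=
  ⟨hF, |C|, 0, abs_nonneg _, fun z hz => by simpa using (h z hz).trans (le_abs_self C)⟩

lemma ExpGrowth.mul {θ : ℝ} {F G : ℂ → ℂ} (hF : ExpGrowth θ F) (hG : ExpGrowth θ G) :
    ExpGrowth θ fun z => F z * G z := by
  obtain ⟨C, K, hC, h⟩ := hF.growth
  obtain ⟨C', K', hC', h'⟩ := hG.growth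
  refine ⟨hF.holo.mul hG.holo, C * C', K + K', by positivity, fun z hz => ?_⟩
  rw [norm_mul, add_mul, Real.exp_add]
  calc _ ≤ (C * Real.exp (K * ‖z‖)) * (C' * Real.exp (K' * ‖z‖)) := by
        gcongr
        · exact h z hz
        · exact h' z hz
    _ = _ := by ring

lemma ExpGrowth.add {θ : ℝ} {F G : ℂ → ℂ} (hF : ExpGrowth θ F) (hG : ExpGrowth θ G) :
    ExpGrowth θ fun z => F z + G z := by
  obtain ⟨C, K, hC, h⟩ := hF.growth
  obtain ⟨C', K', hC', h'⟩ := hG.growth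
  refine ⟨hF.holo.add hG.holo, C + C', max K K', by positivity, fun z hz => ?_⟩
  refine (norm_add_le _ _).trans ?_
  rw [add_mul]
  gcongr
  · exact (h z hz).trans (by gcongr; exact le_max_left _ _)
  · exact (h' z hz).trans (by gcongr; exact le_max_right _ _)

lemma ExpGrowth.const (θ : ℝ) (c : ℂ) : ExpGrowth θ fun _ => c :=
  ExpGrowth.of_bounded (differentiableOn_const _) (C := ‖c‖) fun _ _ => le_rfl

lemma MemHZero.congr {θ : ℝ} {F G : ℂ → ℂ} (hF : MemHZero θ F)
    (h : ∀ z ∈ sector θ, F z = G z) : MemHZero θ G := by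
  obtain ⟨C, K, hC, hb⟩ := hF.decay
  exact ⟨hF.holo.congr fun z hz => (h z hz).symm, C, K, hC, fun z hz => h z hz ▸ hb z hz⟩

lemma MemHZero.mul_bounded {θ : ℝ} {g G : ℂ → ℂ} (hg : MemHZero θ g)
    (hG : DifferentiableOn ℂ G (sector θ)) {B : ℝ} (h : ∀ z ∈ sector θ, ‖G z‖ ≤ B) :
    MemHZero θ fun z => g z * G z := by
  obtain ⟨C, s, hs, hb⟩ := hg.decay
  refine ⟨hg.holo.mul hG, C * B, s, hs, fun z hz => ?_⟩
  rw [norm_mul]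
  calc _ ≤ (C * min (‖z‖ ^ s) (‖z‖ ^ (-s))) * B :=
        mul_le_mul (hb z hz) (h z hz) (norm_nonneg _) ((norm_nonneg _).trans (hb z hz))
    _ = _ := by ring

lemma MemHZero.bounded {θ : ℝ} {g : ℂ → ℂ} (hg : MemHZero θ g) :
    ∃ C, ∀ z ∈ sector θ, ‖g z‖ ≤ C := by
  obtain ⟨C, s, hs, hb⟩ := hg.decay
  refine ⟨|C|, fun z hz => (hb z hz).trans ?_⟩
  have h0 : 0 < ‖z‖ := norm_pos_iff.2 hz.1
  have h1 : min (‖z‖ ^ s) (‖z‖ ^ (-s)) ≤ 1 := by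
    rcases le_total ‖z‖ 1 with h | h
    · exact (min_le_left _ _).trans (Real.rpow_le_one h0.le h hs.le)
    · exact (min_le_right _ _).trans (Real.rpow_le_one_of_one_le_of_nonpos h (by linarith))
  have h2 : 0 ≤ min (‖z‖ ^ s) (‖z‖ ^ (-s)) := by positivity
  calc _ ≤ |C| * min (‖z‖ ^ s) (‖z‖ ^ (-s)) := by gcongr; exact le_abs_self C
    _ ≤ |C| * 1 := by gcongr
    _ = |C| := mul_one _

lemma MemHZero.expGrowth {θ : ℝ} {g : ℂ → ℂ} (hg : MemHZero θ g) : ExpGrowth θ g := by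
  obtain ⟨C, hC⟩ := hg.bounded
  exact ExpGrowth.of_bounded hg.holo hC

/-- The function `e` damped at infinity by `exp (-s z⁴)`. -/
def damp (e : ℂ → ℂ) (s : ℝ) (z : ℂ) : ℂ := e z * exp (-(s : ℂ) * z ^ 4)

/-- The quartic factor outweighs every exponential. Degree four also leaves room for growth of order
`exp (c ‖z‖²)`, met in `IsRegularizer.represents_integral`. -/
lemma MemHZero.damp_mul {θ s : ℝ} (hθ : θ ≤ 1 / 8) (hs : 0 < s) {e F : ℂ → ℂ}
    (he : MemHZero θ e) (hF : ExpGrowth θ F) : MemHZero θ fun z => damp e s z * F z := by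
  obtain ⟨C, K, hC, h⟩ := hF.growth
  obtain ⟨B, hB, hb⟩ := exists_exp_mul_sub_le K (half_pos hs)
  have : MemHZero θ fun z => e z * (exp (-(s : ℂ) * z ^ 4) * F z) := by
    refine he.mul_bounded ((DifferentiableOn.cexp (by fun_prop)).mul hF.holo) (B := C * B)
      fun z hz => ?_
    rw [norm_mul]
    calc _ ≤ Real.exp (-(s / 2) * ‖z‖ ^ 4) * (C * Real.exp (K * ‖z‖)) := by
          gcongr
          · exact norm_exp_neg_mul_pow_four_le hθ hs.le hz
          · exact h z hz
      _ = C * (Real.exp (K * ‖z‖) * Real.exp (-(s / 2) * ‖z‖ ^ 4)) := by ring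
      _ ≤ C * B := by gcongr; exact hb _ (norm_nonneg z)
  exact this.congr fun z _ => by rw [damp, mul_assoc]

lemma MemHZero.damp {θ s : ℝ} (hθ : θ ≤ 1 / 8) (hs : 0 < s) {e : ℂ → ℂ}
    (he : MemHZero θ e) : MemHZero θ (damp e s) :=
  (he.damp_mul hθ hs (ExpGrowth.const θ 1)).congr fun _ _ => mul_one _

end SectorEstimates

/-! ### Operators as values of functions of exponential growth -/

section Representation

variable {X : Type*} [NormedAddCommGroup X] [NormedSpace ℂ X]

/-- The constant `K` is independent of the function. This continuity of the calculus drives every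
norm limit below. -/
lemma IsZeroSectorial.exists_norm_cauchyInt_le {A : X →ₗ.[ℂ] X} (hA : IsZeroSectorial A)
    {θ ν s : ℝ} (hπ : θ ≤ Real.pi) (h0 : 0 < ν) (h1 : ν < θ) (hs : 0 < s) :
    ∃ K : ℝ, 0 < K ∧ ∀ (g : ℂ → ℂ) (C : ℝ), 0 ≤ C →
      (∀ z ∈ sector θ, ‖g z‖ ≤ C * min (‖z‖ ^ s) (‖z‖ ^ (-s))) → ‖cauchyInt A ν g‖ ≤ K * C := by
  obtain ⟨M, hM, h⟩ := hA.exists_bound_exp h0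
  set J := ∫ x : ℝ, Real.exp (-s * |x|) with hJ
  have hJ0 : 0 ≤ J := integral_nonneg fun _ => (Real.exp_pos _).le
  refine ⟨‖(2 * (Real.pi : ℂ) * I)⁻¹‖ * (2 * M * J) + 1, by positivity, fun g C hC hg => ?_⟩
  have hline : ∀ b : ℝ, |b| = ν → ‖∫ x : ℝ, cauchyKer A g (x + (b : ℂ) * I)‖ ≤ C * M * J := by
    intro b hb
    rw [hJ, ← integral_const_mul]
    refine norm_integral_le_of_norm_le ((integrable_exp_neg_mul_abs hs).const_mul _)
      (Eventually.of_forall fun x => ?_)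
    have him : ((x : ℂ) + b * I).im = b := by simp
    have hre : ((x : ℂ) + b * I).re = x := by simp
    have h2 := hg _ (exp_mem_sector hπ (u := x + b * I) (by rw [him, hb]; exact h1))
    have h3 := h (x + b * I) (by rw [him, hb]) (by rw [him, hb]; linarith)
    have e : min (‖exp ((x : ℂ) + b * I)‖ ^ s) (‖exp ((x : ℂ) + b * I)‖ ^ (-s)) ≤
        Real.exp (-s * |x|) := by
      rw [norm_exp, hre, ← Real.exp_mul, ← Real.exp_mul]
      rcases le_total 0 x with hx | hx
      · refine (min_le_right _ _).trans (le_of_eq ?_)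
        rw [abs_of_nonneg hx]; ring_nf
      · refine (min_le_left _ _).trans (le_of_eq ?_)
        rw [abs_of_nonpos hx]; ring_nf
    rw [cauchyKer, norm_smul, norm_mul]
    calc _ = ‖g (exp (x + b * I))‖ * (‖exp (x + b * I)‖ * ‖resolv A (exp (x + b * I))‖) := by ring
      _ ≤ (C * Real.exp (-s * |x|)) * M := by
          gcongr
          exact h2.trans (by gcongr)
      _ = _ := by ring
  rw [cauchyInt_eq, norm_smul]
  have h2 := hline (-ν) (by rw [abs_neg, abs_of_pos h0])
  have h3 := hline ν (abs_of_pos h0)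
  calc _ ≤ ‖(2 * (Real.pi : ℂ) * I)⁻¹‖ * (C * M * J + C * M * J) := by
        gcongr
        exact (norm_sub_le _ _).trans (add_le_add h2 h3)
    _ ≤ _ := by nlinarith

lemma IsZeroSectorial.cauchyInt_add {A : X →ₗ.[ℂ] X} (hA : IsZeroSectorial A)
    {θ ν : ℝ} (hπ : θ ≤ Real.pi) (h0 : 0 < ν) (h1 : ν < θ) {f g : ℂ → ℂ} (hf : MemHZero θ f)
    (hg : MemHZero θ g) :
    cauchyInt A ν (fun z => f z + g z) = cauchyInt A ν f + cauchyInt A ν g := by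
  have hline : ∀ b : ℝ, |b| = ν → ∫ x : ℝ, cauchyKer A (fun z => f z + g z) (x + (b : ℂ) * I) =
      (∫ x : ℝ, cauchyKer A f (x + (b : ℂ) * I)) + ∫ x : ℝ, cauchyKer A g (x + (b : ℂ) * I) := by
    intro b hb
    have hb0 : b ≠ 0 := by rintro rfl; simp at hb; linarith
    rw [← integral_add (hA.integrable_cauchyKer hf hπ hb0 (by rwa [hb]))
      (hA.integrable_cauchyKer hg hπ hb0 (by rwa [hb]))]
    refine integral_congr_ae (Eventually.of_forall fun x => ?_)
    simp only [cauchyKer, add_mul, add_smul]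
  rw [cauchyInt_eq, cauchyInt_eq, cauchyInt_eq, hline (-ν) (by rw [abs_neg, abs_of_pos h0]),
    hline ν (abs_of_pos h0), ← smul_add]
  congr 1; abel

lemma cauchyInt_const_mul (A : X →ₗ.[ℂ] X) (ν : ℝ) (c : ℂ) (f : ℂ → ℂ) :
    cauchyInt A ν (fun z => c * f z) = c • cauchyInt A ν f := by
  have hline : ∀ b : ℝ, ∫ x : ℝ, cauchyKer A (fun z => c * f z) (x + (b : ℂ) * I) =
      c • ∫ x : ℝ, cauchyKer A f (x + (b : ℂ) * I) := by
    intro b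
    rw [← integral_smul]
    refine integral_congr_ae (Eventually.of_forall fun x => ?_)
    simp only [cauchyKer, smul_smul, mul_assoc]
  rw [cauchyInt_eq, cauchyInt_eq, hline, hline, ← smul_sub, smul_comm]

/-- A function `e` with injective `e(A)`, on a small sector. -/
structure IsRegularizer (A : X →ₗ.[ℂ] X) (θ ν : ℝ) (e : ℂ → ℂ) : Prop where
  sectorial : IsZeroSectorial A
  pos : 0 < ν
  lt : ν < θ
  le : θ ≤ 1 / 8
  mem : MemHZero θ e
  injective : Function.Injective (cauchyInt A ν e)

/-- The bounded operator `T` is the value at `A` of a function `F` of exponential growth. -/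
def Represents (A : X →ₗ.[ℂ] X) (ν : ℝ) (e F : ℂ → ℂ) (T : X →L[ℂ] X) : Prop :=
  ∀ s : ℝ, 0 < s → cauchyInt A ν (damp e s) ∘L T = cauchyInt A ν fun z => damp e s z * F z

namespace IsRegularizer

variable {A : X →ₗ.[ℂ] X} {θ ν : ℝ} {e : ℂ → ℂ}

lemma le_pi (h : IsRegularizer A θ ν e) : θ ≤ Real.pi := by
  have := h.le; have := Real.pi_gt_three; linarith

lemma le_pi_div_two (h : IsRegularizer A θ ν e) : θ ≤ Real.pi / 2 := by
  have := h.le; have := Real.pi_gt_three; linarith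

/-- Half of the decay exponent `σ` is sacrificed: the damping error is at most `2 s ^ (σ/8) ‖z‖ ^
(σ/2)`, so its product with `g` still decays with exponent `σ / 2` and carries a factor tending to
zero. -/
lemma tendsto_damp (h : IsRegularizer A θ ν e) {g : ℂ → ℂ} (hg : MemHZero θ g) :
    Tendsto (fun s => cauchyInt A ν (damp g s)) (𝓝[>] 0) (𝓝 (cauchyInt A ν g)) := by
  obtain ⟨C, σ, hσ, hb⟩ := hg.decay
  -- Lowering the exponent weakens the decay bound; it ensures `σ / 8 ≤ 1` for the interpolation.
  wlog hσ1 : σ ≤ 1 generalizing σ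
  · refine this 1 one_pos (fun z hz => (hb z hz).trans ?_) le_rfl
    have h0 : 0 < ‖z‖ := norm_pos_iff.2 hz.1
    have hm : 0 < min (‖z‖ ^ σ) (‖z‖ ^ (-σ)) := lt_min (by positivity) (by positivity)
    have hC : 0 ≤ C := nonneg_of_mul_nonneg_left ((norm_nonneg _).trans (hb z hz)) hm
    gcongr ?_ * ?_
    rcases le_total ‖z‖ 1 with h2 | h2
    · have e1 : ‖z‖ ^ σ ≤ ‖z‖ ^ (1 : ℝ) := Real.rpow_le_rpow_of_exponent_ge h0 h2 (by linarith)
      have e2 : ‖z‖ ^ (1 : ℝ) ≤ ‖z‖ ^ (-1 : ℝ) := Real.rpow_le_rpow_of_exponent_ge h0 h2 (by norm_num)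
      exact (min_le_left _ _).trans (le_min e1 (e1.trans e2))
    · have e1 : ‖z‖ ^ (-σ) ≤ ‖z‖ ^ (-1 : ℝ) := Real.rpow_le_rpow_of_exponent_le h2 (by linarith)
      have e2 : ‖z‖ ^ (-1 : ℝ) ≤ ‖z‖ ^ (1 : ℝ) := Real.rpow_le_rpow_of_exponent_le h2 (by norm_num)
      exact (min_le_right _ _).trans (le_min (e1.trans e2) e1)
  obtain ⟨K, hK, hKb⟩ := h.sectorial.exists_norm_cauchyInt_le h.le_pi h.pos h.lt (half_pos hσ)
  rw [tendsto_iff_norm_sub_tendsto_zero]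
  have hlim : Tendsto (fun s : ℝ => K * (2 * |C| * s ^ (σ / 8))) (𝓝[>] 0) (𝓝 0) := by
    have : Tendsto (fun s : ℝ => K * (2 * |C| * s ^ (σ / 8))) (𝓝 0)
        (𝓝 (K * (2 * |C| * 0 ^ (σ / 8)))) :=
      ((Real.continuousAt_rpow_const 0 (σ / 8) (Or.inr (by positivity))).const_mul _).const_mul _
    rw [Real.zero_rpow (by positivity), mul_zero, mul_zero] at this
    exact this.mono_left nhdsWithin_le_nhds
  refine squeeze_zero' (Eventually.of_forall fun _ => norm_nonneg _) ?_ hlim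
  filter_upwards [self_mem_nhdsWithin] with s hs
  have hs0 : (0 : ℝ) < s := hs
  have hsub : cauchyInt A ν (damp g s) - cauchyInt A ν g =
      cauchyInt A ν fun z => damp g s z + (-1) * g z := by
    rw [h.sectorial.cauchyInt_add h.le_pi h.pos h.lt (hg.damp h.le hs0), cauchyInt_const_mul]
    · rw [neg_one_smul, sub_eq_add_neg]
    · exact (hg.mul_bounded (differentiableOn_const (-1)) (B := 1) (by simp)).congr
        fun z _ => mul_comm _ _
  rw [hsub]
  refine hKb _ _ (by positivity) fun z hz => ?_
  have h0 : 0 < ‖z‖ := norm_pos_iff.2 hz.1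
  have e1 : damp g s z + (-1) * g z = -(g z * (1 - exp (-((s : ℂ) * z ^ 4)))) := by
    rw [damp, neg_mul]; ring
  have hre : 0 ≤ ((s : ℂ) * z ^ 4).re := by
    rw [re_ofReal_mul]
    have := half_norm_pow_four_le h.le hz
    exact mul_nonneg hs0.le ((by positivity : (0 : ℝ) ≤ ‖z‖ ^ 4 / 2).trans this)
  have h3 := norm_one_sub_exp_neg_le hre (κ := σ / 8) (by positivity) (by linarith)
  have e2 : ‖(s : ℂ) * z ^ 4‖ ^ (σ / 8) = s ^ (σ / 8) * ‖z‖ ^ (σ / 2) := by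
    rw [norm_mul, norm_pow, Complex.norm_of_nonneg hs0.le, Real.mul_rpow hs0.le (by positivity),
      ← Real.rpow_natCast, ← Real.rpow_mul h0.le]
    congr 2
    push_cast; ring
  rw [e2] at h3
  rw [e1, norm_neg, norm_mul]
  have hmin : min (‖z‖ ^ σ) (‖z‖ ^ (-σ)) * ‖z‖ ^ (σ / 2) ≤ min (‖z‖ ^ (σ / 2)) (‖z‖ ^ (-(σ / 2))) := by
    have hb2 : (0 : ℝ) ≤ ‖z‖ ^ (σ / 2) := by positivity
    rcases le_total ‖z‖ 1 with h2 | h2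
    · have e1 : ‖z‖ ^ σ * ‖z‖ ^ (σ / 2) ≤ ‖z‖ ^ (σ / 2) := by
        rw [← Real.rpow_add h0]
        exact Real.rpow_le_rpow_of_exponent_ge h0 h2 (by linarith)
      have e2 : ‖z‖ ^ (σ / 2) ≤ ‖z‖ ^ (-(σ / 2)) :=
        Real.rpow_le_rpow_of_exponent_ge h0 h2 (by linarith)
      have e3 : min (‖z‖ ^ σ) (‖z‖ ^ (-σ)) * ‖z‖ ^ (σ / 2) ≤ ‖z‖ ^ σ * ‖z‖ ^ (σ / 2) :=
        mul_le_mul_of_nonneg_right (min_le_left _ _) hb2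
      exact le_min (e3.trans e1) ((e3.trans e1).trans e2)
    · have e1 : ‖z‖ ^ (-σ) * ‖z‖ ^ (σ / 2) = ‖z‖ ^ (-(σ / 2)) := by
        rw [← Real.rpow_add h0]; congr 1; ring
      have e2 : ‖z‖ ^ (-(σ / 2)) ≤ ‖z‖ ^ (σ / 2) :=
        Real.rpow_le_rpow_of_exponent_le h2 (by linarith)
      have e3 : min (‖z‖ ^ σ) (‖z‖ ^ (-σ)) * ‖z‖ ^ (σ / 2) ≤ ‖z‖ ^ (-σ) * ‖z‖ ^ (σ / 2) :=
        mul_le_mul_of_nonneg_right (min_le_right _ _) hb2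
      rw [e1] at e3
      exact le_min (e3.trans e2) e3
  calc ‖g z‖ * ‖1 - exp (-((s : ℂ) * z ^ 4))‖
      ≤ (|C| * min (‖z‖ ^ σ) (‖z‖ ^ (-σ))) * (2 * (s ^ (σ / 8) * ‖z‖ ^ (σ / 2))) := by
        gcongr
        exact (hb z hz).trans (by gcongr; exact le_abs_self C)
    _ = 2 * |C| * s ^ (σ / 8) * (min (‖z‖ ^ σ) (‖z‖ ^ (-σ)) * ‖z‖ ^ (σ / 2)) := by ring
    _ ≤ _ := by gcongr

/-- As `s → 0` the damped regularizers converge to `e(A)`, which is injective. Jointly they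
therefore separate operators. -/
lemma ext (h : IsRegularizer A θ ν e) {T U : X →L[ℂ] X}
    (hTU : ∀ s : ℝ, 0 < s → cauchyInt A ν (damp e s) ∘L T = cauchyInt A ν (damp e s) ∘L U) :
    T = U := by
  ext x
  apply h.injective
  have ht := h.tendsto_damp h.mem
  have h1 : Tendsto (fun s => cauchyInt A ν (damp e s) (T x)) (𝓝[>] 0)
      (𝓝 (cauchyInt A ν e (T x))) :=
    ((ContinuousLinearMap.apply ℂ X (T x)).continuous.tendsto _).comp ht
  have h2 : Tendsto (fun s => cauchyInt A ν (damp e s) (U x)) (𝓝[>] 0)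
      (𝓝 (cauchyInt A ν e (U x))) :=
    ((ContinuousLinearMap.apply ℂ X (U x)).continuous.tendsto _).comp ht
  refine tendsto_nhds_unique (h1.congr' ?_) h2
  filter_upwards [self_mem_nhdsWithin] with s hs
  exact congrArg (fun S : X →L[ℂ] X => S x) (hTU s hs)

lemma unique (h : IsRegularizer A θ ν e) {F : ℂ → ℂ} {T U : X →L[ℂ] X}
    (hT : Represents A ν e F T) (hU : Represents A ν e F U) : T = U :=
  h.ext fun s hs => (hT s hs).trans (hU s hs).symm

lemma congr (h : IsRegularizer A θ ν e) {F G : ℂ → ℂ} {T : X →L[ℂ] X}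
    (hT : Represents A ν e F T) (hFG : ∀ z ∈ sector θ, F z = G z) : Represents A ν e G T :=
  fun s hs => (hT s hs).trans
    (cauchyInt_congr A h.le_pi h.pos h.lt fun z hz => by rw [hFG z hz])

lemma add (h : IsRegularizer A θ ν e) {F G : ℂ → ℂ} {T U : X →L[ℂ] X}
    (hF : ExpGrowth θ F) (hG : ExpGrowth θ G)
    (hT : Represents A ν e F T) (hU : Represents A ν e G U) :
    Represents A ν e (fun z => F z + G z) (T + U) := by
  intro s hs
  rw [ContinuousLinearMap.comp_add, hT s hs, hU s hs,
    ← h.sectorial.cauchyInt_add h.le_pi h.pos h.lt (h.mem.damp_mul h.le hs hF)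
      (h.mem.damp_mul h.le hs hG)]
  simp_rw [mul_add]

lemma smul {F : ℂ → ℂ} {T : X →L[ℂ] X} (c : ℂ)
    (hT : Represents A ν e F T) : Represents A ν e (fun z => c * F z) (c • T) := by
  intro s hs
  rw [ContinuousLinearMap.comp_smul, hT s hs, ← cauchyInt_const_mul]
  congr 1; ext z; ring

lemma one : Represents A ν e (fun _ => 1) (ContinuousLinearMap.id ℂ X) := by
  intro s hs
  simp

/-- For bounded `F` the product `e F` already lies in the decaying class, so the damping can be
removed by letting `s → 0`. -/
lemma isHolValue (h : IsRegularizer A θ ν e) {F : ℂ → ℂ} {T : X →L[ℂ] X}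
    (hF : DifferentiableOn ℂ F (sector θ)) {C : ℝ} (hC : ∀ z ∈ sector θ, ‖F z‖ ≤ C)
    (hT : Represents A ν e F T) : IsHolValue A F T := by
  have heF := h.mem.mul_bounded hF hC
  refine ⟨θ, ν, e, h.pos, h.lt, ?_, hF, h.mem, heF, h.injective, ?_⟩
  · have := h.le; have := Real.pi_gt_three; linarith
  · have h1 : Tendsto (fun s => cauchyInt A ν (damp e s) ∘L T) (𝓝[>] 0)
        (𝓝 (cauchyInt A ν e ∘L T)) :=
      (((ContinuousLinearMap.compL ℂ X X X).flip T).continuous.tendsto _).comp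
        (h.tendsto_damp h.mem)
    have h2 := h.tendsto_damp heF
    have : cauchyInt A ν e ∘L T =
        cauchyInt A ν fun z => e z * F z := by
      refine tendsto_nhds_unique h1 (h2.congr' ?_)
      filter_upwards [self_mem_nhdsWithin] with s hs
      rw [hT s hs]
      congr 1; ext z; simp only [damp]; ring
    intro x
    exact congrArg (fun S : X →L[ℂ] X => S x) this

variable [CompleteSpace X]

lemma damp_comm (h : IsRegularizer A θ ν e) {g : ℂ → ℂ} (hg : MemHZero θ g) {s : ℝ} (hs : 0 < s) :
    cauchyInt A ν (damp e s) ∘L cauchyInt A ν g = cauchyInt A ν g ∘L cauchyInt A ν (damp e s) :=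
  h.sectorial.cauchyInt_comm (h.mem.damp h.le hs) hg h.le_pi_div_two h.pos h.lt

/-- `F` and `G` each need their own damped regularizer, with parameters `s` and `r`. The one with
parameter `r` is carried past the Cauchy integral of the damped `F` by commutativity, and is
stripped off at the end by `ext`. -/
lemma mul (h : IsRegularizer A θ ν e) {F G : ℂ → ℂ} {T U : X →L[ℂ] X}
    (hF : ExpGrowth θ F) (hG : ExpGrowth θ G)
    (hT : Represents A ν e F T) (hU : Represents A ν e G U) :
    Represents A ν e (fun z => F z * G z) (T ∘L U) := by
  intro s hs
  refine h.ext fun r hr => ?_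
  have hs' := h.mem.damp h.le hs
  have hr' := h.mem.damp h.le hr
  have hsF := h.mem.damp_mul h.le hs hF
  have hrG := h.mem.damp_mul h.le hr hG
  calc cauchyInt A ν (damp e r) ∘L (cauchyInt A ν (damp e s) ∘L (T ∘L U))
      = cauchyInt A ν (damp e r) ∘L ((cauchyInt A ν (damp e s) ∘L T) ∘L U) := by
        rw [ContinuousLinearMap.comp_assoc]
    _ = (cauchyInt A ν (fun z => damp e s z * F z) ∘L cauchyInt A ν (damp e r)) ∘L U := by
        rw [hT s hs, ← ContinuousLinearMap.comp_assoc, h.damp_comm hsF hr]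
    _ = cauchyInt A ν (fun z => damp e s z * F z) ∘L cauchyInt A ν (fun z => damp e r z * G z) := by
        rw [ContinuousLinearMap.comp_assoc, hU r hr]
    _ = cauchyInt A ν (fun z => (damp e s z * F z) * (damp e r z * G z)) :=
        (h.sectorial.cauchyInt_mul hsF hrG h.le_pi_div_two h.pos h.lt).symm
    _ = cauchyInt A ν (fun z => damp e r z * (damp e s z * (F z * G z))) := by
        congr 1; ext z; ring
    _ = _ := h.sectorial.cauchyInt_mul hr' (h.mem.damp_mul h.le hs (hF.mul hG))
        h.le_pi_div_two h.pos h.lt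

lemma represents_cauchyInt (h : IsRegularizer A θ ν e) {g : ℂ → ℂ} (hg : MemHZero θ g) :
    Represents A ν e g (cauchyInt A ν g) := fun _ hs =>
  (h.sectorial.cauchyInt_mul (h.mem.damp h.le hs) hg h.le_pi_div_two h.pos h.lt).symm

lemma represents_resolv (h : IsRegularizer A θ ν e) {r : ℝ} (hr : 0 < r) :
    Represents A ν e (fun z => r / (r + z)) (-(r : ℂ) • resolv A (-(r : ℂ))) := by
  have hne : ∀ z ∈ sector θ, (r : ℂ) + z ≠ 0 := fun z hz h0 => by
    have := re_pos_of_mem_sector h.le_pi_div_two hz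
    have h2 := congrArg Complex.re h0
    simp at h2; linarith
  intro s hs
  have hs' := h.mem.damp h.le hs
  have hgr : ExpGrowth θ fun z => (r : ℂ) / (r + z) := by
    refine ExpGrowth.of_bounded (C := 1) ?_ fun z hz => ?_
    · exact (differentiableOn_const _).div (by fun_prop) hne
    · have := re_pos_of_mem_sector h.le_pi_div_two hz
      rw [norm_div, div_le_one (norm_pos_iff.2 (hne z hz)), Complex.norm_of_nonneg hr.le]
      refine le_trans ?_ (Complex.re_le_norm _)
      simp; linarith
  have hsF := h.mem.damp_mul h.le hs hgr
  refine h.ext fun q hq => ?_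
  have hq' := h.mem.damp h.le hq
  have hk := h.sectorial.resolv_comp_cauchyInt hq' h.le_pi_div_two h.pos h.lt hr
  have hsec := h.sectorial.resolv_comp_cauchyInt hs' h.le_pi_div_two h.pos h.lt hr
  -- A bounded resolvent commutes with the Cauchy integral because it commutes with the integrand.
  have hcomm : cauchyInt A ν (damp e s) ∘L resolv A (-(r : ℂ)) =
      resolv A (-(r : ℂ)) ∘L cauchyInt A ν (damp e s) := by
    have hz := neg_ofReal_mem_offAxis hr
    have hline : ∀ b : ℝ, |b| = ν →
        (∫ x : ℝ, cauchyKer A (damp e s) (x + (b : ℂ) * I)) ∘L resolv A (-(r : ℂ)) =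
        resolv A (-(r : ℂ)) ∘L ∫ x : ℝ, cauchyKer A (damp e s) (x + (b : ℂ) * I) := by
      intro b hb
      have hb0 : b ≠ 0 := by rintro rfl; simp at hb; linarith [h.pos]
      have hbθ : |b| < θ := by rw [hb]; exact h.lt
      have hai := h.sectorial.integrable_cauchyKer hs' h.le_pi hb0 hbθ
      have h2 := (ContinuousLinearMap.compL ℂ X X X
        (resolv A (-(r : ℂ)))).integral_comp_comm hai
      have h3 := ((ContinuousLinearMap.compL ℂ X X X).flip
        (resolv A (-(r : ℂ)))).integral_comp_comm hai
      simp only [ContinuousLinearMap.flip_apply, ContinuousLinearMap.compL_apply] at h2 h3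
      rw [← h2, ← h3]
      refine integral_congr_ae (Eventually.of_forall fun x => ?_)
      have hw : exp (x + (b : ℂ) * I) ∈ offAxis := exp_mem_offAxis (by simpa using hb0)
        (by simpa using hbθ.le.trans h.le_pi)
      simp only [cauchyKer, ContinuousLinearMap.comp_smul, ContinuousLinearMap.smul_comp,
        h.sectorial.resolv_comm hw hz]
    rw [cauchyInt_eq, ContinuousLinearMap.smul_comp, ContinuousLinearMap.sub_comp,
      hline (-ν) (by rw [abs_neg, abs_of_pos h.pos]), hline ν (abs_of_pos h.pos),
      ContinuousLinearMap.comp_smul, ContinuousLinearMap.comp_sub]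
  congr 1
  rw [ContinuousLinearMap.comp_smul, hcomm, hsec, ← cauchyInt_const_mul]
  refine cauchyInt_congr A h.le_pi h.pos h.lt fun z hz => ?_
  have h1 := hne z hz
  have h2 : -(r : ℂ) - z ≠ 0 := by rw [← neg_add']; exact neg_ne_zero.2 h1
  rw [show -(r : ℂ) - z = -(r + z) by ring, div_neg]
  field_simp

/-- The value does not depend on the regularizer. Composing the claim with the injective `e'(A)`
that defines `T`, and commuting it with the damped `e`, reduces everything to multiplicativity. Both
contours are first moved to a common angle. -/
lemma of_isHolValue (h : IsRegularizer A θ ν e) {F : ℂ → ℂ} {T : X →L[ℂ] X}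
    (hF : ExpGrowth θ F) (hT : IsHolValue A F T) : Represents A ν e F T := by
  obtain ⟨θ', ν', e', hν', hνθ', hθ', -, he', heF', hinj, hval⟩ := hT
  intro s hs
  have hpi := h.le_pi
  set ϑ := min θ θ' with hϑ
  set μ := min ν ν' with hμ
  have hμ0 : 0 < μ := lt_min h.pos hν'
  have hμϑ : μ < ϑ := lt_min ((min_le_left _ _).trans_lt h.lt) ((min_le_right _ _).trans_lt hνθ')
  have hμθ : μ < θ := hμϑ.trans_le (min_le_left _ _)
  have hμθ' : μ < θ' := hμϑ.trans_le (min_le_right _ _)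
  have hϑpi : ϑ ≤ Real.pi / 2 := (min_le_left _ _).trans h.le_pi_div_two
  have hs' := h.mem.damp h.le hs
  have hsF := h.mem.damp_mul h.le hs hF
  rw [h.sectorial.cauchyInt_congr_angle hs' hpi h.pos h.lt hμ0 hμθ,
    h.sectorial.cauchyInt_congr_angle hsF hpi h.pos h.lt hμ0 hμθ]
  rw [h.sectorial.cauchyInt_congr_angle he' hθ'.le hν' hνθ' hμ0 hμθ'] at hinj hval
  rw [h.sectorial.cauchyInt_congr_angle heF' hθ'.le hν' hνθ' hμ0 hμθ'] at hval
  have m1 := hs'.mono (min_le_left θ θ')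
  have m2 := hsF.mono (min_le_left θ θ')
  have m3 := he'.mono (min_le_right θ θ')
  have m4 := heF'.mono (min_le_right θ θ')
  have hval' : cauchyInt A μ e' ∘L T =
      cauchyInt A μ fun z => e' z * F z := ContinuousLinearMap.ext hval
  have key : cauchyInt A μ e' ∘L (cauchyInt A μ (damp e s) ∘L T) =
      cauchyInt A μ e' ∘L
        cauchyInt A μ fun z => damp e s z * F z := by
    rw [← ContinuousLinearMap.comp_assoc, h.sectorial.cauchyInt_comm m3 m1 hϑpi hμ0 hμϑ,
      ContinuousLinearMap.comp_assoc, hval', ← h.sectorial.cauchyInt_mul m1 m4 hϑpi hμ0 hμϑ,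
      ← h.sectorial.cauchyInt_mul m3 m2 hϑpi hμ0 hμϑ]
    congr 1; ext z; ring
  ext x
  exact hinj (congrArg (fun S : X →L[ℂ] X => S x) key)

end IsRegularizer

end Representation

end SmoothedCalculus

end

noncomputable section

namespace SmoothedCalculus

/-! ### The symbols (1 + z)^(-β) e^(itz) -/

section WaveFunctions

variable {θ : ℝ}

lemma one_add_mem_slitPlane (hθ : θ ≤ 1 / 8) {z : ℂ} (hz : z ∈ sector θ) : 1 + z ∈ slitPlane := by
  have hpi := Real.pi_gt_three
  have := re_pos_of_mem_sector (by linarith) hz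
  exact Or.inl (by simp; linarith)

lemma one_add_ne_zero (hθ : θ ≤ 1 / 8) {z : ℂ} (hz : z ∈ sector θ) : 1 + z ≠ 0 :=
  slitPlane_ne_zero (one_add_mem_slitPlane hθ hz)

lemma one_le_norm_one_add (hθ : θ ≤ 1 / 8) {z : ℂ} (hz : z ∈ sector θ) : 1 ≤ ‖1 + z‖ := by
  have hpi := Real.pi_gt_three
  have := re_pos_of_mem_sector (by linarith) hz
  refine le_trans ?_ (Complex.re_le_norm _)
  simp; linarith

lemma norm_le_norm_one_add (hθ : θ ≤ 1 / 8) {z : ℂ} (hz : z ∈ sector θ) : ‖z‖ ≤ ‖1 + z‖ := by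
  have hpi := Real.pi_gt_three
  have := re_pos_of_mem_sector (by linarith) hz
  refine (sq_le_sq₀ (norm_nonneg _) (norm_nonneg _)).1 ?_
  rw [← Complex.normSq_eq_norm_sq, ← Complex.normSq_eq_norm_sq, Complex.normSq_apply,
    Complex.normSq_apply]
  simp only [add_re, one_re, add_im, one_im, zero_add]
  nlinarith

lemma differentiableOn_powFun (hθ : θ ≤ 1 / 8) (β : ℝ) :
    DifferentiableOn ℂ (powFun β) (sector θ) := fun _ hz =>
  (DifferentiableAt.cpow (by fun_prop) (by fun_prop)
    (one_add_mem_slitPlane hθ hz)).differentiableWithinAt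

lemma norm_powFun_le (hθ : θ ≤ 1 / 8) {β : ℝ} (hβ : 0 ≤ β) {z : ℂ} (hz : z ∈ sector θ) :
    ‖powFun β z‖ ≤ 1 := by
  rw [powFun, ← ofReal_neg, Complex.norm_cpow_real]
  exact Real.rpow_le_one_of_one_le_of_nonpos (one_le_norm_one_add hθ hz) (by linarith)

lemma expGrowth_powFun (hθ : θ ≤ 1 / 8) {β : ℝ} (hβ : 0 ≤ β) : ExpGrowth θ (powFun β) :=
  ExpGrowth.of_bounded (differentiableOn_powFun hθ β) fun _ hz => norm_powFun_le hθ hβ hz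

lemma norm_exp_I_mul_le (t : ℝ) (z : ℂ) : ‖exp (I * t * z)‖ ≤ Real.exp (|t| * ‖z‖) := by
  refine (Complex.norm_exp_le_exp_norm _).trans ?_
  simp

lemma expGrowth_exp (θ t : ℝ) : ExpGrowth θ fun z => exp (I * t * z) :=
  ⟨by fun_prop, 1, |t|, zero_le_one, fun z _ => by rw [one_mul]; exact norm_exp_I_mul_le t z⟩

lemma waveFun_eq (β t : ℝ) (z : ℂ) : waveFun β t z = powFun β z * exp (I * t * z) := rfl

lemma waveFun_zero (β : ℝ) (z : ℂ) : waveFun β 0 z = powFun β z := by simp [waveFun_eq]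

lemma expGrowth_waveFun (hθ : θ ≤ 1 / 8) {β : ℝ} (hβ : 0 ≤ β) (t : ℝ) :
    ExpGrowth θ (waveFun β t) := (expGrowth_powFun hθ hβ).mul (expGrowth_exp θ t)

lemma powFun_mul (hθ : θ ≤ 1 / 8) (β β' : ℝ) {z : ℂ} (hz : z ∈ sector θ) :
    powFun β z * powFun β' z = powFun (β + β') z := by
  rw [powFun, powFun, powFun, ← cpow_add _ _ (one_add_ne_zero hθ hz)]
  push_cast; ring_nf

lemma waveFun_mul (hθ : θ ≤ 1 / 8) (β β' t t' : ℝ) {z : ℂ} (hz : z ∈ sector θ) :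
    waveFun β t z * waveFun β' t' z = waveFun (β + β') (t + t') z := by
  rw [waveFun_eq, waveFun_eq, waveFun_eq, ← powFun_mul hθ β β' hz]
  push_cast
  rw [mul_add, add_mul, exp_add]
  ring

lemma powFun_one (z : ℂ) : powFun 1 z = (1 + z)⁻¹ := by
  rw [powFun]; simp [cpow_neg_one]

end WaveFunctions

/-! ### Resolvent approximation, continuity and superposition of wave operators -/

section Operators

variable {X : Type*} [NormedAddCommGroup X] [NormedSpace ℂ X]

/-- The operator `r (r + A)⁻¹`. -/
def resApprox (A : X →ₗ.[ℂ] X) (r : ℝ) : X →L[ℂ] X := -(r : ℂ) • resolv A (-(r : ℂ))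

lemma IsZeroSectorial.exists_norm_resApprox_le {A : X →ₗ.[ℂ] X} (hA : IsZeroSectorial A) :
    ∃ C : ℝ, 0 < C ∧ ∀ r : ℝ, 0 < r → ‖resApprox A r‖ ≤ C := by
  obtain ⟨C, hC, h⟩ := hA.exists_bound (θ := Real.pi / 2) (by positivity)
    (by linarith [Real.pi_pos])
  refine ⟨C, hC, fun r hr => ?_⟩
  rw [resApprox, norm_smul]
  refine h _ ?_
  simpa using hr

namespace IsRegularizer

variable {A : X →ₗ.[ℂ] X} {θ ν : ℝ} {e : ℂ → ℂ}

lemma expGrowth_resApprox (h : IsRegularizer A θ ν e) {r : ℝ} (hr : 0 < r) :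
    ExpGrowth θ fun z => (r : ℂ) / (r + z) := by
  have hne : ∀ z ∈ sector θ, (r : ℂ) + z ≠ 0 := fun z hz h0 => by
    have := re_pos_of_mem_sector h.le_pi_div_two hz
    have h2 := congrArg Complex.re h0
    simp at h2; linarith
  refine ExpGrowth.of_bounded (C := 1) ?_ fun z hz => ?_
  · exact (differentiableOn_const _).div (by fun_prop) hne
  · have := re_pos_of_mem_sector h.le_pi_div_two hz
    rw [norm_div, div_le_one (norm_pos_iff.2 (hne z hz)), Complex.norm_of_nonneg hr.le]
    refine le_trans ?_ (Complex.re_le_norm _)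
    simp; linarith

variable [CompleteSpace X]

lemma represents_resApprox (h : IsRegularizer A θ ν e) {r : ℝ} (hr : 0 < r) :
    Represents A ν e (fun z => (r : ℂ) / (r + z)) (resApprox A r) := h.represents_resolv hr

lemma represents_resApprox_one (h : IsRegularizer A θ ν e) :
    Represents A ν e (powFun 1) (resApprox A 1) :=
  h.congr (h.represents_resApprox one_pos) fun z _ => by rw [powFun_one]; simp

/-- Operators of the form `(1 + A)⁻¹ T` are approximated by the resolvents. -/
lemma norm_resApprox_one_sub_le (h : IsRegularizer A θ ν e) {r : ℝ} (hr : 0 < r) :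
    ‖resApprox A 1 - resApprox A 1 ∘L resApprox A r‖ ≤
      r⁻¹ * ((1 + ‖resApprox A 1‖) * ‖resApprox A r‖) := by
  have h1 := h.represents_resApprox_one
  have hr' := h.represents_resApprox hr
  have g1 := expGrowth_powFun h.le zero_le_one
  have gr := h.expGrowth_resApprox hr
  -- The symbols of `hL` and `hR` are both `z / ((1 + z)(r + z))`. The second form displays a factor
  -- `r⁻¹` in front of uniformly bounded operators.
  have hL : Represents A ν e (fun z => powFun 1 z + (-1) * (powFun 1 z * ((r : ℂ) / (r + z))))
      (resApprox A 1 + (-1 : ℂ) • (resApprox A 1 ∘L resApprox A r)) :=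
    h.add g1 ((ExpGrowth.const θ (-1)).mul (g1.mul gr)) h1 (smul _ (h.mul g1 gr h1 hr'))
  have hR : Represents A ν e (fun z => (r : ℂ)⁻¹ * ((1 + (-1) * powFun 1 z) * ((r : ℂ) / (r + z))))
      ((r : ℂ)⁻¹ • ((ContinuousLinearMap.id ℂ X + (-1 : ℂ) • resApprox A 1) ∘L resApprox A r)) := by
    refine smul _ (h.mul ((ExpGrowth.const θ 1).add ((ExpGrowth.const θ (-1)).mul g1)) gr ?_ hr')
    exact h.add (ExpGrowth.const θ 1) ((ExpGrowth.const θ (-1)).mul g1) one (smul _ h1)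
  have heq := h.unique hL (h.congr hR fun z hz => by
    have hne : (r : ℂ) + z ≠ 0 := fun h0 => by
      have := re_pos_of_mem_sector h.le_pi_div_two hz
      have h2 := congrArg Complex.re h0
      simp at h2; linarith
    have hne1 := one_add_ne_zero h.le hz
    have hr0 : (r : ℂ) ≠ 0 := ofReal_ne_zero.2 hr.ne'
    rw [powFun_one]
    field_simp
    ring)
  rw [neg_one_smul, ← sub_eq_add_neg] at heq
  rw [heq, norm_smul, norm_inv, Complex.norm_of_nonneg hr.le]
  gcongr
  refine (ContinuousLinearMap.opNorm_comp_le _ _).trans ?_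
  gcongr
  refine (norm_add_le _ _).trans ?_
  gcongr
  · exact ContinuousLinearMap.norm_id_le
  · rw [neg_one_smul, norm_neg]

/-- Neither power vanishes at `0`, but both equal `1` there with bounded derivative, so the
difference is of order `‖z‖`. At infinity `δ ≥ 1` gives order `‖z‖⁻¹`. Fractional powers are thereby
reduced to the resolvent plus a Cauchy integral. -/
lemma memHZero_powFun_sub (hθ : θ ≤ 1 / 8) {δ : ℝ} (hδ : 1 ≤ δ) :
    MemHZero θ fun z => powFun δ z + (-1) * powFun 1 z := by
  refine ⟨(differentiableOn_powFun hθ δ).add ((differentiableOn_powFun hθ 1).const_mul _),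
    2 * (δ + 1), 1, one_pos, fun z hz => ?_⟩
  have hz0 : 0 < ‖z‖ := norm_pos_iff.2 hz.1
  rw [Real.rpow_neg_one, Real.rpow_one, mul_min_of_nonneg _ _ (by linarith)]
  have hpi := Real.pi_gt_three
  have hlip : ∀ β : ℝ, 0 ≤ β → ‖powFun β z - 1‖ ≤ β * ‖z‖ := by
    intro β hβ
    set H : Set ℂ := {w : ℂ | 0 ≤ w.re}
    have hconv : Convex ℝ H := convex_halfSpace_re_ge 0
    have hd : ∀ w ∈ H, HasDerivWithinAt (powFun β) ((-(β : ℂ)) * (1 + w) ^ (-(β : ℂ) - 1) * 1) H w := by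
      intro w hw
      have hs : 1 + w ∈ slitPlane := Or.inl (by
        have : 0 ≤ w.re := hw
        simp; linarith)
      exact (((hasDerivAt_id w).const_add 1).cpow_const hs).hasDerivWithinAt
    have hb : ∀ w ∈ H, ‖(-(β : ℂ)) * (1 + w) ^ (-(β : ℂ) - 1) * 1‖ ≤ β := by
      intro w hw
      have hw' : 0 ≤ w.re := hw
      rw [mul_one, norm_mul, norm_neg, Complex.norm_of_nonneg hβ,
        show -(β : ℂ) - 1 = ((-β - 1 : ℝ) : ℂ) by push_cast; ring, Complex.norm_cpow_real]
      have h1 : 1 ≤ ‖1 + w‖ := le_trans (by simp; linarith) (Complex.re_le_norm _)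
      have := Real.rpow_le_one_of_one_le_of_nonpos h1 (by linarith : -β - 1 ≤ 0)
      nlinarith
    have := hconv.norm_image_sub_le_of_norm_hasDerivWithin_le hd hb (x := 0) (y := z)
      (by simp [H]) (re_pos_of_mem_sector (by linarith) hz).le
    simpa [powFun] using this
  refine le_min ?_ ?_
  · have h1 := hlip δ (by linarith)
    have h2 := hlip 1 zero_le_one
    calc ‖powFun δ z + (-1) * powFun 1 z‖ = ‖(powFun δ z - 1) - (powFun 1 z - 1)‖ := by
          congr 1; ring
      _ ≤ δ * ‖z‖ + 1 * ‖z‖ := (norm_sub_le _ _).trans (add_le_add h1 h2)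
      _ ≤ _ := by nlinarith
  · have hb : ∀ β : ℝ, 1 ≤ β → ‖powFun β z‖ ≤ ‖z‖⁻¹ := by
      intro β hβ
      rw [powFun, ← ofReal_neg, Complex.norm_cpow_real]
      have h1 := one_le_norm_one_add hθ hz
      calc ‖1 + z‖ ^ (-β) ≤ ‖1 + z‖ ^ (-1 : ℝ) :=
            Real.rpow_le_rpow_of_exponent_le h1 (by linarith)
        _ = ‖1 + z‖⁻¹ := Real.rpow_neg_one _
        _ ≤ ‖z‖⁻¹ := by gcongr; exact norm_le_norm_one_add hθ hz
    calc ‖powFun δ z + (-1) * powFun 1 z‖ ≤ ‖powFun δ z‖ + ‖powFun 1 z‖ := by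
          refine (norm_add_le _ _).trans ?_
          rw [neg_one_mul, norm_neg]
      _ ≤ ‖z‖⁻¹ + ‖z‖⁻¹ := add_le_add (hb δ hδ) (hb 1 le_rfl)
      _ ≤ _ := by
          have : 0 < ‖z‖⁻¹ := by positivity
          nlinarith

/-- The fractional powers `(1 + A)^{-δ}` with `δ ≥ 1` are bounded operators. -/
lemma exists_represents_powFun (h : IsRegularizer A θ ν e) {δ : ℝ} (hδ : 1 ≤ δ) :
    ∃ P : X →L[ℂ] X, Represents A ν e (powFun δ) P := by
  have hm := memHZero_powFun_sub h.le hδ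
  refine ⟨_, h.congr (h.add hm.expGrowth (expGrowth_powFun h.le zero_le_one)
    (h.represents_cauchyInt hm) h.represents_resApprox_one) fun z _ => by ring⟩

/-- Interpolation with `κ = 1 / 8` produces `‖z‖ ^ (1/2)`; the factor `(1 + z)⁻¹` turns this into
`‖z‖ ^ (-1/2)` at infinity. Damping the resolvent is thus a small perturbation in norm. -/
lemma memHZero_one_sub_exp (hθ : θ ≤ 1 / 8) {s : ℝ} (hs : 0 < s) :
    DifferentiableOn ℂ (fun z => (1 - exp (-((s : ℂ) * z ^ 4))) * powFun 1 z) (sector θ) ∧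
    ∀ z ∈ sector θ, ‖(1 - exp (-((s : ℂ) * z ^ 4))) * powFun 1 z‖ ≤
      (2 * s ^ (1 / 8 : ℝ)) * min (‖z‖ ^ (1 / 2 : ℝ)) (‖z‖ ^ (-(1 / 2 : ℝ))) := by
  refine ⟨(DifferentiableOn.const_sub (by fun_prop) _).mul (differentiableOn_powFun hθ 1),
    fun z hz => ?_⟩
  have h0 : 0 < ‖z‖ := norm_pos_iff.2 hz.1
  have hre : 0 ≤ ((s : ℂ) * z ^ 4).re := by
    rw [re_ofReal_mul]
    have := half_norm_pow_four_le hθ hz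
    exact mul_nonneg hs.le ((by positivity : (0 : ℝ) ≤ ‖z‖ ^ 4 / 2).trans this)
  have h3 := norm_one_sub_exp_neg_le hre (κ := 1 / 8) (by norm_num) (by norm_num)
  have e2 : ‖(s : ℂ) * z ^ 4‖ ^ (1 / 8 : ℝ) = s ^ (1 / 8 : ℝ) * ‖z‖ ^ (1 / 2 : ℝ) := by
    rw [norm_mul, norm_pow, Complex.norm_of_nonneg hs.le, Real.mul_rpow hs.le (by positivity),
      ← Real.rpow_natCast, ← Real.rpow_mul h0.le]
    congr 2
    norm_num
  rw [e2] at h3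
  have hp1 : ‖powFun 1 z‖ ≤ 1 := norm_powFun_le hθ zero_le_one hz
  have hp2 : ‖powFun 1 z‖ ≤ ‖z‖⁻¹ := by
    rw [powFun_one, norm_inv]
    gcongr
    exact norm_le_norm_one_add hθ hz
  rw [norm_mul, mul_min_of_nonneg _ _ (by positivity)]
  refine le_min ?_ ?_
  · calc _ ≤ (2 * (s ^ (1 / 8 : ℝ) * ‖z‖ ^ (1 / 2 : ℝ))) * 1 := by gcongr
      _ = _ := by ring
  · calc _ ≤ (2 * (s ^ (1 / 8 : ℝ) * ‖z‖ ^ (1 / 2 : ℝ))) * ‖z‖⁻¹ := by gcongr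
      _ = 2 * s ^ (1 / 8 : ℝ) * (‖z‖ ^ (1 / 2 : ℝ) * ‖z‖⁻¹) := by ring
      _ = _ := by
          rw [← Real.rpow_neg_one ‖z‖, ← Real.rpow_add h0]
          norm_num

lemma norm_exp_sub_exp_le {R t t' : ℝ} (ht : |t| ≤ R) (ht' : |t'| ≤ R) (z : ℂ) :
    ‖exp (I * t * z) - exp (I * t' * z)‖ ≤ |t - t'| * ‖z‖ * Real.exp (3 * R * ‖z‖) := by
  have e1 : exp (I * t * z) - exp (I * t' * z) = exp (I * t' * z) * (exp (I * (t - t' : ℝ) * z) - 1) := by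
    rw [mul_sub, ← exp_add, mul_one]
    congr 2
    push_cast; ring
  have h1 := Complex.norm_exp_sub_sum_le_norm_mul_exp (I * (t - t' : ℝ) * z) 1
  simp only [Finset.sum_range_one, pow_zero, Nat.factorial_zero, Nat.cast_one, div_one, pow_one] at h1
  have h2 : ‖I * (t - t' : ℝ) * z‖ = |t - t'| * ‖z‖ := by
    rw [norm_mul, norm_mul, norm_I, one_mul, Complex.norm_real, Real.norm_eq_abs]
  rw [h2] at h1
  have h3 : |t - t'| ≤ 2 * R := (abs_sub _ _).trans (by linarith)
  rw [e1, norm_mul]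
  calc _ ≤ Real.exp (R * ‖z‖) * (|t - t'| * ‖z‖ * Real.exp (2 * R * ‖z‖)) := by
        gcongr
        · exact (norm_exp_I_mul_le t' z).trans (by gcongr)
        · exact h1.trans (by gcongr)
    _ = |t - t'| * ‖z‖ * (Real.exp (R * ‖z‖) * Real.exp (2 * R * ‖z‖)) := by ring
    _ = _ := by rw [← Real.exp_add]; ring_nf

lemma exists_wave_sub_bound (hθ : θ ≤ 1 / 8) {s : ℝ} (hs : 0 < s) (R : ℝ) :
    ∃ B : ℝ, 0 < B ∧ ∀ t t' : ℝ, |t| ≤ R → |t'| ≤ R → ∀ z ∈ sector θ,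
      ‖(exp (I * t * z) - exp (I * t' * z)) * (exp (-(s : ℂ) * z ^ 4) * powFun 1 z)‖ ≤
        (B * |t - t'|) * min (‖z‖ ^ (1 : ℝ)) (‖z‖ ^ (-1 : ℝ)) := by
  -- The extra `1` reserves a factor `exp ‖z‖`, which absorbs the `‖z‖²` needed for decay at
  -- infinity.
  obtain ⟨B, hB, hb⟩ := exists_exp_mul_sub_le (3 * R + 1) (half_pos hs)
  refine ⟨2 * B, by positivity, fun t t' ht ht' z hz => ?_⟩
  have h0 : 0 < ‖z‖ := norm_pos_iff.2 hz.1
  have h1 := norm_exp_sub_exp_le ht ht' z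
  have h2 := norm_exp_neg_mul_pow_four_le hθ hs.le hz
  have h3 := norm_powFun_le hθ zero_le_one hz
  have h4 := hb ‖z‖ h0.le
  rw [add_mul, one_mul, Real.exp_add] at h4
  have h5 : ‖z‖ ^ 2 ≤ 2 * Real.exp ‖z‖ := by
    have := Real.quadratic_le_exp_of_nonneg h0.le
    nlinarith
  have h6 : 1 ≤ Real.exp ‖z‖ := Real.one_le_exp h0.le
  have hmain : ‖(exp (I * t * z) - exp (I * t' * z)) * (exp (-(s : ℂ) * z ^ 4) * powFun 1 z)‖ ≤
      |t - t'| * ‖z‖ * (Real.exp (3 * R * ‖z‖) * Real.exp (-(s / 2) * ‖z‖ ^ 4)) := by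
    rw [norm_mul, norm_mul]
    calc _ ≤ (|t - t'| * ‖z‖ * Real.exp (3 * R * ‖z‖)) * (Real.exp (-(s / 2) * ‖z‖ ^ 4) * 1) := by
          gcongr
      _ = _ := by ring
  set q := Real.exp (3 * R * ‖z‖) * Real.exp (-(s / 2) * ‖z‖ ^ 4) with hq
  have hq0 : 0 < q := by positivity
  have h4' : q * Real.exp ‖z‖ ≤ B := by rw [hq]; linarith
  rw [Real.rpow_one, Real.rpow_neg_one, mul_min_of_nonneg _ _ (by positivity)]
  refine hmain.trans (le_min ?_ ?_)
  · have : q ≤ 2 * B := by nlinarith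
    calc |t - t'| * ‖z‖ * q ≤ |t - t'| * ‖z‖ * (2 * B) := by gcongr
      _ = _ := by ring
  · have : ‖z‖ ^ 2 * q ≤ 2 * B := by nlinarith
    calc |t - t'| * ‖z‖ * q = |t - t'| * (‖z‖ ^ 2 * q) * ‖z‖⁻¹ := by field_simp
      _ ≤ |t - t'| * (2 * B) * ‖z‖⁻¹ := by gcongr
      _ = _ := by ring

/-- Locally bounded wave operators become norm continuous after composition with `(1 + A)⁻¹`. -/
lemma continuousOn_wave_comp (h : IsRegularizer A θ ν e) {β : ℝ} (hβ : 0 ≤ β) {J : Set ℝ}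
    {S : ℝ → X →L[ℂ] X} {R M : ℝ} (hR : ∀ t ∈ J, |t| ≤ R) (hM : ∀ t ∈ J, ‖S t‖ ≤ M)
    (hS : ∀ t ∈ J, Represents A ν e (waveFun β t) (S t)) {B : X →L[ℂ] X}
    (hB : Represents A ν e (powFun β) B) :
    ContinuousOn (fun t => S t ∘L resApprox A 1) J := by
  rcases J.eq_empty_or_nonempty with rfl | ⟨t₀, ht₀⟩
  · exact continuousOn_empty _
  have hM0 : 0 ≤ M := (norm_nonneg _).trans (hM t₀ ht₀)
  set L := resApprox A 1 with hL
  set n : ℝ → ℂ → ℂ := fun s z => (1 - exp (-((s : ℂ) * z ^ 4))) * powFun 1 z with hn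
  have hnm : ∀ s, 0 < s → MemHZero θ (n s) := fun s hs =>
    ⟨(memHZero_one_sub_exp h.le hs).1, _, 1 / 2, by norm_num, (memHZero_one_sub_exp h.le hs).2⟩
  set N : ℝ → X →L[ℂ] X := fun s => cauchyInt A ν (n s) with hN
  have g1 := expGrowth_powFun h.le zero_le_one
  have gd : ∀ s : ℝ, 0 < s → ExpGrowth θ fun z => exp (-(s : ℂ) * z ^ 4) * powFun 1 z := by
    intro s hs
    refine ExpGrowth.of_bounded ((by fun_prop : DifferentiableOn ℂ _ _).mul
      (differentiableOn_powFun h.le 1)) (C := 1) fun z hz => ?_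
    rw [norm_mul]
    refine mul_le_one₀ ((norm_exp_neg_mul_pow_four_le h.le hs.le hz).trans ?_) (norm_nonneg _)
      (norm_powFun_le h.le zero_le_one hz)
    rw [Real.exp_le_one_iff]
    have : 0 ≤ s / 2 * ‖z‖ ^ 4 := by positivity
    linarith
  -- `L - N s` is the damped resolvent. On it the wave operators are Lipschitz in `t`, and it
  -- converges in norm to `L`; local boundedness of `S` makes the convergence uniform on `J`.
  have hLN : ∀ s : ℝ, 0 < s → Represents A ν e (fun z => exp (-(s : ℂ) * z ^ 4) * powFun 1 z)
      (L + (-1 : ℂ) • N s) := by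
    intro s hs
    refine h.congr (h.add g1 ((ExpGrowth.const θ (-1)).mul (hnm s hs).expGrowth)
      h.represents_resApprox_one (smul _ (h.represents_cauchyInt (hnm s hs)))) fun z _ => ?_
    simp only [hn, neg_mul]
    ring
  have hNlim : Tendsto N (𝓝[>] 0) (𝓝 0) := by
    obtain ⟨K, hK, hKb⟩ := h.sectorial.exists_norm_cauchyInt_le h.le_pi h.pos h.lt
      (by norm_num : (0 : ℝ) < 1 / 2)
    have hlim : Tendsto (fun s : ℝ => K * (2 * s ^ (1 / 8 : ℝ))) (𝓝[>] 0) (𝓝 0) := by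
      have : Tendsto (fun s : ℝ => K * (2 * s ^ (1 / 8 : ℝ))) (𝓝 0)
          (𝓝 (K * (2 * 0 ^ (1 / 8 : ℝ)))) :=
        ((Real.continuousAt_rpow_const 0 (1 / 8) (Or.inr (by norm_num))).const_mul _).const_mul _
      rw [Real.zero_rpow (by norm_num), mul_zero, mul_zero] at this
      exact this.mono_left nhdsWithin_le_nhds
    refine squeeze_zero_norm' ?_ hlim
    filter_upwards [self_mem_nhdsWithin] with s hs
    have hs0 : (0 : ℝ) < s := hs
    exact hKb _ _ (by positivity) (memHZero_one_sub_exp h.le hs).2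
  have hcont : ∀ s, 0 < s → ContinuousOn (fun t => S t ∘L (L + (-1 : ℂ) • N s)) J := by
    intro s hs
    obtain ⟨b, hb, hbb⟩ := exists_wave_sub_bound (θ := θ) h.le hs R
    obtain ⟨K, hK, hKb⟩ := h.sectorial.exists_norm_cauchyInt_le h.le_pi h.pos h.lt one_pos
    have hlip : ∀ t ∈ J, ∀ t' ∈ J, ‖S t ∘L (L + (-1 : ℂ) • N s) - S t' ∘L (L + (-1 : ℂ) • N s)‖ ≤
        (‖B‖ * (K * b)) * ‖t - t'‖ := by
      intro t ht t' ht'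
      set q : ℂ → ℂ := fun z => (exp (I * t * z) - exp (I * t' * z)) *
        (exp (-(s : ℂ) * z ^ 4) * powFun 1 z) with hq
      have hqm : MemHZero θ q :=
        ⟨(by fun_prop : DifferentiableOn ℂ _ _).mul (gd s hs).holo, _, 1, one_pos,
          hbb t t' (hR t ht) (hR t' ht')⟩
      have e1 := h.mul (expGrowth_waveFun h.le hβ t) (gd s hs) (hS t ht) (hLN s hs)
      have e2 := h.mul (expGrowth_waveFun h.le hβ t') (gd s hs) (hS t' ht') (hLN s hs)
      have e3 := h.add ((expGrowth_waveFun h.le hβ t).mul (gd s hs))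
        ((ExpGrowth.const θ (-1)).mul ((expGrowth_waveFun h.le hβ t').mul (gd s hs)))
        e1 (smul (-1) e2)
      -- The difference of two damped wave operators factors as `B` times a Cauchy integral whose
      -- symbol is of size `|t - t'|`.
      have e4 := h.mul (expGrowth_powFun h.le hβ) hqm.expGrowth hB (h.represents_cauchyInt hqm)
      have e5 := h.unique e3 (h.congr e4 fun z _ => by simp only [hq, waveFun_eq]; ring)
      have e6 : S t ∘L (L + (-1 : ℂ) • N s) - S t' ∘L (L + (-1 : ℂ) • N s) =
          B ∘L cauchyInt A ν q := by
        rw [← e5]; module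
      rw [e6, mul_assoc]
      refine (ContinuousLinearMap.opNorm_comp_le _ _).trans ?_
      gcongr
      rw [mul_assoc]
      exact hKb _ _ (by positivity) (hbb t t' (hR t ht) (hR t' ht'))
    intro t ht
    rw [ContinuousWithinAt, tendsto_iff_norm_sub_tendsto_zero]
    have hlim : Tendsto (fun t' : ℝ => (‖B‖ * (K * b)) * ‖t' - t‖) (𝓝[J] t) (𝓝 0) := by
      have : Tendsto (fun t' : ℝ => (‖B‖ * (K * b)) * ‖t' - t‖) (𝓝 t)
          (𝓝 ((‖B‖ * (K * b)) * ‖t - t‖)) := Continuous.tendsto (by fun_prop) t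
      rw [sub_self, norm_zero, mul_zero] at this
      exact this.mono_left nhdsWithin_le_nhds
    refine squeeze_zero' (Eventually.of_forall fun _ => norm_nonneg _) ?_ hlim
    filter_upwards [self_mem_nhdsWithin] with t' ht'
    exact hlip t' ht' t ht
  have hunif : TendstoUniformlyOn (fun s t => S t ∘L (L + (-1 : ℂ) • N s))
      (fun t => S t ∘L L) (𝓝[>] 0) J := by
    rw [Metric.tendstoUniformlyOn_iff]
    intro ε hε
    have hlim : Tendsto (fun s => M * ‖N s‖) (𝓝[>] 0) (𝓝 0) := by
      simpa using hNlim.norm.const_mul M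
    filter_upwards [hlim.eventually (gt_mem_nhds hε)] with s hs t ht
    rw [dist_eq_norm]
    have : S t ∘L L - S t ∘L (L + (-1 : ℂ) • N s) = S t ∘L N s := by
      rw [ContinuousLinearMap.comp_add, ContinuousLinearMap.comp_smul]
      module
    rw [this]
    calc _ ≤ ‖S t‖ * ‖N s‖ := ContinuousLinearMap.opNorm_comp_le _ _
      _ ≤ M * ‖N s‖ := by gcongr; exact hM t ht
      _ < ε := hs
  refine hunif.continuousOn (Eventually.frequently ?_)
  filter_upwards [self_mem_nhdsWithin] with s hs using hcont s hs

/-- Superposition of wave operators with a rapidly decaying weight. -/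
lemma represents_integral (h : IsRegularizer A θ ν e) {β : ℝ} (hβ : 0 ≤ β)
    {S : ℝ → X →L[ℂ] X} (hS : ∀ t, Represents A ν e (waveFun β t) (S t))
    {c : ℝ → ℂ} (hc : Continuous c) {C a : ℝ} (ha : 0 < a)
    (hca : ∀ t, ‖c t‖ ≤ C * Real.exp (-a * t ^ 2))
    (hint : Integrable fun t => c t • S t) :
    Represents A ν e (fun z => ∫ t : ℝ, c t * waveFun β t z) (∫ t : ℝ, c t • S t) := by
  intro s hs
  have hC : 0 ≤ C := by
    have := (norm_nonneg _).trans (hca 0)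
    simpa using this
  have hd := h.mem.damp h.le hs
  have e1 : cauchyInt A ν (damp e s) ∘L (∫ t : ℝ, c t • S t) =
      ∫ t : ℝ, c t • cauchyInt A ν fun z => damp e s z * waveFun β t z := by
    have h2 := (ContinuousLinearMap.compL ℂ X X X
        (cauchyInt A ν (damp e s))).integral_comp_comm hint
    simp only [ContinuousLinearMap.compL_apply] at h2
    rw [← h2]
    refine integral_congr_ae (Eventually.of_forall fun t => ?_)
    simp only [ContinuousLinearMap.comp_smul, hS t s hs]
  rw [e1]
  set κ : ℝ → ℂ → X →L[ℂ] X := fun t u => cauchyKer A (fun z => damp e s z * waveFun β t z) u with hκ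
  obtain ⟨E, σ, hσ, hE, heb⟩ := h.mem.exists_exp_bound h.le_pi
  obtain ⟨M, hM, hMb⟩ := h.sectorial.exists_bound_exp h.pos
  -- The maximum over `r` is found by completing the square in `r ^ 2`.
  have hfin : ∃ Q : ℝ, 0 ≤ Q ∧ ∀ r : ℝ, 0 ≤ r →
      Real.exp (r ^ 2 / (2 * a)) * Real.exp (-(s / 2) * r ^ 4) ≤ Q := by
    refine ⟨Real.exp (1 / (8 * a ^ 2 * s)), (Real.exp_pos _).le, fun r hr => ?_⟩
    rw [← Real.exp_add]
    gcongr
    have : 1 / (8 * a ^ 2 * s) - (r ^ 2 / (2 * a) + -(s / 2) * r ^ 4) =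
        (1 / (2 * a) - s * r ^ 2) ^ 2 / (2 * s) := by
      field_simp; ring
    have h3 : 0 ≤ (1 / (2 * a) - s * r ^ 2) ^ 2 / (2 * s) := by positivity
    linarith
  obtain ⟨Q, hQ, hQb⟩ := hfin
  have hprod : ∀ b : ℝ, |b| = ν → Integrable (fun p : ℝ × ℝ => c p.1 • κ p.1 (p.2 + (b : ℂ) * I))
      (volume.prod volume) := by
    intro b hb
    have hb0 : b ≠ 0 := by rintro rfl; simp at hb; linarith [h.pos]
    have hbθ : |b| < θ := by rw [hb]; exact h.lt
    have hsec : ∀ x : ℝ, exp (x + (b : ℂ) * I) ∈ sector θ := fun x =>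
      exp_mem_sector h.le_pi (by simpa using hbθ)
    have hbase : Continuous fun x : ℝ => cauchyKer A (damp e s) (x + (b : ℂ) * I) :=
      h.sectorial.continuous_cauchyKer hd h.le_pi hb0 hbθ
    have hw : Continuous fun p : ℝ × ℝ => waveFun β p.1 (exp (p.2 + (b : ℂ) * I)) := by
      have h1 : Continuous fun x : ℝ => powFun β (exp (x + (b : ℂ) * I)) := by
        have := (differentiableOn_powFun h.le β).continuousOn
        exact this.comp_continuous (by fun_prop) hsec
      simp only [waveFun_eq]
      exact (h1.comp continuous_snd).mul (by fun_prop)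
    have hk : ∀ p : ℝ × ℝ, c p.1 • κ p.1 (p.2 + (b : ℂ) * I) =
        (c p.1 * waveFun β p.1 (exp (p.2 + (b : ℂ) * I))) •
          cauchyKer A (damp e s) (p.2 + (b : ℂ) * I) := by
      intro p
      simp only [hκ, cauchyKer, smul_smul]
      congr 1; ring
    simp_rw [hk]
    have hbd : Integrable (fun p : ℝ × ℝ => (C * Real.exp (-(a / 2) * p.1 ^ 2)) *
        ((Q * E * M) * Real.exp (-σ * |p.2|))) (volume.prod volume) :=
      ((integrable_exp_neg_mul_sq (half_pos ha)).const_mul C).mul_prod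
        ((integrable_exp_neg_mul_abs hσ).const_mul _)
    refine hbd.mono' (((hc.comp continuous_fst).mul hw).smul
      (hbase.comp continuous_snd)).aestronglyMeasurable (Eventually.of_forall fun p => ?_)
    have him : ((p.2 : ℂ) + b * I).im = b := by simp
    have hre : ((p.2 : ℂ) + b * I).re = p.2 := by simp
    have q1 := heb (p.2 + b * I) (by rw [him]; exact hbθ)
    have q2 := hMb (p.2 + b * I) (by rw [him, hb]) (by rw [him]; linarith [h.le_pi])
    set z := exp (p.2 + (b : ℂ) * I) with hz
    have q3 := norm_exp_neg_mul_pow_four_le h.le hs.le (hsec p.2)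
    rw [← hz] at q3
    have q4 : ‖waveFun β p.1 z‖ ≤ Real.exp (|p.1| * ‖z‖) := by
      rw [waveFun_eq, norm_mul]
      calc _ ≤ 1 * Real.exp (|p.1| * ‖z‖) := by
            gcongr
            · exact norm_powFun_le h.le hβ (hsec p.2)
            · exact norm_exp_I_mul_le _ _
        _ = _ := one_mul _
    have q5 := hQb ‖z‖ (norm_nonneg _)
    rw [hre] at q1
    -- Completing the square keeps half of the Gaussian in `t` and leaves Gaussian growth in `‖z‖`,
    -- which quartic damping absorbs. This makes the double integral absolutely convergent and
    -- justifies Fubini's theorem.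
    have q6 : Real.exp (-a * p.1 ^ 2) * Real.exp (|p.1| * ‖z‖) ≤
        Real.exp (-(a / 2) * p.1 ^ 2) * Real.exp (‖z‖ ^ 2 / (2 * a)) := by
      rw [← Real.exp_add, ← Real.exp_add]
      refine Real.exp_le_exp.2 ?_
      have e0 : -(a / 2) * p.1 ^ 2 + ‖z‖ ^ 2 / (2 * a) - (-a * p.1 ^ 2 + |p.1| * ‖z‖) =
          (a * |p.1| - ‖z‖) ^ 2 / (2 * a) := by
        rw [← sq_abs p.1]
        field_simp; ring
      have : 0 ≤ (a * |p.1| - ‖z‖) ^ 2 / (2 * a) := by positivity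
      linarith
    have hRn : ‖cauchyKer A (damp e s) (p.2 + (b : ℂ) * I)‖ ≤
        (E * Real.exp (-σ * |p.2|)) * Real.exp (-(s / 2) * ‖z‖ ^ 4) * M := by
      rw [cauchyKer, ← hz, norm_smul, norm_mul, damp, norm_mul]
      calc _ = ‖e z‖ * ‖exp (-(s : ℂ) * z ^ 4)‖ * (‖z‖ * ‖SmoothedCalculus.resolv A z‖) := by ring
        _ ≤ _ := by gcongr
    rw [norm_smul, norm_mul]
    calc _ ≤ ((C * Real.exp (-a * p.1 ^ 2)) * Real.exp (|p.1| * ‖z‖)) *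
          ((E * Real.exp (-σ * |p.2|)) * Real.exp (-(s / 2) * ‖z‖ ^ 4) * M) := by
          gcongr
          exact hca p.1
      _ = (C * E * M * Real.exp (-σ * |p.2|) * Real.exp (-(s / 2) * ‖z‖ ^ 4)) *
          (Real.exp (-a * p.1 ^ 2) * Real.exp (|p.1| * ‖z‖)) := by ring
      _ ≤ (C * E * M * Real.exp (-σ * |p.2|) * Real.exp (-(s / 2) * ‖z‖ ^ 4)) *
          (Real.exp (-(a / 2) * p.1 ^ 2) * Real.exp (‖z‖ ^ 2 / (2 * a))) := by gcongr
      _ = (C * E * M * Real.exp (-σ * |p.2|) * Real.exp (-(a / 2) * p.1 ^ 2)) *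
          (Real.exp (‖z‖ ^ 2 / (2 * a)) * Real.exp (-(s / 2) * ‖z‖ ^ 4)) := by ring
      _ ≤ (C * E * M * Real.exp (-σ * |p.2|) * Real.exp (-(a / 2) * p.1 ^ 2)) * Q := by gcongr
      _ = _ := by ring
  have hswap : ∀ b : ℝ, |b| = ν → (∫ t : ℝ, c t • ∫ x : ℝ, κ t (x + (b : ℂ) * I)) =
      ∫ x : ℝ, cauchyKer A (fun z => damp e s z * ∫ t : ℝ, c t * waveFun β t z) (x + (b : ℂ) * I) := by
    intro b hb
    have := integral_integral_swap (f := fun t x : ℝ => c t • κ t (x + (b : ℂ) * I)) (hprod b hb)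
    simp_rw [integral_smul] at this
    rw [this]
    refine integral_congr_ae (Eventually.of_forall fun x => ?_)
    simp only [hκ, cauchyKer, smul_smul]
    rw [integral_smul_const]
    congr 1
    rw [← integral_const_mul, ← integral_mul_const]
    refine integral_congr_ae (Eventually.of_forall fun t => ?_)
    simp only
    ring
  have hi : ∀ b : ℝ, |b| = ν → Integrable fun t : ℝ => c t • ∫ x : ℝ, κ t (x + (b : ℂ) * I) := by
    intro b hb
    refine (hprod b hb).integral_prod_left.congr (Eventually.of_forall fun t => ?_)
    exact integral_smul (c t) _
  rw [cauchyInt_eq, ← hswap (-ν) (by rw [abs_neg, abs_of_pos h.pos]),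
    ← hswap ν (abs_of_pos h.pos), ← integral_sub (hi (-ν) (by rw [abs_neg, abs_of_pos h.pos]))
    (hi ν (abs_of_pos h.pos)), ← integral_smul]
  refine integral_congr_ae (Eventually.of_forall fun t => ?_)
  simp only [cauchyInt_eq, hκ]
  rw [← smul_sub, smul_comm]

end IsRegularizer

end Operators

end SmoothedCalculus

end

noncomputable section

namespace SmoothedCalculus

/-! ### The Fourier transform without normalization -/

section Fourier

/-- The Fourier transform `t ↦ ∫ h(y) e^{-ity} dy`. -/
def ft (h : ℝ → ℂ) (t : ℝ) : ℂ := ∫ y : ℝ, h y * exp (-(I * t * y))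

lemma norm_exp_neg_I_mul (t y : ℝ) : ‖exp (-(I * t * y))‖ = 1 := by
  rw [norm_exp]; simp

lemma norm_exp_I_mul_real (t y : ℝ) : ‖exp (I * t * y)‖ = 1 := by
  rw [norm_exp]; simp

lemma integrable_mul_exp {h : ℝ → ℂ} (hh : Integrable h) (t : ℝ) :
    Integrable fun y : ℝ => h y * exp (-(I * t * y)) :=
  hh.mul_bdd (c := 1) (Continuous.aestronglyMeasurable (by fun_prop))
    (Eventually.of_forall fun y => (norm_exp_neg_I_mul t y).le)

lemma norm_ft_le (h : ℝ → ℂ) (t : ℝ) : ‖ft h t‖ ≤ ∫ y, ‖h y‖ := by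
  refine (norm_integral_le_integral_norm _).trans (le_of_eq ?_)
  refine integral_congr_ae (Eventually.of_forall fun y => ?_)
  simp only [norm_mul, norm_exp_neg_I_mul, mul_one]

lemma continuous_ft {h : ℝ → ℂ} (hh : Integrable h) : Continuous (ft h) := by
  refine continuous_of_dominated (bound := fun y => ‖h y‖) (fun t => ?_) (fun t => ?_) hh.norm ?_
  · exact (integrable_mul_exp hh t).aestronglyMeasurable
  · exact Eventually.of_forall fun y => by rw [norm_mul, norm_exp_neg_I_mul, mul_one]
  · exact Eventually.of_forall fun y => by fun_prop

end Fourier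

/-! ### Gaussian weights and the mollified function as a Fourier integral -/

section Gaussian

open Polynomial in
/-- The polynomials `Qₖ` with `(i d/dt)ᵏ e^{-t²} = Qₖ(t) e^{-t²}`. -/
def gaussPoly : ℕ → Polynomial ℂ
  | 0 => 1
  | k + 1 => C I * (derivative (gaussPoly k) - 2 * X * gaussPoly k)

/-- The derivatives `(i d/dt)ᵏ e^{-ε t²}`. -/
def gaussDeriv (ε : ℝ) (k : ℕ) (t : ℝ) : ℂ :=
  (Real.sqrt ε : ℂ) ^ k * (gaussPoly k).eval (Real.sqrt ε * t : ℂ) * exp (-(ε : ℂ) * (t : ℂ) ^ 2)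

/-- A polynomial uses up only half of the Gaussian exponent; the other half stays available for
integrability. -/
lemma exists_norm_eval_le (p : Polynomial ℂ) :
    ∃ C : ℝ, 0 ≤ C ∧ ∀ t : ℝ, ‖p.eval (t : ℂ)‖ ≤ C * Real.exp (t ^ 2 / 2) := by
  induction p using Polynomial.induction_on' with
  | add p q hp hq =>
    obtain ⟨C, hC, h⟩ := hp
    obtain ⟨C', hC', h'⟩ := hq
    refine ⟨C + C', by positivity, fun t => ?_⟩
    rw [Polynomial.eval_add, add_mul]
    exact (norm_add_le _ _).trans (add_le_add (h t) (h' t))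
  | monomial n a =>
    refine ⟨‖a‖ * (n.factorial * Real.exp (1 / 2)), by positivity, fun t => ?_⟩
    rw [Polynomial.eval_monomial, norm_mul, norm_pow, Complex.norm_real, Real.norm_eq_abs, mul_assoc]
    gcongr
    have h1 := Real.pow_div_factorial_le_exp |t| (abs_nonneg t) n
    rw [div_le_iff₀ (by positivity)] at h1
    calc |t| ^ n ≤ Real.exp |t| * n.factorial := h1
      _ ≤ Real.exp (1 / 2 + t ^ 2 / 2) * n.factorial := by
          gcongr
          nlinarith [sq_abs t, sq_nonneg (|t| - 1)]
      _ = _ := by rw [Real.exp_add]; ring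

lemma exists_norm_gaussDeriv_le (k : ℕ) : ∃ C : ℝ, 0 ≤ C ∧ ∀ ε : ℝ, 0 < ε → ∀ t : ℝ,
    ‖gaussDeriv ε k t‖ ≤ C * Real.sqrt ε ^ k * Real.exp (-(ε / 2) * t ^ 2) := by
  obtain ⟨C, hC, h⟩ := exists_norm_eval_le (gaussPoly k)
  refine ⟨C, hC, fun ε hε t => ?_⟩
  have h1 := h (Real.sqrt ε * t)
  rw [mul_pow, Real.sq_sqrt hε.le] at h1
  have h2 : ‖exp (-(ε : ℂ) * (t : ℂ) ^ 2)‖ = Real.exp (-ε * t ^ 2) := by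
    rw [norm_exp]
    congr 1
    rw [← ofReal_neg, ← ofReal_pow, re_ofReal_mul, ofReal_re]
  rw [gaussDeriv, norm_mul, norm_mul, norm_pow, Complex.norm_of_nonneg (Real.sqrt_nonneg ε), h2]
  push_cast at h1
  calc _ ≤ Real.sqrt ε ^ k * (C * Real.exp (ε * t ^ 2 / 2)) * Real.exp (-ε * t ^ 2) := by gcongr
    _ = C * Real.sqrt ε ^ k * (Real.exp (ε * t ^ 2 / 2) * Real.exp (-ε * t ^ 2)) := by ring
    _ = _ := by rw [← Real.exp_add]; ring_nf

lemma continuous_gaussDeriv (ε : ℝ) (k : ℕ) : Continuous (gaussDeriv ε k) := by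
  unfold gaussDeriv
  have := (gaussPoly k).continuous
  fun_prop

lemma hasDerivAt_gaussDeriv {ε : ℝ} (hε : 0 < ε) (k : ℕ) (t : ℝ) :
    HasDerivAt (gaussDeriv ε k) (-I * gaussDeriv ε (k + 1) t) t := by
  have hs : (Real.sqrt ε : ℂ) ^ 2 = ε := by
    rw [← ofReal_pow, Real.sq_sqrt hε.le]
  have h1 : HasDerivAt (fun t : ℝ => (Real.sqrt ε : ℂ) * (t : ℂ)) (Real.sqrt ε : ℂ) t := by
    simpa using (Complex.ofRealCLM.hasDerivAt (x := t)).const_mul (Real.sqrt ε : ℂ)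
  have h2 := ((gaussPoly k).hasDerivAt (Real.sqrt ε * t : ℂ)).comp t h1
  have h3 : HasDerivAt (fun t : ℝ => exp (-(ε : ℂ) * (t : ℂ) ^ 2))
      (exp (-(ε : ℂ) * (t : ℂ) ^ 2) * (-(ε : ℂ) * (2 * t))) t := by
    have := (((Complex.ofRealCLM.hasDerivAt (x := t)).pow 2).const_mul (-(ε : ℂ))).cexp
    simpa using this
  have h4 := (h2.const_mul ((Real.sqrt ε : ℂ) ^ k)).mul h3
  refine h4.congr_deriv ?_
  simp only [Function.comp_def, gaussDeriv, gaussPoly, Polynomial.eval_mul, Polynomial.eval_sub,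
    Polynomial.eval_C, Polynomial.eval_X, Polynomial.eval_ofNat]
  rw [← hs]
  linear_combination ((Real.sqrt ε : ℂ) ^ (k + 1) *
    ((gaussPoly k).derivative.eval (Real.sqrt ε * t : ℂ) -
      2 * (Real.sqrt ε * t) * (gaussPoly k).eval (Real.sqrt ε * t : ℂ)) *
      exp (-(Real.sqrt ε : ℂ) ^ 2 * (t : ℂ) ^ 2)) * I_sq

lemma integrable_exp_sq_mul_exp_abs {a : ℝ} (ha : 0 < a) (b : ℝ) :
    Integrable fun t : ℝ => Real.exp (-a * t ^ 2) * Real.exp (b * |t|) := by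
  refine ((integrable_exp_neg_mul_sq (half_pos ha)).const_mul
    (Real.exp (b ^ 2 / (2 * a)))).mono' (Continuous.aestronglyMeasurable (by fun_prop))
    (Eventually.of_forall fun t => ?_)
  rw [Real.norm_of_nonneg (by positivity), ← Real.exp_add, ← Real.exp_add]
  refine Real.exp_le_exp.2 ?_
  have e0 : b ^ 2 / (2 * a) + -(a / 2) * t ^ 2 - (-a * t ^ 2 + b * |t|) =
      (a * |t| - b) ^ 2 / (2 * a) := by
    rw [← sq_abs t]
    field_simp; ring
  have : 0 ≤ (a * |t| - b) ^ 2 / (2 * a) := by positivity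
  linarith

lemma integrable_gaussDeriv_mul_exp {ε : ℝ} (hε : 0 < ε) (k : ℕ) (w : ℂ) :
    Integrable fun t : ℝ => gaussDeriv ε k t * exp (I * t * w) := by
  obtain ⟨C, hC, h⟩ := exists_norm_gaussDeriv_le k
  refine ((integrable_exp_sq_mul_exp_abs (half_pos hε) ‖w‖).const_mul
    (C * Real.sqrt ε ^ k)).mono'
    ((continuous_gaussDeriv ε k).mul (by fun_prop)).aestronglyMeasurable
    (Eventually.of_forall fun t => ?_)
  rw [norm_mul, ← mul_assoc]
  gcongr
  · exact h ε hε t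
  · rw [mul_comm ‖w‖]
    exact norm_exp_I_mul_le t w

/-- For `k = 0` this is the Fourier transform of a Gaussian at a complex point. Each derivative `i
d/dt` contributes a factor `w` by partial integration. -/
lemma integral_gaussDeriv_mul_exp {ε : ℝ} (hε : 0 < ε) (k : ℕ) (w : ℂ) :
    ∫ t : ℝ, gaussDeriv ε k t * exp (I * t * w) = 2 * Real.pi *
      (w ^ k * (((Real.sqrt (4 * Real.pi * ε) : ℝ) : ℂ)⁻¹ * exp (-w ^ 2 / (4 * ε)))) := by
  induction k with
  | zero =>
    have h1 := fourierIntegral_gaussian (b := (ε : ℂ)) (by simpa using hε) w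
    have e1 : ∀ t : ℝ, gaussDeriv ε 0 t * exp (I * t * w) =
        exp (I * w * t) * exp (-(ε : ℂ) * (t : ℂ) ^ 2) := by
      intro t
      simp only [gaussDeriv, gaussPoly, pow_zero, Polynomial.eval_one, one_mul]
      rw [mul_comm, mul_right_comm]
    simp_rw [e1]
    rw [h1, pow_zero, one_mul, ← mul_assoc]
    congr 1
    have hpi := Real.pi_pos
    rw [show (1 / 2 : ℂ) = ((1 / 2 : ℝ) : ℂ) by push_cast; ring, ← ofReal_div,
      ← ofReal_cpow (by positivity), ← Real.sqrt_eq_rpow, ← ofReal_inv]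
    norm_cast
    have h2 : Real.sqrt (4 * Real.pi * ε) * Real.sqrt (Real.pi / ε) = 2 * Real.pi := by
      rw [← Real.sqrt_mul (by positivity), show 4 * Real.pi * ε * (Real.pi / ε) = (2 * Real.pi) ^ 2 by
        field_simp; ring, Real.sqrt_sq (by positivity)]
    have h3 : 0 < Real.sqrt (4 * Real.pi * ε) := by positivity
    rw [← h2]
    field_simp
  | succ k ih =>
    have hi := integrable_gaussDeriv_mul_exp hε k w
    have hi' := integrable_gaussDeriv_mul_exp hε (k + 1) w
    have hd : ∀ t : ℝ, HasDerivAt (fun t : ℝ => gaussDeriv ε k t * exp (I * t * w))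
        (-I * (gaussDeriv ε (k + 1) t * exp (I * t * w)) +
          (I * w) * (gaussDeriv ε k t * exp (I * t * w))) t := by
      intro t
      have h1 : HasDerivAt (fun t : ℝ => I * (t : ℂ) * w) (I * w) t := by
        simpa using ((Complex.ofRealCLM.hasDerivAt (x := t)).const_mul I).mul_const w
      refine ((hasDerivAt_gaussDeriv hε k t).mul h1.cexp).congr_deriv ?_
      ring
    have h0 := integral_eq_zero_of_hasDerivAt_of_integrable hd
      ((hi'.const_mul (-I)).add (hi.const_mul (I * w))) hi
    rw [integral_add (hi'.const_mul (-I)) (hi.const_mul (I * w)), integral_const_mul,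
      integral_const_mul, ih] at h0
    have h5 : I * (∫ t : ℝ, gaussDeriv ε (k + 1) t * exp (I * t * w)) = I * (2 * Real.pi *
      (w ^ (k + 1) * (((Real.sqrt (4 * Real.pi * ε) : ℝ) : ℂ)⁻¹ * exp (-w ^ 2 / (4 * ε))))) := by
      rw [pow_succ]
      linear_combination -h0
    exact mul_left_cancel₀ I_ne_zero h5

lemma gaussDeriv_zero (ε t : ℝ) : gaussDeriv ε 0 t = exp (-(ε : ℂ) * (t : ℂ) ^ 2) := by
  simp [gaussDeriv, gaussPoly]

lemma tendsto_gaussDeriv (k : ℕ) (t : ℝ) :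
    Tendsto (fun ε => gaussDeriv ε k t) (𝓝[>] 0) (𝓝 (if k = 0 then 1 else 0)) := by
  rcases eq_or_ne k 0 with rfl | hk
  · simp only [if_true, gaussDeriv_zero]
    have : Tendsto (fun ε : ℝ => exp (-(ε : ℂ) * (t : ℂ) ^ 2)) (𝓝 0)
        (𝓝 (exp (-((0 : ℝ) : ℂ) * (t : ℂ) ^ 2))) := Continuous.tendsto (by fun_prop) 0
    simp only [ofReal_zero, neg_zero, zero_mul, exp_zero] at this
    exact this.mono_left nhdsWithin_le_nhds
  · rw [if_neg hk]
    have hp := (gaussPoly k).continuous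
    have : Tendsto (fun ε : ℝ => gaussDeriv ε k t) (𝓝 0) (𝓝 (gaussDeriv 0 k t)) := by
      refine Continuous.tendsto ?_ 0
      unfold gaussDeriv
      have h1 : Continuous fun ε : ℝ => ((Real.sqrt ε : ℝ) : ℂ) :=
        continuous_ofReal.comp Real.continuous_sqrt
      fun_prop
    have h0 : gaussDeriv 0 k t = 0 := by simp [gaussDeriv, hk]
    rw [h0] at this
    exact this.mono_left nhdsWithin_le_nhds

/-- The weight `c_ε` with `(1 + z)ᵐ (f * g_ε)(z) = ∫ c_ε(t) e^{itz} dt`. -/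
def mollWeight (f : ℝ → ℂ) (m : ℕ) (ε t : ℝ) : ℂ :=
  (2 * (Real.pi : ℂ))⁻¹ * ∑ k ∈ Finset.range (m + 1),
    (m.choose k : ℂ) * (ft (fun y => (1 + (y : ℂ)) ^ (m - k) * f y) t * gaussDeriv ε k t)

lemma integrable_continuous_mul {f g : ℝ → ℂ} (hf : Integrable f) (hc : HasCompactSupport f)
    (hg : Continuous g) : Integrable fun y : ℝ => g y * f y := by
  have h1 : IntegrableOn (fun y : ℝ => g y * f y) (tsupport f) :=
    IntegrableOn.continuousOn_mul hg.continuousOn hf.integrableOn hc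
  refine (integrableOn_iff_integrable_of_support_subset ?_).1 h1
  exact (Function.support_mul_subset_right _ _).trans (subset_tsupport f)

lemma integrable_pow_mul {f : ℝ → ℂ} (hf : Integrable f) (hc : HasCompactSupport f) (j : ℕ) :
    Integrable fun y : ℝ => (1 + (y : ℂ)) ^ j * f y :=
  integrable_continuous_mul hf hc (by fun_prop)

lemma continuous_mollWeight {f : ℝ → ℂ} (hf : Integrable f) (hc : HasCompactSupport f) (m : ℕ)
    (ε : ℝ) : Continuous (mollWeight f m ε) := by
  unfold mollWeight
  refine continuous_const.mul (continuous_finsetSum _ fun k _ => continuous_const.mul ?_)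
  exact (continuous_ft (integrable_pow_mul hf hc _)).mul (continuous_gaussDeriv ε k)

lemma exists_norm_mollWeight_le_exp (f : ℝ → ℂ) (m : ℕ) {ε : ℝ} (hε : 0 < ε) :
    ∃ C : ℝ, ∀ t, ‖mollWeight f m ε t‖ ≤ C * Real.exp (-(ε / 2) * t ^ 2) := by
  choose C hC h using fun k => exists_norm_gaussDeriv_le k
  refine ⟨‖(2 * (Real.pi : ℂ))⁻¹‖ * ∑ k ∈ Finset.range (m + 1), (m.choose k : ℝ) *
    ((∫ y : ℝ, ‖(1 + (y : ℂ)) ^ (m - k) * f y‖) * (C k * Real.sqrt ε ^ k)), fun t => ?_⟩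
  rw [mollWeight, norm_mul, mul_assoc, Finset.sum_mul]
  gcongr
  refine (norm_sum_le _ _).trans (Finset.sum_le_sum fun k _ => ?_)
  rw [norm_mul, norm_mul, Complex.norm_natCast, mul_assoc, mul_assoc]
  gcongr
  · exact norm_ft_le _ _
  · exact h k ε hε t

/-- The bound is uniform in `ε ≤ 1` and provides the dominating function as `ε → 0`. -/
lemma exists_norm_mollWeight_le (f : ℝ → ℂ) (m : ℕ) :
    ∃ C : ℝ, 0 ≤ C ∧ ∀ ε, 0 < ε → ε ≤ 1 → ∀ t, ‖mollWeight f m ε t‖ ≤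
      C * ∑ k ∈ Finset.range (m + 1), ‖ft (fun y => (1 + (y : ℂ)) ^ (m - k) * f y) t‖ := by
  choose C hC h using fun k => exists_norm_gaussDeriv_le k
  refine ⟨‖(2 * (Real.pi : ℂ))⁻¹‖ * ∑ k ∈ Finset.range (m + 1), (m.choose k : ℝ) * C k,
    mul_nonneg (norm_nonneg _) (Finset.sum_nonneg fun k _ => mul_nonneg (by positivity) (hC k)),
    fun ε hε h1 t => ?_⟩
  rw [mollWeight, norm_mul, mul_assoc, Finset.sum_mul]
  gcongr
  refine (norm_sum_le _ _).trans (Finset.sum_le_sum fun k hk => ?_)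
  rw [norm_mul, norm_mul, Complex.norm_natCast, mul_assoc]
  refine mul_le_mul_of_nonneg_left ?_ (Nat.cast_nonneg _)
  rw [mul_comm]
  have h2 := h k ε hε t
  have h3 : Real.sqrt ε ^ k ≤ 1 := pow_le_one₀ (Real.sqrt_nonneg _) (Real.sqrt_le_one.2 h1)
  have h4 : Real.exp (-(ε / 2) * t ^ 2) ≤ 1 := Real.exp_le_one_iff.2 (by nlinarith [sq_nonneg t])
  have h5 : ‖gaussDeriv ε k t‖ ≤ C k := by
    refine h2.trans ?_
    calc C k * Real.sqrt ε ^ k * Real.exp (-(ε / 2) * t ^ 2) ≤ C k * 1 * 1 := by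
          have := hC k
          gcongr
      _ = C k := by ring
  have h6 := Finset.single_le_sum (f := fun k =>
    ‖ft (fun y : ℝ => (1 + (y : ℂ)) ^ (m - k) * f y) t‖) (fun _ _ => norm_nonneg _) hk
  exact mul_le_mul h5 h6 (norm_nonneg _) (hC k)

/-- Terms with `k > 0` carry a factor `√ε ^ k` and disappear, so only the transform of `(1 + y) ^ m
f` survives. -/
lemma tendsto_mollWeight (f : ℝ → ℂ) (m : ℕ) (t : ℝ) :
    Tendsto (fun ε => mollWeight f m ε t) (𝓝[>] 0)
      (𝓝 ((2 * (Real.pi : ℂ))⁻¹ * ft (fun y => (1 + (y : ℂ)) ^ m * f y) t)) := by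
  have h1 : Tendsto (fun ε => mollWeight f m ε t) (𝓝[>] 0)
      (𝓝 ((2 * (Real.pi : ℂ))⁻¹ * ∑ k ∈ Finset.range (m + 1), (m.choose k : ℂ) *
        (ft (fun y => (1 + (y : ℂ)) ^ (m - k) * f y) t * if k = 0 then 1 else 0))) := by
    refine Tendsto.const_mul _ (tendsto_finsetSum _ fun k _ => Tendsto.const_mul _ ?_)
    exact (tendsto_gaussDeriv k t).const_mul _
  convert h1 using 3
  rw [Finset.sum_eq_single 0]
  · simp
  · intro k _ hk; simp [hk]
  · simp

lemma integral_ft_mul_gaussDeriv {h : ℝ → ℂ} (hh : Integrable h) {ε : ℝ} (hε : 0 < ε) (k : ℕ)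
    (z : ℂ) :
    Integrable (fun t : ℝ => ft h t * gaussDeriv ε k t * exp (I * t * z)) ∧
    Integrable (fun y : ℝ => h y * ((z - y) ^ k *
      (((Real.sqrt (4 * Real.pi * ε) : ℝ) : ℂ)⁻¹ * exp (-(z - y) ^ 2 / (4 * ε))))) ∧
    ∫ t : ℝ, ft h t * gaussDeriv ε k t * exp (I * t * z) =
      2 * Real.pi * ∫ y : ℝ, h y * ((z - y) ^ k *
        (((Real.sqrt (4 * Real.pi * ε) : ℝ) : ℂ)⁻¹ * exp (-(z - y) ^ 2 / (4 * ε)))) := by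
  have hg := integrable_gaussDeriv_mul_exp hε k z
  have hP : Integrable (fun p : ℝ × ℝ => (gaussDeriv ε k p.1 * exp (I * p.1 * z)) *
      (h p.2 * exp (-(I * p.1 * p.2)))) (volume.prod volume) := by
    have h1 : Integrable (fun p : ℝ × ℝ => (gaussDeriv ε k p.1 * exp (I * p.1 * z)) * h p.2)
      (volume.prod volume) := hg.mul_prod hh
    have h2 := h1.mul_bdd (c := 1) (g := fun p : ℝ × ℝ => exp (-(I * p.1 * p.2)))
      (Continuous.aestronglyMeasurable (by fun_prop))
      (Eventually.of_forall fun p => (norm_exp_neg_I_mul _ _).le)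
    refine h2.congr (Eventually.of_forall fun p => ?_)
    simp only; ring
  have hL : ∀ t : ℝ, ∫ y : ℝ, (gaussDeriv ε k t * exp (I * t * z)) * (h y * exp (-(I * t * y))) =
      ft h t * gaussDeriv ε k t * exp (I * t * z) := by
    intro t
    rw [integral_const_mul, ← ft]
    ring
  have hR : ∀ y : ℝ, ∫ t : ℝ, (gaussDeriv ε k t * exp (I * t * z)) * (h y * exp (-(I * t * y))) =
      2 * Real.pi * (h y * ((z - y) ^ k *
        (((Real.sqrt (4 * Real.pi * ε) : ℝ) : ℂ)⁻¹ * exp (-(z - y) ^ 2 / (4 * ε))))) := by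
    intro y
    have := integral_gaussDeriv_mul_exp hε k (z - y)
    rw [← mul_assoc, mul_comm (2 * (Real.pi : ℂ)) (h y), mul_assoc, ← this, ← integral_const_mul]
    refine integral_congr_ae (Eventually.of_forall fun t => ?_)
    simp only
    rw [mul_sub, sub_eq_add_neg, exp_add]
    ring
  have hpi : (2 * (Real.pi : ℂ)) ≠ 0 := by simp [Real.pi_ne_zero]
  refine ⟨hP.integral_prod_left.congr (Eventually.of_forall hL), ?_, ?_⟩
  · have := (hP.integral_prod_right.congr (Eventually.of_forall hR)).const_mul
      (2 * (Real.pi : ℂ))⁻¹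
    refine this.congr (Eventually.of_forall fun y => ?_)
    simp only
    rw [inv_mul_cancel_left₀ hpi]
  · rw [← integral_const_mul]
    simp_rw [← hL, ← hR]
    exact integral_integral_swap (f := fun t y : ℝ => (gaussDeriv ε k t * exp (I * t * z)) *
      (h y * exp (-(I * t * y)))) hP

lemma integral_mollWeight_mul_exp {f : ℝ → ℂ} (hf : Integrable f) (hc : HasCompactSupport f)
    (m : ℕ) {ε : ℝ} (hε : 0 < ε) (z : ℂ) :
    ∫ t : ℝ, mollWeight f m ε t * exp (I * t * z) = (1 + z) ^ m * gaussMollify f ε z := by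
  have hpi : (2 * (Real.pi : ℂ)) ≠ 0 := by simp [Real.pi_ne_zero]
  have key := fun k => integral_ft_mul_gaussDeriv (integrable_pow_mul hf hc (m - k)) hε k z
  have e1 : ∀ t : ℝ, mollWeight f m ε t * exp (I * t * z) = ∑ k ∈ Finset.range (m + 1),
      (2 * (Real.pi : ℂ))⁻¹ * ((m.choose k : ℂ) *
        (ft (fun y => (1 + (y : ℂ)) ^ (m - k) * f y) t * gaussDeriv ε k t * exp (I * t * z))) := by
    intro t
    rw [mollWeight, mul_assoc, Finset.sum_mul, Finset.mul_sum]
    refine Finset.sum_congr rfl fun k _ => ?_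
    ring
  simp_rw [e1]
  rw [integral_finsetSum _ fun k _ => (((key k).1).const_mul _).const_mul _]
  have e2 : ∀ k ∈ Finset.range (m + 1), ∫ t : ℝ, (2 * (Real.pi : ℂ))⁻¹ * ((m.choose k : ℂ) *
        (ft (fun y => (1 + (y : ℂ)) ^ (m - k) * f y) t * gaussDeriv ε k t * exp (I * t * z))) =
      ∫ y : ℝ, (m.choose k : ℂ) * ((1 + (y : ℂ)) ^ (m - k) * f y * ((z - y) ^ k *
        (((Real.sqrt (4 * Real.pi * ε) : ℝ) : ℂ)⁻¹ * exp (-(z - y) ^ 2 / (4 * ε))))) := by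
    intro k _
    rw [integral_const_mul, integral_const_mul, (key k).2.2, integral_const_mul]
    rw [mul_left_comm, inv_mul_cancel_left₀ hpi]
  rw [Finset.sum_congr rfl e2, ← integral_finsetSum _ fun k _ => ((key k).2.1).const_mul _,
    gaussMollify, ← integral_const_mul]
  refine integral_congr_ae (Eventually.of_forall fun y => ?_)
  simp only
  -- Expanding `1 + z = (z - y) + (1 + y)` moves the polynomial partly onto the Gaussian and partly
  -- onto `f`; this dictates the form of `mollWeight`.
  have hb : (1 + z) ^ m = ∑ k ∈ Finset.range (m + 1),
      (z - y) ^ k * (1 + (y : ℂ)) ^ (m - k) * (m.choose k : ℂ) := by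
    rw [← add_pow]; congr 1; ring
  rw [hb, Finset.sum_mul]
  refine Finset.sum_congr rfl fun k _ => ?_
  ring

end Gaussian

/-! ### Boundedness and holomorphy of the mollified function -/

section Mollification

/-- On a narrow sector `z.im ^ 2 ≤ z.re ^ 2 / 2`, and `(z.re - y)² + y² - z.im²` equals `(z.re - 2
y)² / 2 + z.re² / 2 - z.im²`. Hence the Gaussian stays bounded although it is not so on the whole
plane. -/
lemma norm_gauss_le {θ : ℝ} (hθ : θ ≤ 1 / 8) {ε : ℝ} (hε : 0 < ε) {z : ℂ} (hz : z ∈ sector θ)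
    (y : ℝ) : ‖exp (-(z - y) ^ 2 / (4 * ε))‖ ≤ Real.exp (y ^ 2 / (4 * ε)) := by
  rw [norm_exp]
  refine Real.exp_le_exp.2 ?_
  have e1 : (-(z - y) ^ 2 / (4 * ε) : ℂ).re = -((z.re - y) ^ 2 - z.im ^ 2) / (4 * ε) := by
    rw [show (4 * (ε : ℂ)) = ((4 * ε : ℝ) : ℂ) by push_cast; ring, div_ofReal_re]
    congr 1
    rw [sq]
    simp
    ring
  rw [e1]
  gcongr
  have hpi := Real.pi_gt_three
  have h1 : z ∈ sector (1 / 8) := sector_mono hθ hz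
  rw [sector_eq (by norm_num) (by linarith)] at h1
  have h2 : ‖z‖ * Real.cos (1 / 8) < z.re := h1
  have h3 := Real.one_sub_sq_div_two_le_cos (x := 1 / 8)
  have h4 : ‖z‖ * (127 / 128) ≤ z.re := by
    refine le_trans ?_ h2.le
    gcongr
    norm_num at h3 ⊢
    linarith
  have h5 : ‖z‖ ^ 2 = z.re ^ 2 + z.im ^ 2 := by
    rw [← Complex.normSq_eq_norm_sq, Complex.normSq_apply]; ring
  have h6 : 0 ≤ ‖z‖ := norm_nonneg z
  have h7 : ‖z‖ ^ 2 * (127 / 128) ^ 2 ≤ z.re ^ 2 := by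
    rw [← mul_pow]; gcongr
  nlinarith [sq_nonneg (z.re - 2 * y)]

lemma exists_norm_gaussMollify_le {θ : ℝ} (hθ : θ ≤ 1 / 8) {f : ℝ → ℂ} (hf : Integrable f)
    (hc : HasCompactSupport f) {ε : ℝ} (hε : 0 < ε) :
    ∃ C : ℝ, ∀ z ∈ sector θ, ‖gaussMollify f ε z‖ ≤ C := by
  have hi : Integrable fun y : ℝ =>
      ‖((((Real.sqrt (4 * Real.pi * ε) : ℝ) : ℂ)⁻¹ * (Real.exp (y ^ 2 / (4 * ε)) : ℝ) : ℂ)) * f y‖ := by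
    refine (integrable_continuous_mul hf hc (Continuous.mul continuous_const ?_)).norm
    exact continuous_ofReal.comp (by fun_prop)
  refine ⟨_, fun z hz => norm_integral_le_of_norm_le hi (Eventually.of_forall fun y => ?_)⟩
  rw [norm_mul, norm_mul, norm_mul, norm_mul, mul_comm ‖f y‖]
  gcongr
  rw [Complex.norm_real, Real.norm_of_nonneg (Real.exp_pos _).le]
  exact norm_gauss_le hθ hε hz y

lemma differentiable_gaussMollify {f : ℝ → ℂ} (hf : Integrable f) (hc : HasCompactSupport f)
    (ε : ℝ) : Differentiable ℂ (gaussMollify f ε) := by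
  intro z₀
  set c : ℂ := ((Real.sqrt (4 * Real.pi * ε) : ℝ) : ℂ)⁻¹ with hcdef
  have hcont : Continuous fun p : ℂ × ℝ =>
      c * (exp (-(p.1 - p.2) ^ 2 / (4 * ε)) * (-(2 * (p.1 - p.2)) / (4 * ε))) := by fun_prop
  obtain ⟨M, hM⟩ := ((isCompact_closedBall z₀ 1).prod hc.isCompact).exists_bound_of_continuousOn
    hcont.continuousOn
  have hI : ∀ z : ℂ, Integrable fun y : ℝ => f y * (c * exp (-(z - y) ^ 2 / (4 * ε))) := by
    intro z
    have h : Continuous fun y : ℝ => c * exp (-(z - y) ^ 2 / (4 * ε)) := by fun_prop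
    exact (integrable_continuous_mul hf hc h).congr (Eventually.of_forall fun y => mul_comm _ _)
  have hD : Continuous fun y : ℝ =>
      c * (exp (-(z₀ - y) ^ 2 / (4 * ε)) * (-(2 * (z₀ - y)) / (4 * ε))) := by fun_prop
  refine (hasDerivAt_integral_of_dominated_loc_of_deriv_le (μ := volume)
    (F := fun (z : ℂ) (y : ℝ) => f y * (c * exp (-(z - y) ^ 2 / (4 * ε))))
    (F' := fun (z : ℂ) (y : ℝ) =>
      f y * (c * (exp (-(z - y) ^ 2 / (4 * ε)) * (-(2 * (z - y)) / (4 * ε)))))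
    (bound := fun y => ‖f y‖ * M) (Metric.ball_mem_nhds z₀ one_pos)
    (Eventually.of_forall fun z => (hI z).aestronglyMeasurable) (hI z₀) ?_ ?_
    (hf.norm.mul_const M) ?_).2.differentiableAt
  · exact ((integrable_continuous_mul hf hc hD).congr
      (Eventually.of_forall fun y => mul_comm _ _)).aestronglyMeasurable
  · refine Eventually.of_forall fun y z hz => ?_
    rw [norm_mul]
    by_cases hy : y ∈ tsupport f
    · exact mul_le_mul_of_nonneg_left (hM (z, y) ⟨Metric.ball_subset_closedBall hz, hy⟩)
        (norm_nonneg _)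
    · simp [image_eq_zero_of_notMem_tsupport hy]
  · refine Eventually.of_forall fun y z _ => ?_
    refine HasDerivAt.const_mul _ (HasDerivAt.const_mul _ ?_)
    have h : HasDerivAt (fun z : ℂ => -(z - y) ^ 2 / (4 * ε)) (-(2 * (z - y)) / (4 * ε)) z := by
      simpa using ((((hasDerivAt_id z).sub_const (y : ℂ)).pow 2).neg).div_const (4 * (ε : ℂ))
    exact h.cexp

end Mollification

end SmoothedCalculus

end

noncomputable section

namespace SmoothedCalculus

/-! ### Fourier inversion and smooth multipliers -/

section Inversion

open FourierTransform

lemma ft_eq_fourier (h : ℝ → ℂ) (t : ℝ) : ft h t = 𝓕 h (t / (2 * Real.pi)) := by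
  rw [Real.fourier_real_eq_integral_exp_smul, ft]
  refine integral_congr_ae (Eventually.of_forall fun y => ?_)
  simp only [smul_eq_mul]
  rw [mul_comm]
  congr 2
  push_cast
  have : (Real.pi : ℂ) ≠ 0 := by simp [Real.pi_ne_zero]
  field_simp

lemma fourier_eq_ft (h : ℝ → ℂ) (w : ℝ) : 𝓕 h w = ft h (2 * Real.pi * w) := by
  rw [ft_eq_fourier]
  field_simp

/-- The quantity controlling the `L¹`-norm of the Fourier transform. -/
def sobolevNorm (g : ℝ → ℂ) : ℝ := (∫ x, ‖g x‖) + ∫ x, ‖iteratedDeriv 2 g x‖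

lemma sobolevNorm_nonneg (g : ℝ → ℂ) : 0 ≤ sobolevNorm g :=
  add_nonneg (integral_nonneg fun _ => norm_nonneg _) (integral_nonneg fun _ => norm_nonneg _)

variable {g : ℝ → ℂ}

lemma integrable_iteratedDeriv (hg : ContDiff ℝ 2 g) (hc : HasCompactSupport g) (n : ℕ)
    (hn : n ≤ 2) : Integrable (iteratedDeriv n g) := by
  refine (hg.continuous_iteratedDeriv n (by exact_mod_cast hn)).integrable_of_hasCompactSupport ?_
  rw [iteratedDeriv_eq_equiv_comp]
  exact (hc.iteratedFDeriv n).comp_left (map_zero _)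

lemma norm_ft_mul_le (hg : ContDiff ℝ 2 g) (hc : HasCompactSupport g) (t : ℝ) :
    ‖ft g t‖ ≤ sobolevNorm g * (1 + t ^ 2)⁻¹ := by
  have h1 := Real.fourier_iteratedDeriv (N := 2) (n := 2) hg
    (fun n hn => integrable_iteratedDeriv hg hc n (by exact_mod_cast hn)) le_rfl
  have h2 : ft (iteratedDeriv 2 g) t = (I * t) ^ 2 * ft g t := by
    rw [ft_eq_fourier, h1, ft_eq_fourier g]
    simp only [smul_eq_mul]
    congr 2
    have : (Real.pi : ℂ) ≠ 0 := by simp [Real.pi_ne_zero]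
    push_cast
    field_simp
  have h3 := norm_ft_le (iteratedDeriv 2 g) t
  have h4 := norm_ft_le g t
  rw [h2, norm_mul, norm_pow, norm_mul, norm_I, one_mul, Complex.norm_real, Real.norm_eq_abs,
    sq_abs] at h3
  rw [← div_eq_mul_inv, le_div_iff₀ (by positivity), sobolevNorm]
  linarith

lemma integrable_ft (hg : ContDiff ℝ 2 g) (hc : HasCompactSupport g) : Integrable (ft g) := by
  refine (integrable_inv_one_add_sq.const_mul (sobolevNorm g)).mono'
    (continuous_ft (hg.continuous.integrable_of_hasCompactSupport hc)).aestronglyMeasurable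
    (Eventually.of_forall (norm_ft_mul_le hg hc))

lemma integral_norm_ft_le (hg : ContDiff ℝ 2 g) (hc : HasCompactSupport g) :
    ∫ t, ‖ft g t‖ ≤ Real.pi * sobolevNorm g := by
  calc ∫ t, ‖ft g t‖ ≤ ∫ t : ℝ, sobolevNorm g * (1 + t ^ 2)⁻¹ :=
        integral_mono (integrable_ft hg hc).norm (integrable_inv_one_add_sq.const_mul _)
          (norm_ft_mul_le hg hc)
    _ = _ := by rw [integral_const_mul, integral_univ_inv_one_add_sq, mul_comm]

/-- Fourier inversion. -/
lemma eq_integral_ft {g : ℝ → ℂ} (hg : Continuous g) (hi : Integrable g) (hf : Integrable (ft g))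
    (r : ℝ) : g r = (2 * (Real.pi : ℂ))⁻¹ * ∫ t, ft g t * exp (I * t * r) := by
  have hpi : (0 : ℝ) < 2 * Real.pi := by positivity
  have e1 : 𝓕 g = fun w => ft g (w * (2 * Real.pi)) := by
    ext w; rw [fourier_eq_ft, mul_comm]
  have hf' : Integrable (𝓕 g) := by
    rw [e1]
    exact hf.comp_mul_right' hpi.ne'
  have h1 := congrFun (hg.fourierInv_fourier_eq hi hf') r
  rw [Real.fourierInv_eq'] at h1
  rw [← h1]
  have h2 := Measure.integral_comp_mul_right (fun t : ℝ => ft g t * exp (I * t * r)) (2 * Real.pi)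
  rw [abs_of_pos (inv_pos.2 hpi)] at h2
  have h3 : (2 * (Real.pi : ℂ))⁻¹ = (((2 * Real.pi)⁻¹ : ℝ) : ℂ) := by push_cast; rfl
  rw [h3, ← real_smul, ← h2]
  refine integral_congr_ae (Eventually.of_forall fun w => ?_)
  simp only [smul_eq_mul]
  rw [e1, mul_comm]
  congr 2
  simp
  ring

/-- Multiplying by a smooth function costs a constant in `sup |ft|`. -/
lemma norm_integral_mul_le (hg : ContDiff ℝ 2 g) (hc : HasCompactSupport g) {H : ℝ → ℂ}
    (hH : Integrable H) {M : ℝ} (hM : ∀ x, ‖ft H x‖ ≤ M) :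
    ‖∫ r, g r * H r‖ ≤ sobolevNorm g / 2 * M := by
  have hi : Integrable g := hg.continuous.integrable_of_hasCompactSupport hc
  have hf := integrable_ft hg hc
  have hM0 : 0 ≤ M := (norm_nonneg _).trans (hM 0)
  have e1 : ∫ r, g r * H r =
      (2 * (Real.pi : ℂ))⁻¹ * ∫ r : ℝ, ∫ t : ℝ, H r * (ft g t * exp (I * t * r)) := by
    rw [← integral_const_mul]
    refine integral_congr_ae (Eventually.of_forall fun r => ?_)
    simp only
    rw [integral_const_mul, eq_integral_ft hg.continuous hi hf r]
    ring
  have hprod : Integrable (fun p : ℝ × ℝ => H p.1 * (ft g p.2 * exp (I * p.2 * p.1)))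
      (volume.prod volume) := by
    have := (hH.mul_prod hf).mul_bdd (c := 1) (g := fun p : ℝ × ℝ => exp (I * p.2 * p.1))
      (Continuous.aestronglyMeasurable (by fun_prop))
      (Eventually.of_forall fun p => (norm_exp_I_mul_real _ _).le)
    exact this.congr (Eventually.of_forall fun p => by simp only; ring)
  rw [e1, integral_integral_swap (f := fun r t : ℝ => H r * (ft g t * exp (I * t * r))) hprod]
  -- After inserting the inversion formula for `g`, the pairing only sees values of `ft H`, weighted
  -- by the integrable function `ft g`.
  have e2 : ∀ t : ℝ, ∫ r : ℝ, H r * (ft g t * exp (I * t * r)) = ft g t * ft H (-t) := by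
    intro t
    rw [ft.eq_def H, ← integral_const_mul]
    refine integral_congr_ae (Eventually.of_forall fun r => ?_)
    simp only
    rw [mul_left_comm]
    congr 3
    push_cast
    ring
  simp_rw [e2]
  rw [norm_mul]
  have h3 : ‖∫ t, ft g t * ft H (-t)‖ ≤ (Real.pi * sobolevNorm g) * M := by
    refine (norm_integral_le_of_norm_le (hf.norm.mul_const M)
      (Eventually.of_forall fun t => ?_)).trans ?_
    · rw [norm_mul]
      exact mul_le_mul_of_nonneg_left (hM _) (norm_nonneg _)
    · rw [integral_mul_const]
      exact mul_le_mul_of_nonneg_right (integral_norm_ft_le hg hc) hM0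
  have h4 : ‖(2 * (Real.pi : ℂ))⁻¹‖ = (2 * Real.pi)⁻¹ := by
    rw [norm_inv, norm_mul, Complex.norm_real, Real.norm_of_nonneg Real.pi_pos.le]
    simp
  rw [h4]
  calc _ ≤ (2 * Real.pi)⁻¹ * ((Real.pi * sobolevNorm g) * M) := by gcongr
    _ = _ := by field_simp

/-- The Fourier transform of a product with an inverse Fourier transform. -/
lemma ft_mul_eq (hg : ContDiff ℝ 2 g) (hc : HasCompactSupport g) {H : ℝ → ℂ}
    (hH : Integrable H) (t : ℝ) :
    ft (fun y => g y * H y) t = (2 * (Real.pi : ℂ))⁻¹ * ∫ s, ft g (t - s) * ft H s := by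
  have hi : Integrable g := hg.continuous.integrable_of_hasCompactSupport hc
  have hf := integrable_ft hg hc
  have e1 : ft (fun y => g y * H y) t = (2 * (Real.pi : ℂ))⁻¹ *
      ∫ r : ℝ, ∫ s : ℝ, H r * exp (-(I * t * r)) * (ft g s * exp (I * s * r)) := by
    rw [← integral_const_mul, ft]
    refine integral_congr_ae (Eventually.of_forall fun r => ?_)
    simp only
    rw [integral_const_mul, eq_integral_ft hg.continuous hi hf r]
    ring
  have hprod : Integrable (fun p : ℝ × ℝ =>
      H p.1 * exp (-(I * t * p.1)) * (ft g p.2 * exp (I * p.2 * p.1)))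
      (volume.prod volume) := by
    have := ((integrable_mul_exp hH t).mul_prod hf).mul_bdd (c := 1)
      (g := fun p : ℝ × ℝ => exp (I * p.2 * p.1))
      (Continuous.aestronglyMeasurable (by fun_prop))
      (Eventually.of_forall fun p => (norm_exp_I_mul_real _ _).le)
    exact this.congr (Eventually.of_forall fun p => by simp only; ring)
  rw [e1, integral_integral_swap
    (f := fun r s : ℝ => H r * exp (-(I * t * r)) * (ft g s * exp (I * s * r))) hprod]
  have e2 : ∀ s : ℝ, ∫ r : ℝ, H r * exp (-(I * t * r)) * (ft g s * exp (I * s * r)) =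
      ft g s * ft H (t - s) := by
    intro s
    rw [ft.eq_def H, ← integral_const_mul]
    refine integral_congr_ae (Eventually.of_forall fun r => ?_)
    simp only
    rw [show (-(I * ((t - s : ℝ) : ℂ) * r)) = -(I * t * r) + I * s * r by push_cast; ring, exp_add]
    ring
  simp_rw [e2]
  congr 1
  rw [← integral_sub_left_eq_self (fun s => ft g s * ft H (t - s)) volume t]
  simp only [sub_sub_cancel]

end Inversion

/-! ### Localization by the equidistant partition -/

section Partition

variable {φ : ℝ → ℂ} {E : Type*} [NormedAddCommGroup E] [NormedSpace ℂ E]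

lemma IsEquidistantPartition.eq_zero (hφ : IsEquidistantPartition φ) {t : ℝ} (ht : 1 < |t|) :
    φ t = 0 := by
  refine image_eq_zero_of_notMem_tsupport fun h => ?_
  have := hφ.supp h
  rw [mem_Icc, ← abs_le] at this
  linarith

lemma IsEquidistantPartition.hasCompactSupport (hφ : IsEquidistantPartition φ) :
    HasCompactSupport φ :=
  HasCompactSupport.of_support_subset_isCompact isCompact_Icc
    ((subset_tsupport φ).trans hφ.supp)

lemma IsEquidistantPartition.exists_bound (hφ : IsEquidistantPartition φ) :
    ∃ C : ℝ, ∀ t, ‖φ t‖ ≤ C :=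
  hφ.smooth.continuous.bounded_above_of_compact_support hφ.hasCompactSupport

lemma IsEquidistantPartition.sum_Icc (hφ : IsEquidistantPartition φ) {N : ℕ} {t : ℝ}
    (ht : |t| + 1 ≤ N) : ∑ n ∈ Finset.Icc (-(N : ℤ)) N, φ (t - n) = 1 := by
  refine (hasSum_sum_of_ne_finset_zero fun n hn => hφ.eq_zero ?_).unique (hφ.sum_eq_one t)
  by_contra h
  refine hn (Finset.mem_Icc.2 ?_)
  have h1 := abs_le.1 (not_lt.1 h)
  have h2 := abs_le.1 (show |t| ≤ N - 1 by linarith)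
  constructor
  · have : (-(N : ℝ)) ≤ n := by linarith [h1.2, h2.1]
    exact_mod_cast this
  · have : (n : ℝ) ≤ N := by linarith [h1.1, h2.2]
    exact_mod_cast this

lemma IsEquidistantPartition.sum_norm_le (hφ : IsEquidistantPartition φ) {C : ℝ}
    (hC : ∀ t, ‖φ t‖ ≤ C) (s : Finset ℤ) (t : ℝ) : ∑ n ∈ s, ‖φ (t - n)‖ ≤ 3 * C := by
  have hC0 : 0 ≤ C := (norm_nonneg _).trans (hC 0)
  -- At most three integers lie within distance one of `t`, which accounts for the constant `3 C`.
  have h1 : ∑ n ∈ s, ‖φ (t - n)‖ ≤ ∑ n ∈ Finset.Icc (⌈t - 1⌉) (⌈t - 1⌉ + 2), ‖φ (t - n)‖ := by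
    rw [← Finset.sum_filter_add_sum_filter_not s (fun n : ℤ => |t - n| ≤ 1)]
    rw [Finset.sum_eq_zero (s := s.filter fun n : ℤ => ¬ |t - n| ≤ 1), add_zero]
    · refine Finset.sum_le_sum_of_subset_of_nonneg (fun n hn => ?_) fun _ _ _ => norm_nonneg _
      have h := abs_le.1 (Finset.mem_filter.1 hn).2
      refine Finset.mem_Icc.2 ⟨Int.ceil_le.2 (by linarith [h.2]), ?_⟩
      have h3 := Int.le_ceil (t - 1)
      have : (n : ℝ) ≤ ((⌈t - 1⌉ + 2 : ℤ) : ℝ) := by push_cast; linarith [h.1]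
      exact_mod_cast this
    · intro n hn
      rw [hφ.eq_zero (not_le.1 (Finset.mem_filter.1 hn).2), norm_zero]
  refine h1.trans ((Finset.sum_le_card_nsmul _ _ C fun n _ => hC _).trans (le_of_eq ?_))
  rw [Int.card_Icc, nsmul_eq_mul]
  congr 1
  have : (⌈t - 1⌉ + 2 + 1 - ⌈t - 1⌉).toNat = 3 := by
    rw [show ⌈t - 1⌉ + 2 + 1 - ⌈t - 1⌉ = 3 by ring]; rfl
  rw [this]; norm_num

/-- An integral is the sum of its localizations. -/
lemma IsEquidistantPartition.tendsto_integral (hφ : IsEquidistantPartition φ) {G : ℝ → E}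
    (hG : Integrable G) :
    Tendsto (fun N : ℕ => ∑ n ∈ Finset.Icc (-(N : ℤ)) N, ∫ t, φ (t - n) • G t) atTop
      (𝓝 (∫ t, G t)) := by
  obtain ⟨C, hC⟩ := hφ.exists_bound
  have hI : ∀ n : ℤ, Integrable fun t => φ (t - n) • G t := fun n =>
    hG.bdd_smul C (hφ.smooth.continuous.comp (by fun_prop)).aestronglyMeasurable
      (Eventually.of_forall fun t => hC _)
  simp_rw [← integral_finsetSum _ fun n _ => hI n]
  refine tendsto_integral_of_dominated_convergence (fun t => 3 * C * ‖G t‖)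
    (fun N => (integrable_finsetSum _ fun n _ => hI n).aestronglyMeasurable)
    (hG.norm.const_mul _) (fun N => Eventually.of_forall fun t => ?_)
    (Eventually.of_forall fun t => ?_)
  · rw [← Finset.sum_smul, norm_smul]
    exact mul_le_mul_of_nonneg_right ((norm_sum_le _ _).trans (hφ.sum_norm_le hC _ t))
      (norm_nonneg _)
  · obtain ⟨N₀, hN₀⟩ := exists_nat_ge (|t| + 1)
    refine tendsto_const_nhds.congr' ?_
    filter_upwards [eventually_ge_atTop N₀] with N hN
    rw [← Finset.sum_smul, hφ.sum_Icc (hN₀.trans (by exact_mod_cast hN)), one_smul]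

lemma IsEquidistantPartition.enorm_integral_le (hφ : IsEquidistantPartition φ) {G : ℝ → E}
    (hG : Integrable G) :
    ‖∫ t, G t‖ₑ ≤ ∑' n : ℤ, ‖∫ t, φ (t - n) • G t‖ₑ := by
  refine le_of_tendsto (hφ.tendsto_integral hG).enorm (Eventually.of_forall fun N => ?_)
  exact (enorm_sum_le _ _).trans (ENNReal.sum_le_tsum _)

end Partition

end SmoothedCalculus

end

noncomputable section

namespace SmoothedCalculus

/-! ### Sobolev norms of localized Schwartz kernels -/

section Sobolev

lemma sobolevNorm_le {g : ℝ → ℂ} {a b B : ℝ} (hab : a ≤ b) (hs : tsupport g ⊆ Icc a b)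
    (h0 : ∀ x ∈ Icc a b, ‖g x‖ ≤ B) (h2 : ∀ x ∈ Icc a b, ‖iteratedFDeriv ℝ 2 g x‖ ≤ B) :
    sobolevNorm g ≤ 2 * (b - a) * B := by
  have key : ∀ h : ℝ → ℂ, (∀ x, x ∉ Icc a b → h x = 0) → (∀ x ∈ Icc a b, ‖h x‖ ≤ B) →
      ∫ x, ‖h x‖ ≤ (b - a) * B := by
    intro h hz hB
    have h1 : ∫ x, ‖h x‖ = ∫ x in Icc a b, ‖h x‖ := by
      refine (setIntegral_eq_integral_of_forall_compl_eq_zero fun x hx => ?_).symm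
      rw [hz x hx, norm_zero]
    rw [h1]
    have h3 := norm_setIntegral_le_of_norm_le_const (μ := volume) (s := Icc a b)
      (f := fun x => ‖h x‖) (C := B) (by simp) (fun x hx => by rw [norm_norm]; exact hB x hx)
    refine (Real.le_norm_self _).trans (h3.trans (le_of_eq ?_))
    rw [Real.volume_real_Icc_of_le hab, mul_comm]
  have h3 := key g (fun x hx => image_eq_zero_of_notMem_tsupport fun h => hx (hs h)) h0
  have h4 := key (iteratedDeriv 2 g) (fun x hx => by
    rw [← norm_eq_zero, ← norm_iteratedFDeriv_eq_norm_iteratedDeriv, norm_eq_zero]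
    exact image_eq_zero_of_notMem_tsupport fun h => hx (hs (tsupport_iteratedFDeriv_subset 2 h)))
    (fun x hx => by rw [← norm_iteratedFDeriv_eq_norm_iteratedDeriv]; exact h2 x hx)
  rw [sobolevNorm]
  linarith

lemma contDiff_ft {ψ : ℝ → ℂ} (hψ : ContDiff ℝ ∞ ψ) (hc : HasCompactSupport ψ) :
    ContDiff ℝ ∞ (ft ψ) := by
  have e : ft ψ = fun t => FourierTransform.fourier (hc.toSchwartzMap hψ) ((2 * Real.pi)⁻¹ * t) := by
    ext t
    rw [ft_eq_fourier, SchwartzMap.fourier_coe, div_eq_inv_mul]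
    rfl
  rw [e]
  exact (SchwartzMap.smooth _ _).comp (contDiff_const.mul contDiff_id)

/-- The transform of a test function is a Schwartz function; passing between the two normalizations
is a dilation by `2π`, which changes only constants. -/
lemma exists_norm_iteratedFDeriv_ft_le {ψ : ℝ → ℂ} (hψ : ContDiff ℝ ∞ ψ)
    (hc : HasCompactSupport ψ) (N : ℕ) :
    ∃ C : ℝ, 0 ≤ C ∧ ∀ i ≤ 2, ∀ t, (1 + |t|) ^ N * ‖iteratedFDeriv ℝ i (ft ψ) t‖ ≤ C := by
  set S := FourierTransform.fourier (hc.toSchwartzMap hψ)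
  have e : ft ψ = fun t => S ((2 * Real.pi)⁻¹ * t) := by
    ext t
    rw [ft_eq_fourier, SchwartzMap.fourier_coe, div_eq_inv_mul]
    rfl
  have h := fun i (hi : i ≤ 2) => SchwartzMap.one_add_le_sup_seminorm_apply (𝕜 := ℝ) (m := (N, 2))
    (k := N) (n := i) le_rfl hi S
  set K := 2 ^ N * ((Finset.Iic ((N, 2) : ℕ × ℕ)).sup fun m => SchwartzMap.seminorm ℝ m.1 m.2) S
  have hpi : (1 : ℝ) ≤ 2 * Real.pi := by linarith [Real.pi_gt_three]
  have hK : 0 ≤ K := (by positivity : (0 : ℝ) ≤ _).trans (h 0 (by norm_num) 0)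
  refine ⟨(2 * Real.pi) ^ N * K, by positivity, fun i hi t => ?_⟩
  have h1 := h i hi ((2 * Real.pi)⁻¹ * t)
  rw [norm_iteratedFDeriv_eq_norm_iteratedDeriv] at h1 ⊢
  rw [e, iteratedDeriv_comp_const_smul (S.smooth i), norm_smul, norm_pow, norm_inv,
    Real.norm_of_nonneg (by linarith)]
  have h2 : ((2 * Real.pi)⁻¹) ^ i ≤ 1 := pow_le_one₀ (by positivity) (inv_le_one_of_one_le₀ hpi)
  have h3 : 1 + |t| ≤ 2 * Real.pi * (1 + ‖(2 * Real.pi)⁻¹ * t‖) := by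
    rw [norm_mul, norm_inv, Real.norm_of_nonneg (by linarith : 0 ≤ 2 * Real.pi), Real.norm_eq_abs,
      mul_add, mul_inv_cancel_left₀ (by linarith)]
    linarith
  calc (1 + |t|) ^ N * ((2 * Real.pi)⁻¹ ^ i * ‖iteratedDeriv i S ((2 * Real.pi)⁻¹ * t)‖)
      ≤ (2 * Real.pi * (1 + ‖(2 * Real.pi)⁻¹ * t‖)) ^ N *
        (1 * ‖iteratedDeriv i S ((2 * Real.pi)⁻¹ * t)‖) := by gcongr
    _ = (2 * Real.pi) ^ N * ((1 + ‖(2 * Real.pi)⁻¹ * t‖) ^ N *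
        ‖iteratedDeriv i S ((2 * Real.pi)⁻¹ * t)‖) := by rw [mul_pow]; ring
    _ ≤ _ := by gcongr

lemma norm_iteratedFDeriv_comp_const_sub (g : ℝ → ℂ) (i : ℕ) (τ r : ℝ) :
    ‖iteratedFDeriv ℝ i (fun r => g (τ - r)) r‖ = ‖iteratedFDeriv ℝ i g (τ - r)‖ := by
  rw [norm_iteratedFDeriv_eq_norm_iteratedDeriv, norm_iteratedFDeriv_eq_norm_iteratedDeriv,
    iteratedDeriv_comp_const_sub, norm_smul, norm_pow]
  simp

/-- Translates of a Schwartz function, localized near the origin, decay in the Sobolev norm. -/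
lemma exists_sobolevNorm_translate_le {ψ κ : ℝ → ℂ} (hψ : ContDiff ℝ ∞ ψ)
    (hc : HasCompactSupport ψ) (hκ : ContDiff ℝ ∞ κ) (hs : tsupport κ ⊆ Icc (-2) 2) (N : ℕ) :
    ∃ C : ℝ, 0 ≤ C ∧ ∀ τ : ℝ,
      sobolevNorm (fun r => ft ψ (τ - r) * κ r) ≤ C * ((1 + |τ|) ^ N)⁻¹ := by
  obtain ⟨K, hK, hKb⟩ := exists_norm_iteratedFDeriv_ft_le hψ hc N
  have hκc : HasCompactSupport κ := HasCompactSupport.of_support_subset_isCompact isCompact_Icc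
    ((subset_tsupport κ).trans hs)
  have hL : ∃ L : ℝ, 0 ≤ L ∧ ∀ i ≤ 2, ∀ r, ‖iteratedFDeriv ℝ i κ r‖ ≤ L := by
    have h := fun i : ℕ => (hκ.continuous_iteratedFDeriv (m := i)
      (by exact_mod_cast le_top)).bounded_above_of_compact_support (hκc.iteratedFDeriv i)
    choose L hL using h
    refine ⟨∑ i ∈ Finset.range 3, L i, Finset.sum_nonneg fun i _ =>
      (norm_nonneg _).trans (hL i 0), fun i hi r => (hL i r).trans ?_⟩
    exact Finset.single_le_sum (f := L) (fun i _ => (norm_nonneg _).trans (hL i 0))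
      (Finset.mem_range.2 (by omega))
  obtain ⟨L, hL0, hL⟩ := hL
  set ζ := ft ψ
  have hζ : ContDiff ℝ ∞ ζ := contDiff_ft hψ hc
  refine ⟨2 * (2 - -2) * (4 * (3 ^ N * K) * L), by positivity, fun τ => ?_⟩
  have hd : ∀ i ≤ 2, ∀ r ∈ Icc (-2 : ℝ) 2,
      ‖iteratedFDeriv ℝ i (fun r => ζ (τ - r)) r‖ ≤ 3 ^ N * K * ((1 + |τ|) ^ N)⁻¹ := by
    intro i hi r hr
    rw [norm_iteratedFDeriv_comp_const_sub, ← div_eq_mul_inv, le_div_iff₀ (by positivity), mul_comm]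
    -- On the support of `κ` one has `|r| ≤ 2`, so decay in `τ - r` is decay in `τ` up to a factor
    -- `3`.
    have h1 : 1 + |τ| ≤ 3 * (1 + |τ - r|) := by
      have h2 : |r| ≤ 2 := abs_le.2 hr
      have h3 := abs_add_le (τ - r) r
      rw [sub_add_cancel] at h3
      linarith [abs_nonneg (τ - r)]
    calc (1 + |τ|) ^ N * ‖iteratedFDeriv ℝ i ζ (τ - r)‖
        ≤ (3 * (1 + |τ - r|)) ^ N * ‖iteratedFDeriv ℝ i ζ (τ - r)‖ := by gcongr
      _ = 3 ^ N * ((1 + |τ - r|) ^ N * ‖iteratedFDeriv ℝ i ζ (τ - r)‖) := by rw [mul_pow]; ring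
      _ ≤ _ := by gcongr; exact hKb i hi _
  have hcd : ContDiff ℝ ∞ fun r => ζ (τ - r) := hζ.comp (contDiff_const.sub contDiff_id)
  have hB : ∀ i ≤ 2, ∀ r ∈ Icc (-2 : ℝ) 2, ‖iteratedFDeriv ℝ i (fun r => ζ (τ - r) * κ r) r‖ ≤
      4 * (3 ^ N * K) * L * ((1 + |τ|) ^ N)⁻¹ := by
    intro i hi r hr
    refine (norm_iteratedFDeriv_mul_le hcd hκ r (n := i) (by exact_mod_cast le_top)).trans ?_
    have h1 : ∀ k ∈ Finset.range (i + 1), (i.choose k : ℝ) *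
        ‖iteratedFDeriv ℝ k (fun r => ζ (τ - r)) r‖ * ‖iteratedFDeriv ℝ (i - k) κ r‖ ≤
        (i.choose k : ℝ) * ((3 ^ N * K * ((1 + |τ|) ^ N)⁻¹) * L) := by
      intro k hk
      rw [mul_assoc]
      have hk' := Finset.mem_range.1 hk
      gcongr
      · exact hd k (by omega) r hr
      · exact hL _ (by omega) r
    refine (Finset.sum_le_sum h1).trans ?_
    rw [← Finset.sum_mul]
    have h2 : ∑ k ∈ Finset.range (i + 1), (i.choose k : ℝ) = 2 ^ i := by
      exact_mod_cast Nat.sum_range_choose i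
    rw [h2]
    have h3 : (2 : ℝ) ^ i ≤ 4 := by
      calc (2 : ℝ) ^ i ≤ 2 ^ 2 := pow_le_pow_right₀ (by norm_num) hi
        _ = 4 := by norm_num
    calc (2 : ℝ) ^ i * (3 ^ N * K * ((1 + |τ|) ^ N)⁻¹ * L)
        ≤ 4 * (3 ^ N * K * ((1 + |τ|) ^ N)⁻¹ * L) := by gcongr
      _ = _ := by ring
  refine (sobolevNorm_le (by norm_num) ((tsupport_mul_subset_right).trans hs)
    (fun r hr => ?_) (hB 2 le_rfl)).trans (le_of_eq (by ring))
  have := hB 0 (by norm_num) r hr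
  rwa [norm_iteratedFDeriv_zero] at this

end Sobolev

/-! ### The localizations of f and weighted integrability of its transform -/

section Pieces

variable {φ f : ℝ → ℂ}

/-- The sup norm of the localization `f * φ̌ₙ`. -/
def pieceSup (φ f : ℝ → ℂ) (n : ℤ) : ENNReal :=
  ⨆ x : ℝ, ‖(f ⋆[ContinuousLinearMap.mul ℝ ℂ, volume] checkPart φ n) x‖ₑ

lemma eNormE_eq (φ : ℝ → ℂ) (α : ℝ) (f : ℝ → ℂ) :
    eNormE φ α f = ∑' n : ℤ, ENNReal.ofReal ((1 + |(n : ℝ)|) ^ α) * pieceSup φ f n := rfl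

lemma IsEquidistantPartition.integrable_translate (hφ : IsEquidistantPartition φ) (s : ℝ) :
    Integrable fun t => φ (t - s) :=
  (hφ.smooth.continuous.integrable_of_hasCompactSupport hφ.hasCompactSupport).comp_sub_right s

/-- The convolution theorem: convolving with the inverse transform of `φ_n` multiplies the transform
of `f` by `φ_n`. -/
lemma convolution_checkPart (hφ : IsEquidistantPartition φ) (hf : Integrable f) (n : ℤ) (x : ℝ) :
    (f ⋆[ContinuousLinearMap.mul ℝ ℂ, volume] checkPart φ n) x =
      (2 * (Real.pi : ℂ))⁻¹ * ∫ t : ℝ, φ (t - n) * ft f t * exp (I * t * x) := by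
  have hprod : Integrable (fun p : ℝ × ℝ => f p.1 * (φ (p.2 - n) * exp (I * p.2 * (x - p.1))))
      (volume.prod volume) := by
    have := (hf.mul_prod (hφ.integrable_translate n)).mul_bdd (c := 1)
      (g := fun p : ℝ × ℝ => exp (I * p.2 * ((x - p.1 : ℝ) : ℂ)))
      (Continuous.aestronglyMeasurable (by fun_prop))
      (Eventually.of_forall fun p => (norm_exp_I_mul_real _ _).le)
    exact this.congr (Eventually.of_forall fun p => by simp only; push_cast; ring)
  have e1 : (f ⋆[ContinuousLinearMap.mul ℝ ℂ, volume] checkPart φ n) x =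
      (2 * (Real.pi : ℂ))⁻¹ * ∫ y : ℝ, ∫ t : ℝ, f y * (φ (t - n) * exp (I * t * (x - y))) := by
    rw [convolution_def, ← integral_const_mul]
    refine integral_congr_ae (Eventually.of_forall fun y => ?_)
    simp only [ContinuousLinearMap.mul_apply', checkPart]
    rw [integral_const_mul]
    push_cast
    ring
  rw [e1, integral_integral_swap
    (f := fun y t : ℝ => f y * (φ (t - n) * exp (I * t * (x - y)))) hprod]
  congr 1
  refine integral_congr_ae (Eventually.of_forall fun t => ?_)
  simp only
  rw [ft.eq_def f, mul_assoc, ← integral_mul_const, ← integral_const_mul]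
  refine integral_congr_ae (Eventually.of_forall fun y => ?_)
  simp only
  rw [show I * (t : ℂ) * (x - y) = -(I * t * y) + I * t * x by ring, exp_add]
  ring

/-- The left side is, up to `2π`, a value of the localization of `f` at `-ξ`; recentring at `c`
contributes only a phase. This is where the sup norms in the definition of the function space enter.
-/
lemma enorm_ft_piece_le (hφ : IsEquidistantPartition φ) (hf : Integrable f) (n : ℤ) (c ξ : ℝ) :
    ‖ft (fun u => φ (c + u - n) * ft f (c + u)) ξ‖ₑ ≤
      ENNReal.ofReal (2 * Real.pi) * pieceSup φ f n := by
  have h1 := convolution_checkPart hφ hf n (-ξ)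
  have h2 : ft (fun u => φ (c + u - n) * ft f (c + u)) ξ = exp (I * c * ξ) *
      ((2 * (Real.pi : ℂ)) * (f ⋆[ContinuousLinearMap.mul ℝ ℂ, volume] checkPart φ n) (-ξ)) := by
    rw [h1, mul_inv_cancel_left₀ (by simp [Real.pi_ne_zero]), ft,
      ← integral_add_left_eq_self (fun t : ℝ => φ (t - n) * ft f t * exp (I * t * ((-ξ : ℝ) : ℂ))) c,
      ← integral_const_mul]
    refine integral_congr_ae (Eventually.of_forall fun u => ?_)
    simp only
    have : exp (-(I * ξ * u)) = exp (I * c * ξ) * exp (I * ((c + u : ℝ) : ℂ) * ((-ξ : ℝ) : ℂ)) := by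
      rw [← exp_add]; congr 1; push_cast; ring
    rw [this]
    ring
  rw [h2, enorm_mul, enorm_mul, ← ofReal_norm, norm_exp_I_mul_real, ENNReal.ofReal_one, one_mul]
  gcongr
  · rw [← ofReal_norm, norm_mul, Complex.norm_real, Real.norm_of_nonneg Real.pi_pos.le]
    simp
  · exact le_iSup (fun x : ℝ =>
      ‖(f ⋆[ContinuousLinearMap.mul ℝ ℂ, volume] checkPart φ n) x‖ₑ) (-ξ)

lemma pieceSup_lt_top {α : ℝ} (h : eNormE φ α f < ⊤) (n : ℤ) : pieceSup φ f n < ⊤ := by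
  have h1 := (ENNReal.le_tsum n).trans_lt (eNormE_eq φ α f ▸ h)
  refine ENNReal.lt_top_of_mul_ne_top_right h1.ne ?_
  rw [Ne, ENNReal.ofReal_eq_zero, not_le]
  positivity

lemma norm_ft_piece_le (hφ : IsEquidistantPartition φ) (hf : Integrable f) {α : ℝ}
    (h : eNormE φ α f < ⊤) (n : ℤ) (c ξ : ℝ) :
    ‖ft (fun u => φ (c + u - n) * ft f (c + u)) ξ‖ ≤ 2 * Real.pi * (pieceSup φ f n).toReal := by
  have h1 := ENNReal.toReal_mono (ENNReal.mul_ne_top ENNReal.ofReal_ne_top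
    (pieceSup_lt_top h n).ne) (enorm_ft_piece_le hφ hf n c ξ)
  rwa [toReal_enorm, ENNReal.toReal_mul, ENNReal.toReal_ofReal (by positivity)] at h1

lemma integrable_piece (hφ : IsEquidistantPartition φ) (hf : Integrable f) (c s : ℝ) :
    Integrable fun u => φ (c + u - s) * ft f (c + u) := by
  have h : Integrable fun t => φ (t - s) * ft f t :=
    (hφ.integrable_translate s).mul_bdd (c := ∫ y, ‖f y‖) (continuous_ft hf).aestronglyMeasurable
      (Eventually.of_forall fun t => norm_ft_le f t)
  exact h.comp_add_left c

/-- Multiplication by a smooth function preserves the weighted integrability of the Fourier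
transform. -/
lemma integrable_ft_mul (hφ : IsEquidistantPartition φ) {α : ℝ} (hα : 0 < α) (hf : Integrable f)
    (h : eNormE φ α f < ⊤) {ψ : ℝ → ℂ} (hψ : ContDiff ℝ ∞ ψ) (hc : HasCompactSupport ψ) :
    Integrable fun t => (((1 + |t|) ^ α : ℝ) : ℂ) * ft (fun y => ψ y * f y) t := by
  -- A bump equal to `1` on the support of `φ`. It can be inserted at no cost and localizes the
  -- convolution kernel, whose Sobolev norm then decays in `t - n`.
  let b : ContDiffBump (0 : ℝ) := ⟨1, 2, one_pos, one_lt_two⟩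
  set κ : ℝ → ℂ := fun r => (b r : ℂ)
  have hκ : ContDiff ℝ ∞ κ := Complex.ofRealCLM.contDiff.comp b.contDiff
  have hκs : tsupport κ ⊆ Icc (-2) 2 := by
    refine (tsupport_comp_subset Complex.ofReal_zero b).trans ?_
    rw [b.tsupport_eq, Real.closedBall_eq_Icc]
    simp [b]
  have hκ1 : ∀ r, κ r * φ r = φ r := by
    intro r
    by_cases hr : |r| ≤ 1
    · have : b r = 1 := b.one_of_mem_closedBall (by simpa [b, Real.norm_eq_abs] using hr)
      simp [κ, this]
    · rw [hφ.eq_zero (not_le.1 hr), mul_zero]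
  have hκc : HasCompactSupport κ := HasCompactSupport.of_support_subset_isCompact isCompact_Icc
    ((subset_tsupport κ).trans hκs)
  obtain ⟨k, hk⟩ := exists_nat_ge α
  -- Of the `k + 2` powers, `k ≥ α` are spent on exchanging the weight at `t` for the weight at `n`,
  -- and two remain for integrability in `t`.
  obtain ⟨C, hC, hCb⟩ := exists_sobolevNorm_translate_le hψ hc hκ hκs (k + 2)
  have hψ2 : ContDiff ℝ 2 ψ := contDiff_infty.1 hψ 2
  have hcdft := contDiff_ft hψ hc
  have hfψ : Integrable fun y => ψ y * f y := by
    obtain ⟨c, hc'⟩ := hψ.continuous.bounded_above_of_compact_support hc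
    exact hf.bdd_mul (c := c) hψ.continuous.aestronglyMeasurable (Eventually.of_forall hc')
  have hterm : ∀ (t : ℝ) (n : ℤ), ‖∫ s, φ (s - n) • (ft ψ (t - s) * ft f s)‖ ≤
      C * ((1 + |t - n|) ^ (k + 2))⁻¹ / 2 * (2 * Real.pi * (pieceSup φ f n).toReal) := by
    intro t n
    have e1 : ∫ s, φ (s - n) • (ft ψ (t - s) * ft f s) =
        ∫ r : ℝ, (ft ψ (t - n - r) * κ r) * (φ (n + r - n) * ft f (n + r)) := by
      rw [← integral_add_left_eq_self
        (fun s : ℝ => φ (s - n) • (ft ψ (t - s) * ft f s)) (n : ℝ)]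
      refine integral_congr_ae (Eventually.of_forall fun r => ?_)
      simp only [smul_eq_mul, add_sub_cancel_left]
      nth_rewrite 1 [← hκ1 r]
      rw [sub_sub]
      ring
    rw [e1]
    refine (norm_integral_mul_le ?_ ?_ (integrable_piece hφ hf n n)
      (norm_ft_piece_le hφ hf h n n)).trans ?_
    · exact contDiff_infty.1 ((hcdft.comp (contDiff_const.sub contDiff_id)).mul hκ) 2
    · exact hκc.mul_left
    · gcongr
      exact hCb _
  have hweight : ∀ (t : ℝ) (n : ℤ), (1 + |t|) ^ α * ((1 + |t - n|) ^ (k + 2))⁻¹ ≤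
      (1 + |(n : ℝ)|) ^ α * (1 + (t - n) ^ 2)⁻¹ := by
    intro t n
    have h1 : 1 + |t| ≤ (1 + |(n : ℝ)|) * (1 + |t - n|) := by
      have h2 := abs_add_le (n : ℝ) (t - n)
      rw [add_sub_cancel] at h2
      nlinarith [abs_nonneg (n : ℝ), abs_nonneg (t - n)]
    have h3 : (1 + |t|) ^ α ≤ (1 + |(n : ℝ)|) ^ α * (1 + |t - n|) ^ k := by
      calc (1 + |t|) ^ α ≤ ((1 + |(n : ℝ)|) * (1 + |t - n|)) ^ α :=
            Real.rpow_le_rpow (by positivity) h1 hα.le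
        _ = (1 + |(n : ℝ)|) ^ α * (1 + |t - n|) ^ α := Real.mul_rpow (by positivity) (by positivity)
        _ ≤ (1 + |(n : ℝ)|) ^ α * (1 + |t - n|) ^ (k : ℝ) := by
            gcongr
            linarith [abs_nonneg (t - n)]
        _ = _ := by rw [Real.rpow_natCast]
    have h4 : 1 + (t - n) ^ 2 ≤ (1 + |t - n|) ^ 2 := by
      rw [← sq_abs (t - n)]
      nlinarith [abs_nonneg (t - n)]
    calc (1 + |t|) ^ α * ((1 + |t - n|) ^ (k + 2))⁻¹
        ≤ (1 + |(n : ℝ)|) ^ α * (1 + |t - n|) ^ k * ((1 + |t - n|) ^ (k + 2))⁻¹ := by gcongr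
      _ = (1 + |(n : ℝ)|) ^ α * ((1 + |t - n|) ^ 2)⁻¹ := by
          rw [pow_add]
          have : (1 + |t - n|) ≠ 0 := by positivity
          field_simp
      _ ≤ _ := by gcongr
  refine ⟨(Continuous.aestronglyMeasurable ?_), ?_⟩
  · have h1 : Continuous fun t : ℝ => (1 + |t|) ^ α :=
      (continuous_const.add continuous_abs).rpow_const fun t => Or.inr hα.le
    exact (continuous_ofReal.comp h1).mul (continuous_ft hfψ)
  have hpt : ∀ t : ℝ, ‖(((1 + |t|) ^ α : ℝ) : ℂ) * ft (fun y => ψ y * f y) t‖ₑ ≤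
      ∑' n : ℤ, ENNReal.ofReal (C / 2) * (ENNReal.ofReal ((1 + |(n : ℝ)|) ^ α) * pieceSup φ f n) *
        ENNReal.ofReal ((1 + (t - n) ^ 2)⁻¹) := by
    intro t
    have hG : Integrable fun s => ft ψ (t - s) * ft f s :=
      ((integrable_ft hψ2 hc).comp_sub_left t).mul_bdd (c := ∫ y, ‖f y‖)
        (continuous_ft hf).aestronglyMeasurable (Eventually.of_forall fun t => norm_ft_le f t)
    rw [ft_mul_eq hψ2 hc hf, enorm_mul, enorm_mul]
    refine (mul_le_mul_right (mul_le_mul_right (hφ.enorm_integral_le hG) _) _).trans ?_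
    rw [← ENNReal.tsum_mul_left, ← ENNReal.tsum_mul_left]
    refine ENNReal.tsum_le_tsum fun n => ?_
    have hM := (pieceSup_lt_top h n).ne
    rw [← ENNReal.ofReal_toReal hM, ← ofReal_norm, ← ofReal_norm, ← ofReal_norm,
      ← ENNReal.ofReal_mul (by positivity), ← ENNReal.ofReal_mul (by positivity),
      ← ENNReal.ofReal_mul (by positivity), ← ENNReal.ofReal_mul (by positivity),
      ← ENNReal.ofReal_mul (by positivity)]
    refine ENNReal.ofReal_le_ofReal ?_
    have h4 : ‖(2 * (Real.pi : ℂ))⁻¹‖ = (2 * Real.pi)⁻¹ := by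
      rw [norm_inv, norm_mul, Complex.norm_real, Real.norm_of_nonneg Real.pi_pos.le]
      simp
    rw [h4, Complex.norm_real, Real.norm_of_nonneg (by positivity)]
    have hM0 : 0 ≤ (pieceSup φ f n).toReal := ENNReal.toReal_nonneg
    calc (1 + |t|) ^ α * ((2 * Real.pi)⁻¹ * ‖∫ s, φ (s - n) • (ft ψ (t - s) * ft f s)‖)
        ≤ (1 + |t|) ^ α * ((2 * Real.pi)⁻¹ * (C * ((1 + |t - n|) ^ (k + 2))⁻¹ / 2 *
          (2 * Real.pi * (pieceSup φ f n).toReal))) := by gcongr; exact hterm t n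
      _ = C / 2 * ((pieceSup φ f n).toReal * ((1 + |t|) ^ α * ((1 + |t - n|) ^ (k + 2))⁻¹)) := by
          field_simp
      _ ≤ C / 2 * ((pieceSup φ f n).toReal * ((1 + |(n : ℝ)|) ^ α * (1 + (t - n) ^ 2)⁻¹)) := by
          gcongr C / 2 * (_ * ?_)
          exact hweight t n
      _ = _ := by ring
  refine (lintegral_mono hpt).trans_lt ?_
  rw [lintegral_tsum fun n => Measurable.aemeasurable (by fun_prop)]
  have hint : ∀ n : ℤ, ∫⁻ t : ℝ, ENNReal.ofReal ((1 + (t - n) ^ 2)⁻¹) = ENNReal.ofReal Real.pi := by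
    intro n
    rw [lintegral_sub_right_eq_self (fun t : ℝ => ENNReal.ofReal ((1 + t ^ 2)⁻¹)) (n : ℝ),
      ← ofReal_integral_eq_lintegral_ofReal integrable_inv_one_add_sq
        (Eventually.of_forall fun t => by positivity), integral_univ_inv_one_add_sq]
  have e2 : ∀ n : ℤ, ∫⁻ t : ℝ, ENNReal.ofReal (C / 2) *
      (ENNReal.ofReal ((1 + |(n : ℝ)|) ^ α) * pieceSup φ f n) *
        ENNReal.ofReal ((1 + (t - n) ^ 2)⁻¹) = ENNReal.ofReal (C / 2) * ENNReal.ofReal Real.pi *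
      (ENNReal.ofReal ((1 + |(n : ℝ)|) ^ α) * pieceSup φ f n) := by
    intro n
    rw [lintegral_const_mul _ (by fun_prop), hint]
    ring
  simp_rw [e2]
  rw [ENNReal.tsum_mul_left, ← eNormE_eq]
  exact ENNReal.mul_lt_top (ENNReal.mul_lt_top ENNReal.ofReal_lt_top ENNReal.ofReal_lt_top) h

/-- On the compact support of `f` the polynomial agrees with a compactly supported smooth
multiplier. -/
lemma integrable_ft_pow_mul (hφ : IsEquidistantPartition φ) {α : ℝ} (hα : 0 < α)
    (hf : Integrable f) (hc : HasCompactSupport f) (h : eNormE φ α f < ⊤) (j : ℕ) :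
    Integrable fun t => (((1 + |t|) ^ α : ℝ) : ℂ) * ft (fun y => (1 + (y : ℂ)) ^ j * f y) t := by
  obtain ⟨R, hR, hRs⟩ := hc.isCompact.isBounded.subset_closedBall_lt 0 (0 : ℝ)
  let b : ContDiffBump (0 : ℝ) := ⟨R, R + 1, hR, by linarith⟩
  have h1 : ContDiff ℝ ∞ fun y : ℝ => (b y : ℂ) * (1 + (y : ℂ)) ^ j :=
    (Complex.ofRealCLM.contDiff.comp b.contDiff).mul
      ((contDiff_const.add Complex.ofRealCLM.contDiff).pow j)
  have h2 : HasCompactSupport fun y : ℝ => (b y : ℂ) * (1 + (y : ℂ)) ^ j :=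
    (b.hasCompactSupport.comp_left Complex.ofReal_zero).mul_right
  convert integrable_ft_mul hφ hα hf h h1 h2 using 5 with t y
  by_cases hy : y ∈ tsupport f
  · rw [b.one_of_mem_closedBall (hRs hy)]; simp
  · rw [image_eq_zero_of_notMem_tsupport hy, mul_zero, mul_zero]

end Pieces

end SmoothedCalculus

end

noncomputable section

namespace SmoothedCalculus

/-! ### Gaussian norms and their ideal property -/

section Gauss

open ProbabilityTheory WithLp InnerProductSpace

variable {X : Type*} [NormedAddCommGroup X] [NormedSpace ℂ X] {n : ℕ}

/-- The linear combination `∑ vₖ xₖ`. -/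
def gaussSum (x : Fin n → X) (v : EuclideanSpace ℝ (Fin n)) : X := ∑ k, (v k : ℂ) • x k

lemma continuous_gaussSum (x : Fin n → X) : Continuous (gaussSum x) := by
  unfold gaussSum
  fun_prop

lemma gaussSum_add (x : Fin n → X) (v w : EuclideanSpace ℝ (Fin n)) :
    gaussSum x (v + w) = gaussSum x v + gaussSum x w := by
  simp [gaussSum, add_smul, Finset.sum_add_distrib]

lemma gaussSum_smul (x : Fin n → X) (c : ℝ) (v : EuclideanSpace ℝ (Fin n)) :
    gaussSum x (c • v) = (c : ℂ) • gaussSum x v := by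
  simp only [gaussSum, Finset.smul_sum, smul_smul, PiLp.smul_apply, smul_eq_mul, ofReal_mul]

lemma gaussSum_neg (x : Fin n → X) (v : EuclideanSpace ℝ (Fin n)) :
    gaussSum x (-v) = -gaussSum x v := by
  simp [gaussSum]

lemma gaussNorm_eq (x : Fin n → X) : gaussNorm x =
    Real.sqrt (∫ v, ‖gaussSum x v‖ ^ 2 ∂stdGaussian (EuclideanSpace ℝ (Fin n))) := by
  rw [gaussNorm, ← map_pi_eq_stdGaussian, integral_map
    (by fun_prop) (f := fun v => ‖gaussSum x v‖ ^ 2)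
    ((continuous_gaussSum x).norm.pow 2).aestronglyMeasurable]
  rfl

lemma integrable_gaussSum_sq (x : Fin n → X) :
    Integrable (fun v => ‖gaussSum x v‖ ^ 2) (stdGaussian (EuclideanSpace ℝ (Fin n))) := by
  have h1 := (IsGaussian.memLp_id (stdGaussian (EuclideanSpace ℝ (Fin n))) 2 (by simp)).norm
  have h2 := (h1.integrable_sq).const_mul ((∑ k, ‖x k‖) ^ 2)
  refine h2.mono' ((continuous_gaussSum x).norm.pow 2).aestronglyMeasurable
    (Eventually.of_forall fun v => ?_)
  rw [Real.norm_of_nonneg (by positivity), ← mul_pow]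
  gcongr
  rw [gaussSum, Finset.sum_mul]
  refine (norm_sum_le _ _).trans (Finset.sum_le_sum fun k _ => ?_)
  rw [norm_smul, mul_comm, Complex.norm_real]
  gcongr
  exact EuclideanSpace.norm_eq v ▸ (by
    rw [← EuclideanSpace.norm_eq]; exact PiLp.norm_apply_le v k)

lemma charFun_map_stdGaussian {E : Type*} [NormedAddCommGroup E] [InnerProductSpace ℝ E]
    [FiniteDimensional ℝ E] [MeasurableSpace E] [BorelSpace E] (L : E →L[ℝ] E) (t : E) :
    charFun ((stdGaussian E).map L) t =
      exp (-(‖ContinuousLinearMap.adjoint L t‖ : ℂ) ^ 2 / 2) := by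
  rw [← charFun_stdGaussian, charFun_apply, charFun_apply, integral_map (by fun_prop)
    (Continuous.aestronglyMeasurable (by fun_prop))]
  simp_rw [ContinuousLinearMap.adjoint_inner_right]

/-- A Gaussian sum dominates the sums in which an independent symmetric part is dropped. -/
lemma lintegral_gaussSum_le (x : Fin n → X) {ρ ν : Measure (EuclideanSpace ℝ (Fin n))}
    [SFinite ρ] [IsProbabilityMeasure ν] (hν : ν.map (fun v => -v) = ν) :
    ∫⁻ v, ENNReal.ofReal (‖gaussSum x v‖ ^ 2) ∂ρ ≤
      ∫⁻ v, ENNReal.ofReal (‖gaussSum x v‖ ^ 2) ∂(ρ.conv ν) := by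
  have hm : Measurable fun v => ENNReal.ofReal (‖gaussSum x v‖ ^ 2) :=
    (ENNReal.continuous_ofReal.comp ((continuous_gaussSum x).norm.pow 2)).measurable
  rw [Measure.lintegral_conv hm]
  refine lintegral_mono fun v => ?_
  have hmv : Measurable fun w => ENNReal.ofReal (‖gaussSum x (v + w)‖ ^ 2) :=
    hm.comp (measurable_const_add v)
  -- By symmetry `w` may be replaced by `-w`, and the average of `‖a + b‖²` and `‖a - b‖²` is at
  -- least `‖a‖²`.
  have h1 : ∫⁻ w, ENNReal.ofReal (‖gaussSum x (v + w)‖ ^ 2) ∂ν =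
      ∫⁻ w, ENNReal.ofReal (‖gaussSum x (v - w)‖ ^ 2) ∂ν := by
    conv_lhs => rw [← hν]
    rw [lintegral_map hmv (by fun_prop)]
    simp_rw [sub_eq_add_neg]
  have h2 : 2 * ENNReal.ofReal (‖gaussSum x v‖ ^ 2) ≤
      2 * ∫⁻ w, ENNReal.ofReal (‖gaussSum x (v + w)‖ ^ 2) ∂ν := by
    calc 2 * ENNReal.ofReal (‖gaussSum x v‖ ^ 2)
        = ∫⁻ _, 2 * ENNReal.ofReal (‖gaussSum x v‖ ^ 2) ∂ν := by simp
      _ ≤ ∫⁻ w, (ENNReal.ofReal (‖gaussSum x (v + w)‖ ^ 2) +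
            ENNReal.ofReal (‖gaussSum x (v - w)‖ ^ 2)) ∂ν := by
          refine lintegral_mono fun w => ?_
          rw [two_mul, ← ENNReal.ofReal_add (by positivity) (by positivity),
            ← ENNReal.ofReal_add (by positivity) (by positivity)]
          refine ENNReal.ofReal_le_ofReal ?_
          rw [sub_eq_add_neg, gaussSum_add, gaussSum_add, gaussSum_neg, ← sub_eq_add_neg]
          set a := gaussSum x v
          set b := gaussSum x w
          have h3 : 2 * ‖a‖ ≤ ‖a + b‖ + ‖a - b‖ := by
            calc 2 * ‖a‖ = ‖(a + b) + (a - b)‖ := by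
                  rw [show (a + b) + (a - b) = (2 : ℂ) • a by rw [two_smul]; abel, norm_smul]
                  simp
              _ ≤ _ := norm_add_le _ _
          nlinarith [sq_nonneg (‖a + b‖ - ‖a - b‖), norm_nonneg a]
      _ = _ := by
          rw [lintegral_add_left hmv, ← h1, two_mul]
  exact (ENNReal.mul_le_mul_iff_right (by simp) (by simp)).1 h2

/-- The ideal property of Gaussian norms. -/
lemma gaussNorm_matrix_le (K : Matrix (Fin n) (Fin n) ℝ) {κ : ℝ} (hκ : 0 ≤ κ)
    (hK : ∀ ξ : Fin n → ℝ, ∑ i, (∑ j, K i j * ξ j) ^ 2 ≤ κ ^ 2 * ∑ j, ξ j ^ 2) (x : Fin n → X) :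
    gaussNorm (fun i => ∑ j, (K i j : ℂ) • x j) ≤ κ * gaussNorm x := by
  classical
  set E := EuclideanSpace ℝ (Fin n)
  set L : E →L[ℝ] E := Matrix.toEuclideanCLM (𝕜 := ℝ) K with hL
  have hLn : ∀ t : E, ‖L t‖ ^ 2 = ∑ i, (∑ j, K i j * t j) ^ 2 := by
    intro t
    rw [EuclideanSpace.real_norm_sq_eq]
    rfl
  -- The bound on `K` says that `S` is positive semidefinite. A Gaussian vector of covariance `κ²`
  -- is then the sum of the image of a standard one under the transpose of `K` and an independent
  -- one of covariance `S`. Dropping the latter decreases the second moment.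
  set S : Matrix (Fin n) (Fin n) ℝ := κ ^ 2 • (1 : Matrix (Fin n) (Fin n) ℝ) - K.transpose * K
  have hSt : ∀ t : Fin n → ℝ, t ⬝ᵥ S.mulVec t =
      κ ^ 2 * ∑ j, t j ^ 2 - ∑ i, (∑ j, K i j * t j) ^ 2 := by
    intro t
    rw [Matrix.sub_mulVec, dotProduct_sub, Matrix.smul_mulVec, Matrix.one_mulVec,
      dotProduct_smul, ← Matrix.mulVec_mulVec, Matrix.dotProduct_mulVec, Matrix.vecMul_transpose]
    simp only [dotProduct, Matrix.mulVec, smul_eq_mul, sq]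
  have hS : S.PosSemidef := by
    refine Matrix.PosSemidef.of_dotProduct_mulVec_nonneg ?_ fun t => ?_
    · refine Matrix.IsHermitian.sub ?_ ?_
      · simp [Matrix.IsHermitian]
      · simpa using Matrix.isHermitian_conjTranspose_mul_self K
    · rw [star_trivial, hSt]
      linarith [hK t]
  set ν := multivariateGaussian (0 : E) S
  have hν : ν.map (fun v => -v) = ν := by
    have : IsProbabilityMeasure (ν.map (fun v => -v)) :=
      Measure.isProbabilityMeasure_map (by fun_prop)
    refine Measure.ext_of_charFun ?_
    ext t
    have h1 : charFun (ν.map (fun v => -v)) t = charFun ν (-t) := by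
      rw [charFun_apply, charFun_apply, integral_map (by fun_prop)
        (Continuous.aestronglyMeasurable (by fun_prop))]
      simp
    rw [h1, charFun_multivariateGaussian hS, charFun_multivariateGaussian hS]
    simp [Matrix.mulVec_neg]
  set ρ := (stdGaussian E).map (ContinuousLinearMap.adjoint L)
  have hρ : IsProbabilityMeasure ρ := Measure.isProbabilityMeasure_map (by fun_prop)
  have hconv : ρ.conv ν = (stdGaussian E).map (κ • ContinuousLinearMap.id ℝ E) := by
    have : IsProbabilityMeasure ((stdGaussian E).map (κ • ContinuousLinearMap.id ℝ E)) :=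
      Measure.isProbabilityMeasure_map (by fun_prop)
    refine Measure.ext_of_charFun ?_
    ext t
    rw [charFun_conv, charFun_map_stdGaussian, charFun_map_stdGaussian,
      charFun_multivariateGaussian hS, ← exp_add]
    congr 1
    have e1 : ‖ContinuousLinearMap.adjoint (κ • ContinuousLinearMap.id ℝ E) t‖ ^ 2 =
        κ ^ 2 * ∑ j, t j ^ 2 := by
      rw [← EuclideanSpace.real_norm_sq_eq]
      have h1 : ContinuousLinearMap.adjoint (κ • ContinuousLinearMap.id ℝ E) t = κ • t := by
        refine ext_inner_right ℝ fun w => ?_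
        rw [ContinuousLinearMap.adjoint_inner_left, smul_apply, ContinuousLinearMap.id_apply,
          real_inner_smul_right, real_inner_smul_left]
      rw [h1, norm_smul, mul_pow, Real.norm_eq_abs, sq_abs]
    rw [ContinuousLinearMap.adjoint_adjoint, ← ofReal_pow, ← ofReal_pow, e1, hLn, hSt]
    simp
    ring
  have key := lintegral_gaussSum_le x (ρ := ρ) hν
  have hm : Measurable fun v : E => ENNReal.ofReal (‖gaussSum x v‖ ^ 2) :=
    (ENNReal.continuous_ofReal.comp ((continuous_gaussSum x).norm.pow 2)).measurable
  rw [hconv, lintegral_map hm (by fun_prop), lintegral_map hm (by fun_prop)] at key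
  have e2 : ∀ v : E, gaussSum x (ContinuousLinearMap.adjoint L v) =
      gaussSum (fun i => ∑ j, (K i j : ℂ) • x j) v := by
    intro v
    have : ∀ j, (ContinuousLinearMap.adjoint L v) j = ∑ i, K i j * v i := by
      intro j
      have h1 : ContinuousLinearMap.adjoint L = Matrix.toEuclideanCLM (𝕜 := ℝ) K.transpose := by
        rw [hL, ← ContinuousLinearMap.star_eq_adjoint, ← map_star]
        rfl
      rw [h1]
      rfl
    simp only [gaussSum, this, Finset.smul_sum, ofReal_sum, Finset.sum_smul, ofReal_mul, smul_smul]
    rw [Finset.sum_comm]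
    refine Finset.sum_congr rfl fun i _ => Finset.sum_congr rfl fun j _ => ?_
    rw [mul_comm]
  have e3 : ∀ v : E, ‖gaussSum x ((κ • ContinuousLinearMap.id ℝ E) v)‖ ^ 2 =
      κ ^ 2 * ‖gaussSum x v‖ ^ 2 := by
    intro v
    rw [smul_apply, ContinuousLinearMap.id_apply, gaussSum_smul, norm_smul,
      mul_pow, Complex.norm_real, Real.norm_eq_abs, sq_abs]
  simp_rw [e2, e3] at key
  rw [← ofReal_integral_eq_lintegral_ofReal (integrable_gaussSum_sq _)
      (Eventually.of_forall fun v => by positivity),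
    ← ofReal_integral_eq_lintegral_ofReal ((integrable_gaussSum_sq x).const_mul _)
      (Eventually.of_forall fun v => by positivity), integral_const_mul] at key
  have h0 : 0 ≤ ∫ v, ‖gaussSum x v‖ ^ 2 ∂stdGaussian E := integral_nonneg fun v => by positivity
  rw [ENNReal.ofReal_le_ofReal_iff (by positivity)] at key
  rw [gaussNorm_eq, gaussNorm_eq]
  refine (Real.sqrt_le_sqrt key).trans (le_of_eq ?_)
  rw [Real.sqrt_mul (by positivity), Real.sqrt_sq hκ]

/-- A sum of `n` independent standard Gaussians has variance `n`. -/
lemma gaussNorm_const (x : X) : gaussNorm (fun _ : Fin n => x) = Real.sqrt n * ‖x‖ := by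
  set E := EuclideanSpace ℝ (Fin n)
  set L : StrongDual ℝ E := innerSL ℝ (toLp 2 fun _ => (1 : ℝ))
  have hLv : ∀ v : E, L v = ∑ k, v k := by
    intro v
    rw [innerSL_apply_apply, PiLp.inner_apply]
    simp
  have h1 := variance_dual_stdGaussian L
  rw [variance_eq_integral (by fun_prop), integral_strongDual_stdGaussian] at h1
  have h2 : ‖L‖ ^ 2 = n := by
    rw [innerSL_apply_norm, EuclideanSpace.real_norm_sq_eq]
    simp
  have h3 : ∀ v : E, ‖gaussSum (fun _ : Fin n => x) v‖ ^ 2 = (L v - 0) ^ 2 * ‖x‖ ^ 2 := by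
    intro v
    rw [gaussSum, ← Finset.sum_smul, norm_smul, mul_pow, ← ofReal_sum, Complex.norm_real,
      Real.norm_eq_abs, sq_abs, hLv, sub_zero]
  rw [gaussNorm_eq]
  simp_rw [h3]
  rw [integral_mul_const, h1, h2, Real.sqrt_mul (by positivity), Real.sqrt_sq (norm_nonneg _)]

/-- The matrix with all entries `1 / n` is a projection of norm one; it replaces every vector by the
mean, and the Gaussian norm of a constant family is explicit. -/
lemma norm_sum_le_gaussNorm (x : Fin n → X) : ‖∑ i, x i‖ ≤ Real.sqrt n * gaussNorm x := by
  rcases Nat.eq_zero_or_pos n with rfl | hn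
  · simp
  have hn' : (0 : ℝ) < n := by exact_mod_cast hn
  have h := gaussNorm_matrix_le (Matrix.of fun _ _ : Fin n => (n : ℝ)⁻¹) zero_le_one (fun ξ => ?_) x
  · simp only [Matrix.of_apply] at h
    rw [one_mul, gaussNorm_const, ← Finset.smul_sum, norm_smul] at h
    have h2 : Real.sqrt n * Real.sqrt n = n := Real.mul_self_sqrt hn'.le
    have h3 := mul_le_mul_of_nonneg_left h (Real.sqrt_nonneg n)
    rw [← mul_assoc, ← mul_assoc, h2] at h3
    simpa [hn.ne'] using h3
  · simp only [Matrix.of_apply, ← Finset.mul_sum]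
    rw [Finset.sum_const, Finset.card_univ, Fintype.card_fin, nsmul_eq_mul]
    have h4 := sq_sum_le_card_mul_sum_sq (s := (Finset.univ : Finset (Fin n))) (f := ξ)
    rw [Finset.card_univ, Fintype.card_fin] at h4
    calc (n : ℝ) * ((n : ℝ)⁻¹ * ∑ j, ξ j) ^ 2 = (n : ℝ)⁻¹ * (∑ j, ξ j) ^ 2 := by
          field_simp
      _ ≤ (n : ℝ)⁻¹ * (n * ∑ j, ξ j ^ 2) := by gcongr
      _ = _ := by field_simp

/-- Twofold application of `γ`-boundedness along a bounded matrix. -/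
lemma norm_double_sum_le {τ : Set (X →L[ℂ] X)} {C : ℝ} (hC : 0 ≤ C)
    (hτ : ∀ (n : ℕ) (T : Fin n → X →L[ℂ] X) (x : Fin n → X),
      (∀ k, T k ∈ τ) → gaussNorm (fun k => T k (x k)) ≤ C * gaussNorm x)
    (S : Fin n → X →L[ℂ] X) (hS : ∀ k, S k ∈ τ) (K : Matrix (Fin n) (Fin n) ℝ) {κ : ℝ}
    (hκ : 0 ≤ κ)
    (hK : ∀ ξ : Fin n → ℝ, ∑ i, (∑ j, K i j * ξ j) ^ 2 ≤ κ ^ 2 * ∑ j, ξ j ^ 2) (x : X) :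
    ‖∑ i, ∑ j, (K i j : ℂ) • S i (S j x)‖ ≤ C ^ 2 * κ * n * ‖x‖ := by
  have e1 : ∑ i, ∑ j, (K i j : ℂ) • S i (S j x) = ∑ i, S i (∑ j, (K i j : ℂ) • S j x) := by
    simp [map_sum]
  rw [e1]
  calc _ ≤ Real.sqrt n * gaussNorm fun i => S i (∑ j, (K i j : ℂ) • S j x) :=
        norm_sum_le_gaussNorm _
    _ ≤ Real.sqrt n * (C * gaussNorm fun i => ∑ j, (K i j : ℂ) • S j x) := by
        gcongr; exact hτ n S _ hS
    _ ≤ Real.sqrt n * (C * (κ * gaussNorm fun j => S j x)) := by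
        gcongr; exact gaussNorm_matrix_le K hκ hK _
    _ ≤ Real.sqrt n * (C * (κ * (C * gaussNorm fun _ : Fin n => x))) := by
        gcongr; exact hτ n S _ hS
    _ = C ^ 2 * κ * (Real.sqrt n * Real.sqrt n) * ‖x‖ := by rw [gaussNorm_const]; ring
    _ = _ := by rw [Real.mul_self_sqrt (by positivity)]

end Gauss

end SmoothedCalculus

end

noncomputable section

namespace SmoothedCalculus

/-! ### Plancherel's theorem and the Hankel operator -/

section Plancherel

open FourierTransform

/-- Plancherel's theorem for functions in `L¹ ∩ L²`. -/
lemma fourier_ae_eq {a : ℝ → ℂ} (h1 : Integrable a) (h2 : MemLp a 2) :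
    ((𝓕 (h2.toLp a) : Lp (α := ℝ) ℂ 2 volume) : ℝ → ℂ) =ᵐ[volume] 𝓕 a := by
  set G : Lp (α := ℝ) ℂ 2 volume := 𝓕 (h2.toLp a)
  have hc : Continuous (𝓕 a) := by
    have : 𝓕 a = fun w => ft a (2 * Real.pi * w) := funext (fourier_eq_ft a)
    rw [this]
    exact (continuous_ft h1).comp (by fun_prop)
  -- Both transforms are tested against smooth functions. On the `L²` side unitarity moves the
  -- transform to the test function, and on the `L¹` side Fubini's theorem does.
  refine ae_eq_of_integral_contDiff_smul_eq ((Lp.memLp G).locallyIntegrable (by norm_num))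
    hc.locallyIntegrable fun g hg hgc => ?_
  have hgC : ContDiff ℝ ∞ fun x => (g x : ℂ) := Complex.ofRealCLM.contDiff.comp hg
  have hgCc : HasCompactSupport fun x => (g x : ℂ) := hgc.comp_left Complex.ofReal_zero
  set χ : SchwartzMap ℝ ℂ := hgCc.toSchwartzMap hgC
  have e1 : inner ℂ (χ.toLp 2) G = inner ℂ ((𝓕⁻ χ).toLp 2) (h2.toLp a) := by
    have h3 := Lp.inner_fourier_eq ((𝓕⁻ χ).toLp 2) (h2.toLp a)
    rwa [SchwartzMap.toLp_fourier_eq, FourierTransform.fourier_fourierInv_eq] at h3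
  have e2 : inner ℂ (χ.toLp 2) G = ∫ x, g x • (G : ℝ → ℂ) x := by
    rw [L2.inner_def]
    refine integral_congr_ae ?_
    filter_upwards [χ.coeFn_toLp 2] with x hx
    rw [hx]
    change (G : ℝ → ℂ) x * (starRingEnd ℂ) (g x : ℂ) = _
    rw [Complex.conj_ofReal, real_smul, mul_comm]
  have e3 : inner ℂ ((𝓕⁻ χ).toLp 2) (h2.toLp a) = ∫ x, a x * 𝓕 (fun x => (g x : ℂ)) x := by
    rw [L2.inner_def]
    refine integral_congr_ae ?_
    filter_upwards [(𝓕⁻ χ).coeFn_toLp 2, h2.coeFn_toLp] with x hx hx'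
    rw [hx, hx']
    change a x * (starRingEnd ℂ) ((𝓕⁻ χ) x) = _
    congr 1
    rw [SchwartzMap.fourierInv_coe, Real.fourierInv_eq', Real.fourier_real_eq_integral_exp_smul,
      ← integral_conj]
    refine integral_congr_ae (Eventually.of_forall fun w => ?_)
    simp only [smul_eq_mul, map_mul, ← Complex.exp_conj]
    change _ * (starRingEnd ℂ) (g w : ℂ) = _
    congr 1
    · congr 1
      simp [Complex.conj_ofNat]
      ring
    · exact Complex.conj_ofReal _
  rw [← e2, e1, e3]
  have h4 := VectorFourier.integral_bilin_fourierIntegral_eq_flip (L := innerₗ ℝ) (f := a)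
    (μ := volume) (ν := volume) (g := fun x : ℝ => (g x : ℂ)) (ContinuousLinearMap.mul ℂ ℂ)
    Real.continuous_fourierChar continuous_inner h1
    (hgC.continuous.integrable_of_hasCompactSupport hgCc)
  rw [flip_innerₗ] at h4
  refine h4.symm.trans (integral_congr_ae (Eventually.of_forall fun x => ?_))
  exact mul_comm _ _

lemma integral_norm_sq_fourier {a : ℝ → ℂ} (h1 : Integrable a) (h2 : MemLp a 2) :
    Integrable (fun w => ‖𝓕 a w‖ ^ 2) ∧ ∫ w, ‖𝓕 a w‖ ^ 2 = ∫ x, ‖a x‖ ^ 2 := by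
  have h3 := fourier_ae_eq h1 h2
  have h4 : MemLp (𝓕 a) 2 := (memLp_congr_ae h3).1 (Lp.memLp _)
  refine ⟨(memLp_two_iff_integrable_sq_norm h4.1).1 h4, ?_⟩
  have key := Lp.inner_fourier_eq (h2.toLp a) (h2.toLp a)
  rw [L2.inner_def, L2.inner_def] at key
  have e1 : ∫ x, inner ℂ ((𝓕 (h2.toLp a) : Lp (α := ℝ) ℂ 2 volume) x)
      ((𝓕 (h2.toLp a) : Lp (α := ℝ) ℂ 2 volume) x) = ((∫ w, ‖𝓕 a w‖ ^ 2 : ℝ) : ℂ) := by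
    rw [← integral_complex_ofReal]
    refine integral_congr_ae ?_
    filter_upwards [h3] with x hx
    rw [hx, inner_self_eq_norm_sq_to_K]
    push_cast
    rfl
  have e2 : ∫ x, inner ℂ ((h2.toLp a : Lp (α := ℝ) ℂ 2 volume) x)
      ((h2.toLp a : Lp (α := ℝ) ℂ 2 volume) x) = ((∫ w, ‖a w‖ ^ 2 : ℝ) : ℂ) := by
    rw [← integral_complex_ofReal]
    refine integral_congr_ae ?_
    filter_upwards [h2.coeFn_toLp] with x hx
    rw [hx, inner_self_eq_norm_sq_to_K]
    push_cast
    rfl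
  rw [e1, e2] at key
  exact_mod_cast key

/-- The Hankel operator with kernel `h(x + y)` is bounded on `L²` by `sup |ft h|`. -/
lemma integral_norm_sq_hankel_le {h b : ℝ → ℂ} (hh : Continuous h) (hc : HasCompactSupport h)
    {M : ℝ} (hM : ∀ t, ‖ft h t‖ ≤ M) (hb : Integrable b) (hb2 : MemLp b 2) :
    Integrable (fun x => ‖∫ y, h (x + y) * b y‖ ^ 2) ∧
      ∫ x, ‖∫ y, h (x + y) * b y‖ ^ 2 ≤ M ^ 2 * ∫ y, ‖b y‖ ^ 2 := by
  have hhi : Integrable h := hh.integrable_of_hasCompactSupport hc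
  set k : ℝ → ℂ := fun x => ∫ y, h (x + y) * b y
  set b' : ℝ → ℂ := fun y => b (-y)
  have hb' : Integrable b' := hb.comp_neg
  have hb2' : MemLp b' 2 := hb2.comp_measurePreserving (Measure.measurePreserving_neg volume)
  -- Reflecting `b` turns the Hankel kernel into a convolution, on which the transform acts by
  -- multiplication with a function bounded by `M`.
  have hk : k = b' ⋆[ContinuousLinearMap.mul ℂ ℂ, volume] h := by
    ext x
    rw [convolution_def, ← integral_neg_eq_self]
    refine integral_congr_ae (Eventually.of_forall fun y => ?_)
    simp [b', mul_comm]
  have hki : Integrable k := by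
    rw [hk]; exact hb'.integrable_convolution _ hhi
  obtain ⟨K, hK⟩ := hh.bounded_above_of_compact_support hc
  have hkb : ∀ x, ‖k x‖ ≤ K * ∫ y, ‖b y‖ := by
    intro x
    refine (norm_integral_le_of_norm_le (hb.norm.const_mul K)
      (Eventually.of_forall fun y => ?_)).trans (le_of_eq (integral_const_mul _ _))
    rw [norm_mul]
    exact mul_le_mul_of_nonneg_right (hK _) (norm_nonneg _)
  have hk2 : Integrable fun x => ‖k x‖ ^ 2 := by
    refine (hki.norm.const_mul (K * ∫ y, ‖b y‖)).mono'
      (hki.aestronglyMeasurable.norm.pow 2) (Eventually.of_forall fun x => ?_)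
    rw [Real.norm_of_nonneg (by positivity), sq]
    exact mul_le_mul_of_nonneg_right (hkb x) (norm_nonneg _)
  have hkm : MemLp k 2 := (memLp_two_iff_integrable_sq_norm hki.aestronglyMeasurable).2 hk2
  refine ⟨hk2, ?_⟩
  obtain ⟨i1, e1⟩ := integral_norm_sq_fourier hki hkm
  obtain ⟨i2, e2⟩ := integral_norm_sq_fourier hb' hb2'
  have e3 : ∫ y, ‖b y‖ ^ 2 = ∫ y, ‖b' y‖ ^ 2 := (integral_neg_eq_self _ _).symm
  rw [← e1, e3, ← e2, ← integral_const_mul]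
  refine integral_mono i1 (i2.const_mul _) fun w => ?_
  simp only
  rw [hk, Real.fourier_mul_convolution_eq hb' hhi, norm_mul, mul_pow, mul_comm]
  have h5 := hM (2 * Real.pi * w)
  rw [← fourier_eq_ft] at h5
  gcongr

end Plancherel

/-! ### Discretization of operator valued Hankel integrals -/

section Galerkin

/-- The grid intervals `(i/N, (i+1)/N]`. -/
def gridIoc (N : ℕ) (i : ℕ) : Set ℝ := Ioc ((i : ℝ) / N) ((i + 1 : ℕ) / N)

lemma measurableSet_gridIoc (N i : ℕ) : MeasurableSet (gridIoc N i) := measurableSet_Ioc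

lemma volume_gridIoc_lt_top (N i : ℕ) : volume (gridIoc N i) < ⊤ := measure_Ioc_lt_top

lemma grid_le (N i : ℕ) : (i : ℝ) / N ≤ ((i + 1 : ℕ) : ℝ) / N := by
  push_cast
  gcongr
  linarith

lemma eq_of_mem_gridIoc {N i j : ℕ} {y : ℝ} (hi : y ∈ gridIoc N i) (hj : y ∈ gridIoc N j) :
    i = j := by
  have hN : (0 : ℝ) < N := by
    rcases Nat.eq_zero_or_pos N with rfl | h
    · simp [gridIoc] at hi
    · exact_mod_cast h
  have key : ∀ {i j : ℕ}, y ∈ gridIoc N i → y ∈ gridIoc N j → i ≤ j := by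
    intro i j hi hj
    have h1 := hi.1.trans_le hj.2
    rw [div_lt_div_iff_of_pos_right hN] at h1
    have h2 : i < j + 1 := by exact_mod_cast h1
    omega
  exact le_antisymm (key hi hj) (key hj hi)

lemma sum_gridIoc_integral {E : Type*} [NormedAddCommGroup E] [NormedSpace ℝ E] {g : ℝ → E}
    (hg : Continuous g) {N : ℕ} (hN : 0 < N) :
    ∑ i : Fin N, ∫ x in ((i : ℕ) : ℝ) / N..((i + 1 : ℕ) : ℝ) / N, g x = ∫ x in (0 : ℝ)..1, g x := by
  rw [Fin.sum_univ_eq_sum_range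
    (fun i : ℕ => ∫ x in (i : ℝ) / N..((i + 1 : ℕ) : ℝ) / N, g x) N,
    intervalIntegral.sum_integral_adjacent_intervals (a := fun i : ℕ => (i : ℝ) / N)
      fun k _ => hg.intervalIntegrable _ _]
  simp [hN.ne']

/-- The Galerkin matrix of the Hankel kernel `h(x + y)`. -/
def hankelMatrix (h : ℝ → ℂ) (N : ℕ) (i j : Fin N) : ℂ :=
  N * ∫ x in ((i : ℕ) : ℝ) / N..((i + 1 : ℕ) : ℝ) / N,
    ∫ y in ((j : ℕ) : ℝ) / N..((j + 1 : ℕ) : ℝ) / N, h (x + y)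

/-- Cauchy–Schwarz, obtained from the nonnegative integral of the squared deviation of `(b - a) ‖k‖`
from its mean. -/
lemma norm_integral_sq_le {k : ℝ → ℂ} (hk : Continuous k) {a b : ℝ} (hab : a ≤ b) :
    ‖∫ x in a..b, k x‖ ^ 2 ≤ (b - a) * ∫ x in a..b, ‖k x‖ ^ 2 := by
  set J := ∫ x in a..b, ‖k x‖
  have h0 : ‖∫ x in a..b, k x‖ ≤ J := intervalIntegral.norm_integral_le_integral_norm hab
  have h1 : 0 ≤ ∫ x in a..b, ((b - a) * ‖k x‖ - J) ^ 2 :=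
    intervalIntegral.integral_nonneg hab fun x _ => sq_nonneg _
  have h2 : ∫ x in a..b, ((b - a) * ‖k x‖ - J) ^ 2 =
      (b - a) ^ 2 * (∫ x in a..b, ‖k x‖ ^ 2) - 2 * (b - a) * J * J + (b - a) * J ^ 2 := by
    have e : ∀ x, ((b - a) * ‖k x‖ - J) ^ 2 =
        (b - a) ^ 2 * ‖k x‖ ^ 2 - 2 * (b - a) * J * ‖k x‖ + J ^ 2 := fun x => by ring
    simp_rw [e]
    rw [intervalIntegral.integral_add, intervalIntegral.integral_sub,
      intervalIntegral.integral_const_mul, intervalIntegral.integral_const_mul,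
      intervalIntegral.integral_const, smul_eq_mul]
    all_goals exact Continuous.intervalIntegrable (by fun_prop) _ _
  rcases hab.eq_or_lt with rfl | hlt
  · simp
  have h3 : J ^ 2 ≤ (b - a) * ∫ x in a..b, ‖k x‖ ^ 2 := by
    have h4 : 0 < b - a := sub_pos.2 hlt
    rw [h2] at h1
    have h5 : 0 ≤ (b - a) * ((b - a) * (∫ x in a..b, ‖k x‖ ^ 2) - J ^ 2) := by linarith
    linarith [(mul_nonneg_iff_of_pos_left h4).1 h5]
  exact (pow_le_pow_left₀ (norm_nonneg _) h0 2).trans h3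

/-- The Galerkin matrices are bounded by `sup |ft h|`. -/
lemma sum_norm_sq_hankelMatrix_le {h : ℝ → ℂ} (hh : Continuous h) (hc : HasCompactSupport h)
    {M : ℝ} (hM : ∀ t, ‖ft h t‖ ≤ M) {N : ℕ} (hN : 0 < N) (ξ : Fin N → ℝ) :
    ∑ i, ‖∑ j, hankelMatrix h N i j * ξ j‖ ^ 2 ≤ M ^ 2 * ∑ j, ξ j ^ 2 := by
  have hN' : (0 : ℝ) < N := by exact_mod_cast hN
  -- The step function with values `ξ` has squared norm `N⁻¹ ∑ ξ²`, and the matrix applied to `ξ`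
  -- gives the means of its Hankel image over the cells. The factor `N` in `hankelMatrix` is what
  -- makes the discrete and continuous norms match.
  set b : ℝ → ℂ := fun y => ∑ j : Fin N, (gridIoc N j).indicator (fun _ => (ξ j : ℂ)) y
  have hbi : ∀ j : Fin N, Integrable ((gridIoc N j).indicator fun _ : ℝ => (ξ j : ℂ)) := fun j =>
    (integrable_indicator_iff (measurableSet_gridIoc N j)).2
      (integrableOn_const (volume_gridIoc_lt_top N j).ne)
  have hb : Integrable b := integrable_finsetSum _ fun j _ => hbi j
  have hb2 : MemLp b 2 := by
    refine memLp_finsetSum _ fun j _ => ?_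
    exact memLp_indicator_const 2 (measurableSet_gridIoc N j) _ (Or.inr (volume_gridIoc_lt_top N j).ne)
  have hsq : ∀ y, ‖b y‖ ^ 2 = ∑ j : Fin N, (gridIoc N j).indicator (fun _ => ξ j ^ 2) y := by
    intro y
    by_cases hy : ∃ j : Fin N, y ∈ gridIoc N j
    · obtain ⟨j, hj⟩ := hy
      have hne : ∀ i : Fin N, i ≠ j → y ∉ gridIoc N i := fun i hij hi =>
        hij (Fin.ext (eq_of_mem_gridIoc hi hj))
      simp only [b]
      rw [Finset.sum_eq_single j, Finset.sum_eq_single j, indicator_of_mem hj, indicator_of_mem hj,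
        Complex.norm_real, Real.norm_eq_abs, sq_abs]
      · exact fun i _ hi => indicator_of_notMem (hne i hi) _
      · simp
      · exact fun i _ hi => indicator_of_notMem (hne i hi) _
      · simp
    · push Not at hy
      simp only [b]
      rw [Finset.sum_eq_zero fun j _ => indicator_of_notMem (hy j) _,
        Finset.sum_eq_zero fun j _ => indicator_of_notMem (hy j) _]
      simp
  have hbn : ∫ y, ‖b y‖ ^ 2 = (N : ℝ)⁻¹ * ∑ j, ξ j ^ 2 := by
    simp_rw [hsq]
    have hi : ∀ j : Fin N, Integrable ((gridIoc N j).indicator fun _ => ξ j ^ 2) := fun j =>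
      (integrable_indicator_iff (measurableSet_gridIoc N j)).2
        (integrableOn_const (volume_gridIoc_lt_top N j).ne)
    rw [integral_finsetSum _ fun j _ => hi j, Finset.mul_sum]
    refine Finset.sum_congr rfl fun j _ => ?_
    rw [integral_indicator (measurableSet_gridIoc N j), setIntegral_const, gridIoc,
      Real.volume_real_Ioc_of_le (grid_le _ _), smul_eq_mul]
    congr 1
    push_cast
    field_simp
    ring
  set k : ℝ → ℂ := fun x => ∫ y, h (x + y) * b y
  have hkint : ∀ x, k x = ∑ j : Fin N, (∫ y in ((j : ℕ) : ℝ) / N..((j + 1 : ℕ) : ℝ) / N,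
      h (x + y)) * ξ j := by
    intro x
    have e : ∀ y, h (x + y) * b y =
        ∑ j : Fin N, (gridIoc N j).indicator (fun y => h (x + y) * ξ j) y := by
      intro y
      simp only [b, Finset.mul_sum]
      refine Finset.sum_congr rfl fun j _ => ?_
      by_cases hy : y ∈ gridIoc N j
      · rw [indicator_of_mem hy, indicator_of_mem hy]
      · rw [indicator_of_notMem hy, indicator_of_notMem hy, mul_zero]
    simp only [k, e]
    have hi : ∀ j : Fin N, Integrable ((gridIoc N j).indicator fun y => h (x + y) * ξ j) :=
      fun j => (integrable_indicator_iff (measurableSet_gridIoc N j)).2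
        ((Continuous.integrableOn_Icc (by fun_prop)).mono_set Ioc_subset_Icc_self)
    rw [integral_finsetSum _ fun j _ => hi j]
    refine Finset.sum_congr rfl fun j _ => ?_
    rw [integral_indicator (measurableSet_gridIoc N j), gridIoc,
      ← intervalIntegral.integral_of_le (grid_le _ _), intervalIntegral.integral_mul_const]
  have hkc : Continuous k := by
    have : k = fun x => ∑ j : Fin N, (∫ y in ((j : ℕ) : ℝ) / N..((j + 1 : ℕ) : ℝ) / N,
      h (x + y)) * ξ j := funext hkint
    rw [this]
    refine continuous_finsetSum _ fun j _ => Continuous.mul ?_ continuous_const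
    exact intervalIntegral.continuous_parametric_intervalIntegral_of_continuous' (by fun_prop) _ _
  obtain ⟨hk2, hkM⟩ := integral_norm_sq_hankel_le hh hc hM hb hb2
  have hrow : ∀ i : Fin N, ‖∑ j, hankelMatrix h N i j * ξ j‖ ^ 2 ≤
      N * ∫ x in ((i : ℕ) : ℝ) / N..((i + 1 : ℕ) : ℝ) / N, ‖k x‖ ^ 2 := by
    intro i
    have e : ∑ j, hankelMatrix h N i j * ξ j =
        N * ∫ x in ((i : ℕ) : ℝ) / N..((i + 1 : ℕ) : ℝ) / N, k x := by
      simp_rw [hkint]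
      have hcj : ∀ j : Fin N, Continuous fun x => (∫ y in ((j : ℕ) : ℝ) / N..((j + 1 : ℕ) : ℝ) / N,
          h (x + y)) * (ξ j : ℂ) := fun j =>
        (intervalIntegral.continuous_parametric_intervalIntegral_of_continuous'
          (f := fun x y => h (x + y)) (by fun_prop) _ _).mul continuous_const
      rw [intervalIntegral.integral_finsetSum fun j _ => (hcj j).intervalIntegrable _ _,
        Finset.mul_sum]
      refine Finset.sum_congr rfl fun j _ => ?_
      rw [intervalIntegral.integral_mul_const, hankelMatrix, mul_assoc]
    rw [e, norm_mul, mul_pow, Complex.norm_natCast]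
    refine (mul_le_mul_of_nonneg_left (norm_integral_sq_le hkc (grid_le N i)) (by positivity)).trans
      (le_of_eq ?_)
    push_cast
    field_simp
    ring
  calc ∑ i, ‖∑ j, hankelMatrix h N i j * ξ j‖ ^ 2
      ≤ ∑ i : Fin N, N * ∫ x in ((i : ℕ) : ℝ) / N..((i + 1 : ℕ) : ℝ) / N, ‖k x‖ ^ 2 :=
        Finset.sum_le_sum fun i _ => hrow i
    _ = N * ∫ x in (0 : ℝ)..1, ‖k x‖ ^ 2 := by
        rw [← Finset.mul_sum, sum_gridIoc_integral (g := fun x => ‖k x‖ ^ 2) (hkc.norm.pow 2) hN]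
    _ ≤ N * ∫ x, ‖k x‖ ^ 2 := by
        gcongr
        rw [intervalIntegral.integral_of_le zero_le_one]
        exact setIntegral_le_integral hk2 (Eventually.of_forall fun x => by positivity)
    _ ≤ N * (M ^ 2 * ∫ y, ‖b y‖ ^ 2) := by gcongr
    _ = _ := by rw [hbn]; field_simp

variable {X : Type*} [NormedAddCommGroup X] [NormedSpace ℂ X]

/-- The ideal property is available for real matrices. Since `ξ` is real, the real and imaginary
parts of the Galerkin matrix inherit its bound; treating them separately costs the factor `2`. -/
lemma norm_hankel_sum_le {τ : Set (X →L[ℂ] X)} {C : ℝ} (hC : 0 ≤ C)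
    (hτ : ∀ (n : ℕ) (T : Fin n → X →L[ℂ] X) (x : Fin n → X),
      (∀ k, T k ∈ τ) → gaussNorm (fun k => T k (x k)) ≤ C * gaussNorm x)
    {h : ℝ → ℂ} (hh : Continuous h) (hc : HasCompactSupport h)
    {M : ℝ} (hM : ∀ t, ‖ft h t‖ ≤ M) {N : ℕ} (hN : 0 < N) (S : Fin N → X →L[ℂ] X)
    (hS : ∀ k, S k ∈ τ) (u : X) :
    ‖∑ i, ∑ j, hankelMatrix h N i j • S i (S j u)‖ ≤ 2 * C ^ 2 * M * N * ‖u‖ := by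
  have hM0 : 0 ≤ M := (norm_nonneg _).trans (hM 0)
  have hsum := sum_norm_sq_hankelMatrix_le hh hc hM hN
  have hre : ∀ (p : ℂ → ℝ) (hp : ∀ z, p z ^ 2 ≤ ‖z‖ ^ 2)
      (hl : ∀ ξ : Fin N → ℝ, ∀ i, p (∑ j, hankelMatrix h N i j * ξ j) =
        ∑ j, p (hankelMatrix h N i j) * ξ j),
      ‖∑ i, ∑ j, (p (hankelMatrix h N i j) : ℂ) • S i (S j u)‖ ≤ C ^ 2 * M * N * ‖u‖ := by
    intro p hp hl
    refine norm_double_sum_le hC hτ S hS (Matrix.of fun i j => p (hankelMatrix h N i j)) hM0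
      (fun ξ => ?_) u
    refine le_trans (Finset.sum_le_sum fun i _ => ?_) (hsum ξ)
    simp only [Matrix.of_apply]
    rw [← hl]
    exact hp _
  have h1 := hre Complex.re (fun z => sq_le_sq.2 (by
    rw [abs_norm]; exact abs_re_le_norm z)) (fun ξ i => by simp)
  have h2 := hre Complex.im (fun z => sq_le_sq.2 (by
    rw [abs_norm]; exact abs_im_le_norm z)) (fun ξ i => by simp)
  have e : ∑ i, ∑ j, hankelMatrix h N i j • S i (S j u) =
      ∑ i, ∑ j, ((hankelMatrix h N i j).re : ℂ) • S i (S j u) +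
        I • ∑ i, ∑ j, ((hankelMatrix h N i j).im : ℂ) • S i (S j u) := by
    rw [Finset.smul_sum, ← Finset.sum_add_distrib]
    refine Finset.sum_congr rfl fun i _ => ?_
    rw [Finset.smul_sum, ← Finset.sum_add_distrib]
    refine Finset.sum_congr rfl fun j _ => ?_
    rw [smul_smul, ← add_smul, mul_comm I, re_add_im]
  rw [e]
  refine (norm_add_le _ _).trans ?_
  rw [norm_smul, norm_I, one_mul]
  linarith

/-- The `γ`-boundedness estimate for operator valued Hankel integrals. -/
lemma norm_integral_hankel_le [CompleteSpace X] {τ : Set (X →L[ℂ] X)} {C : ℝ} (hC : 0 ≤ C)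
    (hτ : ∀ (n : ℕ) (T : Fin n → X →L[ℂ] X) (x : Fin n → X),
      (∀ k, T k ∈ τ) → gaussNorm (fun k => T k (x k)) ≤ C * gaussNorm x)
    {h : ℝ → ℂ} (hh : Continuous h) (hc : HasCompactSupport h)
    {M : ℝ} (hM : ∀ t, ‖ft h t‖ ≤ M) {S : ℝ → X →L[ℂ] X}
    (hS : ∀ t ∈ Icc (0 : ℝ) 1, S t ∈ τ) {u : X} {v : ℝ → X} (hv : Continuous v)
    (hSv : ∀ x ∈ Icc (0 : ℝ) 1, ∀ y ∈ Icc (0 : ℝ) 1, S x (S y u) = v (x + y)) :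
    ‖∫ x in (0 : ℝ)..1, ∫ y in (0 : ℝ)..1, h (x + y) • v (x + y)‖ ≤ 2 * C ^ 2 * M * ‖u‖ := by
  obtain ⟨H, hH⟩ := hh.bounded_above_of_compact_support hc
  have hH0 : 0 ≤ H := (norm_nonneg _).trans (hH 0)
  refine le_of_forall_pos_le_add fun ε hε => ?_
  have hε' : 0 < ε / (H + 1) := by positivity
  obtain ⟨δ, hδ, hδv⟩ := Metric.uniformContinuousOn_iff.1
    (isCompact_Icc.uniformContinuousOn_of_continuous (hv.continuousOn (s := Icc 0 2))) _ hε'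
  obtain ⟨N, hN⟩ := exists_nat_gt (max 1 (2 / δ))
  have hN1 : (1 : ℝ) < N := (le_max_left _ _).trans_lt hN
  -- In a grid cell `x` and `y` each move by at most `1 / N`, so `x + y` moves by at most `2 / N`.
  have hNδ : 2 / (N : ℝ) < δ := by
    have := (le_max_right _ _).trans_lt hN
    rw [div_lt_iff₀ hδ] at this
    rw [div_lt_iff₀ (by linarith)]
    linarith
  have hN0 : 0 < N := by
    have : (0 : ℝ) < N := by linarith
    exact_mod_cast this
  have hN' : (0 : ℝ) < N := by linarith
  set pt : Fin N → ℝ := fun i => ((i : ℕ) : ℝ) / N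
  set pt' : Fin N → ℝ := fun i => ((i + 1 : ℕ) : ℝ) / N
  have hpt0 : ∀ i, 0 ≤ pt i := fun i => by positivity
  have hpt1 : ∀ i, pt' i ≤ 1 := fun i => by
    simp only [pt']
    rw [div_le_one hN']
    exact_mod_cast i.2
  have hle : ∀ i, pt i ≤ pt' i := fun i => grid_le N i
  have hlen : ∀ i, pt' i - pt i = (N : ℝ)⁻¹ := fun i => by
    simp only [pt, pt']
    push_cast
    field_simp
    ring
  have hptm : ∀ i, pt i ∈ Icc (0 : ℝ) 1 := fun i => ⟨hpt0 i, (hle i).trans (hpt1 i)⟩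
  have hc2 : ∀ a b : ℝ, Continuous fun x => ∫ y in a..b, h (x + y) • v (x + y) := fun a b =>
    intervalIntegral.continuous_parametric_intervalIntegral_of_continuous'
      (f := fun x y => h (x + y) • v (x + y)) (by fun_prop) _ _
  have hc3 : ∀ (a b : ℝ) (w : X), Continuous fun x => ∫ y in a..b, h (x + y) • w := fun a b w =>
    intervalIntegral.continuous_parametric_intervalIntegral_of_continuous'
      (f := fun x y => h (x + y) • w) (by fun_prop) _ _
  have hJ : ∫ x in (0 : ℝ)..1, ∫ y in (0 : ℝ)..1, h (x + y) • v (x + y) =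
      ∑ i, ∑ j, ∫ x in pt i..pt' i, ∫ y in pt j..pt' j, h (x + y) • v (x + y) := by
    rw [← sum_gridIoc_integral (hc2 0 1) hN0]
    refine Finset.sum_congr rfl fun i _ => ?_
    rw [← intervalIntegral.integral_finsetSum fun j _ => (hc2 _ _).intervalIntegrable _ _]
    refine intervalIntegral.integral_congr fun x _ => ?_
    exact (sum_gridIoc_integral (g := fun y => h (x + y) • v (x + y)) (by fun_prop) hN0).symm
  -- Only the vector is frozen at the grid points; the kernel is integrated exactly. The sum is thus
  -- `N⁻¹` times a Galerkin sum, and `N⁻¹` cancels the `N` in `norm_hankel_sum_le`.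
  have hJN : ∑ i, ∑ j, ∫ x in pt i..pt' i, ∫ y in pt j..pt' j, h (x + y) • v (pt i + pt j) =
      (N : ℂ)⁻¹ • ∑ i, ∑ j, hankelMatrix h N i j • S (pt i) (S (pt j) u) := by
    rw [Finset.smul_sum]
    refine Finset.sum_congr rfl fun i _ => ?_
    rw [Finset.smul_sum]
    refine Finset.sum_congr rfl fun j _ => ?_
    rw [hSv _ (hptm i) _ (hptm j), hankelMatrix, smul_smul,
      inv_mul_cancel_left₀ (by exact_mod_cast hN0.ne')]
    rw [← intervalIntegral.integral_smul_const]
    exact intervalIntegral.integral_congr fun x _ => intervalIntegral.integral_smul_const _ _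
  have hdiff : ‖(∑ i, ∑ j, ∫ x in pt i..pt' i, ∫ y in pt j..pt' j, h (x + y) • v (x + y)) -
      ∑ i, ∑ j, ∫ x in pt i..pt' i, ∫ y in pt j..pt' j, h (x + y) • v (pt i + pt j)‖ ≤ ε := by
    rw [← Finset.sum_sub_distrib]
    have hb : ∀ i j, ‖(∫ x in pt i..pt' i, ∫ y in pt j..pt' j, h (x + y) • v (x + y)) -
        ∫ x in pt i..pt' i, ∫ y in pt j..pt' j, h (x + y) • v (pt i + pt j)‖ ≤
        ε * (N : ℝ)⁻¹ * (N : ℝ)⁻¹ := by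
      intro i j
      rw [← intervalIntegral.integral_sub ((hc2 _ _).intervalIntegrable _ _)
        ((hc3 _ _ _).intervalIntegrable _ _)]
      refine (intervalIntegral.norm_integral_le_of_norm_le_const (C := ε * (N : ℝ)⁻¹)
        fun x hx => ?_).trans (le_of_eq ?_)
      · rw [uIoc_of_le (hle i)] at hx
        rw [← intervalIntegral.integral_sub
          (Continuous.intervalIntegrable (by fun_prop) _ _)
          (Continuous.intervalIntegrable (by fun_prop) _ _)]
        refine (intervalIntegral.norm_integral_le_of_norm_le_const (C := ε)
          fun y hy => ?_).trans (le_of_eq ?_)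
        · rw [uIoc_of_le (hle j)] at hy
          rw [← smul_sub, norm_smul]
          have h1 := hδv (x + y) ⟨by linarith [hpt0 i, hpt0 j, hx.1, hy.1],
              by linarith [hpt1 i, hpt1 j, hx.2, hy.2]⟩ (pt i + pt j)
            ⟨by linarith [hpt0 i, hpt0 j], by linarith [(hptm i).2, (hptm j).2]⟩ (by
              rw [Real.dist_eq, abs_of_nonneg (by linarith [hx.1, hy.1])]
              have h2 : 2 / (N : ℝ) = (N : ℝ)⁻¹ + (N : ℝ)⁻¹ := by ring
              linarith [hlen i, hlen j, hx.2, hy.2])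
          rw [dist_eq_norm] at h1
          calc ‖h (x + y)‖ * ‖v (x + y) - v (pt i + pt j)‖ ≤ H * (ε / (H + 1)) := by
                gcongr
                exact hH _
            _ ≤ ε := by
                rw [mul_div_assoc', div_le_iff₀ (by linarith)]
                nlinarith
        · rw [hlen, abs_of_pos (by positivity)]
      · rw [hlen, abs_of_pos (by positivity)]
    calc _ ≤ ∑ i : Fin N, ∑ j : Fin N, ε * (N : ℝ)⁻¹ * (N : ℝ)⁻¹ := by
          refine (norm_sum_le _ _).trans (Finset.sum_le_sum fun i _ => ?_)
          rw [← Finset.sum_sub_distrib]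
          exact (norm_sum_le _ _).trans (Finset.sum_le_sum fun j _ => hb i j)
      _ = ε := by
          simp only [Finset.sum_const, Finset.card_univ, Fintype.card_fin, nsmul_eq_mul]
          field_simp
  have hmain := norm_hankel_sum_le hC hτ hh hc hM hN0 (fun i => S (pt i))
    (fun i => hS _ (hptm i)) u
  rw [hJ]
  have h5 := norm_sub_norm_le
    (∑ i, ∑ j, ∫ x in pt i..pt' i, ∫ y in pt j..pt' j, h (x + y) • v (x + y))
    (∑ i, ∑ j, ∫ x in pt i..pt' i, ∫ y in pt j..pt' j, h (x + y) • v (pt i + pt j))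
  have h6 : ‖∑ i, ∑ j, ∫ x in pt i..pt' i, ∫ y in pt j..pt' j, h (x + y) • v (pt i + pt j)‖ ≤
      2 * C ^ 2 * M * ‖u‖ := by
    rw [hJN, norm_smul, norm_inv, Complex.norm_natCast, inv_mul_le_iff₀ hN']
    refine hmain.trans (le_of_eq (by ring))
  linarith

/-- The segment `x + y = s` of the unit square projects to an interval of length `s` when `s ≤ 1`,
and larger `s` do not contribute. The proof takes `P`, the integral of `g` from `x` to `1`, and
integrates by parts. -/
lemma integral_integral_add_eq [CompleteSpace X] {g : ℝ → X} (hg : Continuous g)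
    (hz : ∀ s, 1 ≤ s → g s = 0) :
    ∫ x in (0 : ℝ)..1, ∫ y in (0 : ℝ)..1, g (x + y) = ∫ s in (0 : ℝ)..1, s • g s := by
  set P : ℝ → X := fun x => ∫ s in x..1, g s
  have hP : ∀ x, HasDerivAt P (-g x) x := fun x =>
    intervalIntegral.integral_hasDerivAt_left (hg.intervalIntegrable _ _)
      (hg.stronglyMeasurableAtFilter _ _) hg.continuousAt
  have hPc : Continuous P := continuous_iff_continuousAt.2 fun x => (hP x).continuousAt
  have e1 : ∀ x ∈ Icc (0 : ℝ) 1, ∫ y in (0 : ℝ)..1, g (x + y) = P x := by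
    intro x hx
    rw [intervalIntegral.integral_comp_add_left, add_zero]
    have h1 : ∫ s in (1 : ℝ)..x + 1, g s = 0 := by
      rw [intervalIntegral.integral_congr (g := fun _ => (0 : X)) fun s hs => ?_]
      · simp
      · rw [uIcc_of_le (by linarith [hx.1])] at hs
        exact hz s hs.1
    rw [← intervalIntegral.integral_add_adjacent_intervals (b := 1)
      (hg.intervalIntegrable _ _) (hg.intervalIntegrable _ _), h1, add_zero]
  have e2 : ∫ x in (0 : ℝ)..1, ∫ y in (0 : ℝ)..1, g (x + y) = ∫ x in (0 : ℝ)..1, P x :=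
    intervalIntegral.integral_congr fun x hx => e1 x (by rwa [uIcc_of_le zero_le_one] at hx)
  have h3 : ∫ x in (0 : ℝ)..1, (P x - x • g x) = (1 : ℝ) • P 1 - (0 : ℝ) • P 0 := by
    refine intervalIntegral.integral_eq_sub_of_hasDerivAt (f := fun x => x • P x) (fun x _ => ?_)
      (Continuous.intervalIntegrable (by fun_prop) _ _)
    have := (hasDerivAt_id x).smul (hP x)
    refine this.congr_deriv ?_
    simp [sub_eq_neg_add]
  have hP1 : P 1 = 0 := intervalIntegral.integral_same
  rw [intervalIntegral.integral_sub (hPc.intervalIntegrable _ _)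
    (Continuous.intervalIntegrable (by fun_prop) _ _), hP1, smul_zero, zero_smul, sub_zero,
    sub_eq_zero] at h3
  rw [e2, h3]

end Galerkin

end SmoothedCalculus

end

noncomputable section

namespace SmoothedCalculus

/-! ### The estimate of a piece and summation over the pieces -/

section PieceEstimate

variable {X : Type*} [NormedAddCommGroup X] [NormedSpace ℂ X] [CompleteSpace X] {φ f : ℝ → ℂ}

/-- The smooth multiplier `u ↦ φ(4u - 2) / u`. -/
def quotBump (φ : ℝ → ℂ) (u : ℝ) : ℂ := φ (4 * u - 2) / u

lemma IsEquidistantPartition.bump_eq_zero (hφ : IsEquidistantPartition φ) {u : ℝ}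
    (hu : u ∉ Icc (1 / 4 : ℝ) (3 / 4)) : φ (4 * u - 2) = 0 := by
  refine hφ.eq_zero (not_le.1 fun h => hu ?_)
  have := abs_le.1 h
  constructor <;> linarith [this.1, this.2]

lemma hasCompactSupport_quotBump (hφ : IsEquidistantPartition φ) :
    HasCompactSupport (quotBump φ) :=
  HasCompactSupport.intro (isCompact_Icc (a := (1 / 4 : ℝ)) (b := 3 / 4)) fun u hu => by
    rw [quotBump, hφ.bump_eq_zero hu, zero_div]

/-- The bump lives on `[1/4, 3/4]`, away from the singularity of `1 / u`. -/
lemma contDiff_quotBump (hφ : IsEquidistantPartition φ) : ContDiff ℝ ∞ (quotBump φ) := by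
  rw [contDiff_iff_contDiffAt]
  intro u
  by_cases hu : u = 0
  · refine (contDiffAt_const (c := (0 : ℂ))).congr_of_eventuallyEq ?_
    have : Iio (1 / 4 : ℝ) ∈ 𝓝 u := Iio_mem_nhds (by rw [hu]; norm_num)
    filter_upwards [this] with x hx
    rw [quotBump, hφ.bump_eq_zero fun h => (not_le.2 hx) h.1, zero_div]
  · have h1 : ContDiff ℝ ∞ fun u : ℝ => φ (4 * u - 2) :=
      hφ.smooth.comp ((contDiff_const.mul contDiff_id).sub contDiff_const)
    have h2 : ContDiffAt ℝ ∞ (fun u : ℝ => (u : ℂ)⁻¹) u :=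
      Complex.ofRealCLM.contDiff.contDiffAt.inv (ofReal_ne_zero.2 hu)
    exact (h1.contDiffAt.mul h2).congr_of_eventuallyEq
      (Eventually.of_forall fun x => div_eq_mul_inv _ _)

/-- Modulating `H` translates its transform and leaves the supremum unchanged, so the bound for a
single pairing holds at every frequency. -/
lemma norm_ft_mul_le_of_contDiff {p H : ℝ → ℂ} (hp : ContDiff ℝ 2 p) (hc : HasCompactSupport p)
    (hH : Integrable H) {M : ℝ} (hM : ∀ x, ‖ft H x‖ ≤ M) (ξ : ℝ) :
    ‖ft (fun u => p u * H u) ξ‖ ≤ sobolevNorm p / 2 * M := by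
  have e : ft (fun u => p u * H u) ξ = ∫ u : ℝ, p u * (H u * exp (-(I * ξ * u))) := by
    simp only [ft, mul_assoc]
  rw [e]
  refine norm_integral_mul_le hp hc (integrable_mul_exp hH ξ) fun x => ?_
  have e2 : ft (fun u => H u * exp (-(I * ξ * u))) x = ft H (ξ + x) := by
    refine integral_congr_ae (Eventually.of_forall fun u => ?_)
    simp only
    rw [mul_assoc, ← exp_add]
    congr 2
    push_cast
    ring
  rw [e2]
  exact hM _

/-- The basic estimate for a frequency localized piece. -/
lemma norm_integral_piece_le {τ : Set (X →L[ℂ] X)} {C : ℝ} (hC : 0 ≤ C)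
    (hτ : ∀ (n : ℕ) (T : Fin n → X →L[ℂ] X) (x : Fin n → X),
      (∀ k, T k ∈ τ) → gaussNorm (fun k => T k (x k)) ≤ C * gaussNorm x)
    {S : ℝ → X →L[ℂ] X} (hS : ∀ t ∈ Icc (0 : ℝ) 1, S t ∈ τ) {x₀ : X} {v : ℝ → X}
    (hv : Continuous v)
    (hSv : ∀ x ∈ Icc (0 : ℝ) 1, ∀ y ∈ Icc (0 : ℝ) 1, S x (S y x₀) = v (x + y))
    (hφ : IsEquidistantPartition φ) (hf : Integrable f) {α : ℝ} (h : eNormE φ α f < ⊤)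
    (n : ℤ) (c : ℝ) :
    ‖∫ u, (φ (4 * u - 2) * (φ (c + u - n) * ft f (c + u))) • v u‖ ≤
      2 * Real.pi * C ^ 2 * sobolevNorm (quotBump φ) * (pieceSup φ f n).toReal * ‖x₀‖ := by
  set H : ℝ → ℂ := fun u => φ (c + u - n) * ft f (c + u)
  -- The division by `u` in `quotBump` cancels the weight `s` created by collapsing the Hankel
  -- double integral.
  set k : ℝ → ℂ := fun u => quotBump φ u * H u
  have hp := contDiff_quotBump hφ
  have hpc := hasCompactSupport_quotBump hφ
  have hHc : Continuous H := by
    have h1 := hφ.smooth.continuous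
    have h2 := continuous_ft hf
    fun_prop
  have hkc : Continuous k := hp.continuous.mul hHc
  have hk0 : ∀ u, u ∉ Icc (1 / 4 : ℝ) (3 / 4) → k u = 0 := fun u hu => by
    simp only [k, quotBump]
    rw [hφ.bump_eq_zero hu, zero_div, zero_mul]
  have hks : HasCompactSupport k := hpc.mul_right
  have hM := norm_ft_mul_le_of_contDiff (contDiff_infty.1 hp 2) hpc (integrable_piece hφ hf c n)
    (norm_ft_piece_le hφ hf h n c)
  have key := norm_integral_hankel_le hC hτ hkc hks hM hS hv hSv
  rw [integral_integral_add_eq (g := fun s => k s • v s) (by fun_prop) fun s hs => by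
    rw [hk0 s fun h => by linarith [h.2], zero_smul]] at key
  have e : ∫ u, (φ (4 * u - 2) * (φ (c + u - n) * ft f (c + u))) • v u =
      ∫ s in (0 : ℝ)..1, s • k s • v s := by
    rw [intervalIntegral.integral_of_le zero_le_one,
      setIntegral_eq_integral_of_forall_compl_eq_zero]
    · refine integral_congr_ae (Eventually.of_forall fun u => ?_)
      simp only
      by_cases hu : u ∈ Icc (1 / 4 : ℝ) (3 / 4)
      · have hu0 : (u : ℂ) ≠ 0 := by
          have : (u : ℝ) ≠ 0 := by linarith [hu.1]
          exact_mod_cast this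
        rw [← Complex.coe_smul, smul_smul]
        congr 1
        simp only [k, quotBump, H]
        field_simp
      · rw [hk0 u hu, hφ.bump_eq_zero hu]
        simp
    · intro u hu
      rw [hk0 u fun h => hu ⟨by linarith [h.1], by linarith [h.2]⟩, zero_smul, smul_zero]
  rw [e]
  refine key.trans (le_of_eq (by ring))

lemma one_add_abs_rpow_le {α : ℝ} (hα : 0 < α) (n : ℤ) {i : ℤ} (hi : i ∈ Finset.Icc (-5 : ℤ) 5) :
    (1 + |(n : ℝ) + i / 4 - 1 / 2|) ^ α ≤ 3 ^ α * (1 + |(n : ℝ)|) ^ α := by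
  rw [← Real.mul_rpow (by norm_num) (by positivity)]
  refine Real.rpow_le_rpow (by positivity) ?_ hα.le
  rw [Finset.mem_Icc] at hi
  have h1 : (-5 : ℝ) ≤ i := by exact_mod_cast hi.1
  have h2 : (i : ℝ) ≤ 5 := by exact_mod_cast hi.2
  have h3 : |(n : ℝ) + i / 4 - 1 / 2| ≤ |(n : ℝ)| + 7 / 4 := by
    rw [abs_le]
    constructor <;> linarith [neg_abs_le (n : ℝ), le_abs_self (n : ℝ)]
  linarith [abs_nonneg (n : ℝ)]

/-- The estimate for the integral of `ft f` against a wave operator. -/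
lemma norm_integral_ft_smul_le {τ : Set (X →L[ℂ] X)} {C : ℝ} (hC : 0 ≤ C)
    (hτ : ∀ (n : ℕ) (T : Fin n → X →L[ℂ] X) (x : Fin n → X),
      (∀ k, T k ∈ τ) → gaussNorm (fun k => T k (x k)) ≤ C * gaussNorm x)
    {S : ℝ → X →L[ℂ] X} (hS : ∀ t ∈ Icc (0 : ℝ) 1, S t ∈ τ) {x₀ : X} {v : ℝ → X}
    (hv : Continuous v)
    (hSv : ∀ x ∈ Icc (0 : ℝ) 1, ∀ y ∈ Icc (0 : ℝ) 1, S x (S y x₀) = v (x + y))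
    (hφ : IsEquidistantPartition φ) (hf : Integrable f) {α : ℝ} (hα : 0 < α)
    (h : eNormE φ α f < ⊤) {S₁ : ℝ → X →L[ℂ] X} {C₁ : ℝ} (hC₁ : 0 ≤ C₁)
    (hS₁ : ∀ t, ‖S₁ t‖ ≤ C₁ * (1 + |t|) ^ α) {V : ℝ → X}
    (hV : ∀ c, ∀ u ∈ Icc (0 : ℝ) 1, V (c + u) = S₁ c (v u))
    (hG : Integrable fun t => ft f t • V t) :
    ‖∫ t, ft f t • V t‖ ≤
      11 * C₁ * 3 ^ α * (2 * Real.pi * C ^ 2 * sobolevNorm (quotBump φ)) * ‖x₀‖ *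
        (eNormE φ α f).toReal := by
  set Q := 2 * Real.pi * C ^ 2 * sobolevNorm (quotBump φ) with hQ
  have hQ0 : 0 ≤ Q := by have := sobolevNorm_nonneg (quotBump φ); positivity
  set K := 11 * C₁ * 3 ^ α * Q * ‖x₀‖ with hK
  have hK0 : 0 ≤ K := by positivity
  obtain ⟨B, hB⟩ := hφ.exists_bound
  have hφc := hφ.smooth.continuous
  have hpiece : ∀ n : ℤ, ‖∫ t, φ (t - n) • ft f t • V t‖ ≤
      K * ((1 + |(n : ℝ)|) ^ α * (pieceSup φ f n).toReal) := by
    intro n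
    have hGn : Integrable fun t => φ (t - n) • ft f t • V t :=
      hG.bdd_smul B (hφc.comp (by fun_prop)).aestronglyMeasurable
        (Eventually.of_forall fun t => hB _)
    have hGi : ∀ i : ℤ, Integrable fun t => φ (4 * (t - n) - i) • φ (t - n) • ft f t • V t :=
      fun i => hGn.bdd_smul B (hφc.comp (by fun_prop)).aestronglyMeasurable
        (Eventually.of_forall fun t => hB _)
    -- A second partition of step `1 / 4` makes each piece short enough for a translate of `[1/4,
    -- 3/4]`. As `|4 (t - n)| ≤ 4` on the support, the eleven indices from `-5` to `5` suffice.
    have e1 : ∫ t, φ (t - n) • ft f t • V t = ∑ i ∈ Finset.Icc (-5 : ℤ) 5,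
        ∫ t, φ (4 * (t - n) - i) • φ (t - n) • ft f t • V t := by
      rw [← integral_finsetSum _ fun i _ => hGi i]
      refine integral_congr_ae (Eventually.of_forall fun t => ?_)
      simp only
      rw [← Finset.sum_smul]
      by_cases ht : |t - n| ≤ 1
      · have h4 : |4 * (t - n)| + 1 ≤ (5 : ℕ) := by
          rw [abs_mul]; norm_num; linarith
        have := hφ.sum_Icc h4
        norm_num at this
        rw [this, one_smul]
      · rw [hφ.eq_zero (not_le.1 ht), zero_smul, smul_zero]
    have e2 : ∀ i ∈ Finset.Icc (-5 : ℤ) 5,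
        ‖∫ t, φ (4 * (t - n) - i) • φ (t - n) • ft f t • V t‖ ≤
        C₁ * (3 ^ α * (1 + |(n : ℝ)|) ^ α) * (Q * (pieceSup φ f n).toReal * ‖x₀‖) := by
      intro i hi
      -- With this base point the fine bump is centred at `u = 1 / 2`.
      set c : ℝ := n + i / 4 - 1 / 2 with hc
      have e3 : ∫ t, φ (4 * (t - n) - i) • φ (t - n) • ft f t • V t =
          S₁ c (∫ u, (φ (4 * u - 2) * (φ (c + u - n) * ft f (c + u))) • v u) := by
        rw [← integral_add_left_eq_self
          (fun t => φ (4 * (t - n) - i) • φ (t - n) • ft f t • V t) c,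
          ← ContinuousLinearMap.integral_comp_comm]
        · refine integral_congr_ae (Eventually.of_forall fun u => ?_)
          simp only
          have h5 : 4 * (c + u - n) - i = 4 * u - 2 := by rw [hc]; ring
          rw [h5]
          by_cases hu : u ∈ Icc (1 / 4 : ℝ) (3 / 4)
          · rw [hV c u ⟨by linarith [hu.1], by linarith [hu.2]⟩, map_smul, smul_smul, smul_smul,
              mul_assoc]
          · rw [hφ.bump_eq_zero hu]; simp
        · refine Continuous.integrable_of_hasCompactSupport ?_ ?_
          · have := continuous_ft hf
            fun_prop
          · refine HasCompactSupport.intro (isCompact_Icc (a := (1 / 4 : ℝ)) (b := 3 / 4))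
              fun u hu => ?_
            rw [hφ.bump_eq_zero hu, zero_mul, zero_smul]
      rw [e3]
      refine ((S₁ c).le_opNorm _).trans ?_
      have h6 := norm_integral_piece_le hC hτ hS hv hSv hφ hf h n c
      have h7 : ‖S₁ c‖ ≤ C₁ * (3 ^ α * (1 + |(n : ℝ)|) ^ α) :=
        (hS₁ c).trans (mul_le_mul_of_nonneg_left (one_add_abs_rpow_le hα n hi) hC₁)
      exact mul_le_mul h7 h6 (norm_nonneg _) (by positivity)
    rw [e1]
    refine (norm_sum_le _ _).trans ((Finset.sum_le_sum e2).trans (le_of_eq ?_))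
    rw [Finset.sum_const, Int.card_Icc, nsmul_eq_mul]
    have : (5 + 1 - (-5) : ℤ).toNat = 11 := rfl
    rw [this, hK, Nat.cast_ofNat]
    ring
  have hE : ‖∫ t, ft f t • V t‖ₑ ≤ ENNReal.ofReal K * eNormE φ α f := by
    refine (hφ.enorm_integral_le hG).trans ?_
    rw [eNormE_eq, ← ENNReal.tsum_mul_left]
    refine ENNReal.tsum_le_tsum fun n => ?_
    rw [← ENNReal.ofReal_toReal (pieceSup_lt_top h n).ne, ← ENNReal.ofReal_mul (by positivity),
      ← ENNReal.ofReal_mul hK0, ← ofReal_norm]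
    exact ENNReal.ofReal_le_ofReal (hpiece n)
  have h8 := ENNReal.toReal_mono (ENNReal.mul_ne_top ENNReal.ofReal_ne_top h.ne) hE
  rwa [toReal_enorm, ENNReal.toReal_mul, ENNReal.toReal_ofReal hK0] at h8

end PieceEstimate

/-! ### Mollified functions of the operator -/

section Mollified

variable {X : Type*} [NormedAddCommGroup X] [NormedSpace ℂ X]
  {A : X →ₗ.[ℂ] X} {θ ν : ℝ} {e : ℂ → ℂ} {f : ℝ → ℂ}

lemma integrable_smul_of_growth {S : ℝ → X →L[ℂ] X} (hSc : Continuous S) {C α : ℝ}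
    (hSb : ∀ t, ‖S t‖ ≤ C * (1 + |t|) ^ α) {c : ℝ → ℂ} (hc : Continuous c)
    (hi : Integrable fun t => (((1 + |t|) ^ α : ℝ) : ℂ) * c t) : Integrable fun t => c t • S t := by
  refine (hi.norm.const_mul C).mono' (hc.smul hSc).aestronglyMeasurable
    (Eventually.of_forall fun t => ?_)
  rw [norm_smul, norm_mul, Complex.norm_real, Real.norm_of_nonneg (by positivity)]
  calc ‖c t‖ * ‖S t‖ ≤ ‖c t‖ * (C * (1 + |t|) ^ α) := by gcongr; exact hSb t
    _ = _ := by ring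

lemma represents_mollify [CompleteSpace X] (h : IsRegularizer A θ ν e) {b : ℝ} (hb : 0 ≤ b) {S : ℝ → X →L[ℂ] X}
    (hS : ∀ t, Represents A ν e (waveFun b t) (S t)) (hSc : Continuous S) {C α : ℝ} (hα : 0 < α)
    (hSb : ∀ t, ‖S t‖ ≤ C * (1 + |t|) ^ α) (hf : Integrable f) (hc : HasCompactSupport f) (m : ℕ)
    {ε : ℝ} (hε : 0 < ε) :
    Represents A ν e (fun z => powFun b z * ((1 + z) ^ m * gaussMollify f ε z))
      (∫ t, mollWeight f m ε t • S t) := by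
  obtain ⟨K, hK⟩ := exists_norm_mollWeight_le_exp f m hε
  have hw := continuous_mollWeight hf hc m ε
  have hi : Integrable fun t => (((1 + |t|) ^ α : ℝ) : ℂ) * mollWeight f m ε t := by
    refine ((integrable_exp_sq_mul_exp_abs (half_pos hε) α).const_mul K).mono'
      (Continuous.aestronglyMeasurable ?_) (Eventually.of_forall fun t => ?_)
    · have h1 : Continuous fun t : ℝ => (1 + |t|) ^ α :=
        (continuous_const.add continuous_abs).rpow_const fun t => Or.inr hα.le
      exact (continuous_ofReal.comp h1).mul hw
    · rw [norm_mul, Complex.norm_real, Real.norm_of_nonneg (by positivity)]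
      have h1 : (1 + |t|) ^ α ≤ Real.exp (α * |t|) := by
        rw [mul_comm, Real.exp_mul]
        exact Real.rpow_le_rpow (by positivity) (by linarith [Real.add_one_le_exp |t|]) hα.le
      calc (1 + |t|) ^ α * ‖mollWeight f m ε t‖
          ≤ Real.exp (α * |t|) * (K * Real.exp (-(ε / 2) * t ^ 2)) := by
            gcongr
            exact hK t
        _ = _ := by ring
  refine h.congr (h.represents_integral hb hS hw (half_pos hε) hK
    (integrable_smul_of_growth hSc hSb hw hi)) fun z _ => ?_
  rw [← integral_mollWeight_mul_exp hf hc m hε, ← integral_const_mul]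
  refine integral_congr_ae (Eventually.of_forall fun t => ?_)
  simp only [waveFun_eq]
  ring

/-- Dominated convergence: the weights are bounded uniformly in `ε` by the transforms of `(1 + y) ^
j f`, and these are integrable against the growth of `S`. -/
lemma tendsto_mollify {S : ℝ → X →L[ℂ] X} (hSc : Continuous S) {C α : ℝ}
    (hSb : ∀ t, ‖S t‖ ≤ C * (1 + |t|) ^ α) (hf : Integrable f) (hc : HasCompactSupport f)
    (hft : ∀ j : ℕ, Integrable fun t =>
      (((1 + |t|) ^ α : ℝ) : ℂ) * ft (fun y => (1 + (y : ℂ)) ^ j * f y) t) (m : ℕ) :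
    Tendsto (fun ε => ∫ t, mollWeight f m ε t • S t) (𝓝[>] 0)
      (𝓝 (∫ t, ((2 * (Real.pi : ℂ))⁻¹ * ft (fun y => (1 + (y : ℂ)) ^ m * f y) t) • S t)) := by
  obtain ⟨K, hK, hKb⟩ := exists_norm_mollWeight_le f m
  have hC : 0 ≤ C := by
    have := (norm_nonneg _).trans (hSb 0)
    simpa using this
  refine tendsto_integral_filter_of_dominated_convergence
    (fun t => K * C * ∑ k ∈ Finset.range (m + 1),
      ‖(((1 + |t|) ^ α : ℝ) : ℂ) * ft (fun y => (1 + (y : ℂ)) ^ (m - k) * f y) t‖) ?_ ?_ ?_ ?_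
  · exact Eventually.of_forall fun ε =>
      ((continuous_mollWeight hf hc m ε).smul hSc).aestronglyMeasurable
  · filter_upwards [Ioc_mem_nhdsGT (zero_lt_one (α := ℝ))] with ε hε
    refine Eventually.of_forall fun t => ?_
    rw [norm_smul]
    calc ‖mollWeight f m ε t‖ * ‖S t‖ ≤ (K * ∑ k ∈ Finset.range (m + 1),
          ‖ft (fun y => (1 + (y : ℂ)) ^ (m - k) * f y) t‖) * (C * (1 + |t|) ^ α) := by
          gcongr
          · exact hKb ε hε.1 hε.2 t
          · exact hSb t
      _ = _ := by
          simp only [norm_mul, Complex.norm_real]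
          rw [Real.norm_of_nonneg (by positivity), ← Finset.mul_sum]
          ring
  · exact (integrable_finsetSum _ fun k _ => (hft (m - k)).norm).const_mul _
  · exact Eventually.of_forall fun t => (tendsto_mollWeight f m t).smul_const _

end Mollified

end SmoothedCalculus

end

/-! ### Existence of f(A), removal of the auxiliary resolvent, and the theorem -/

noncomputable section

namespace SmoothedCalculus

variable {X : Type*} [NormedAddCommGroup X] [NormedSpace ℂ X]
  {A : X →ₗ.[ℂ] X}

/-- Any value of the extended calculus comes with a regularizer, and independence of the contour
angle preserves its injectivity on a narrower sector. -/
lemma IsHolValue.exists_isRegularizer [CompleteSpace X] (hA : IsZeroSectorial A) {F : ℂ → ℂ} {T : X →L[ℂ] X}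
    (hT : IsHolValue A F T) : ∃ θ ν e, IsRegularizer A θ ν e := by
  obtain ⟨θ, ν, e, hν, hνθ, hθ, -, he, -, hinj, -⟩ := hT
  have h1 : 0 < min ν (1 / 16) := lt_min hν (by norm_num)
  have h2 : min ν (1 / 16) < θ := (min_le_left _ _).trans_lt hνθ
  refine ⟨min θ (1 / 8), min ν (1 / 16), e, hA, h1,
    lt_min h2 ((min_le_right _ _).trans_lt (by norm_num)), min_le_right _ _,
    he.mono (min_le_left _ _), ?_⟩
  rwa [hA.cauchyInt_congr_angle he hθ.le hν hνθ h1 h2] at hinj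

namespace IsRegularizer

variable {θ ν : ℝ} {e : ℂ → ℂ}

lemma wave_of_pow (h : IsRegularizer A θ ν e) {β : ℝ} {S : X →L[ℂ] X}
    (hS : Represents A ν e (powFun β) S) : Represents A ν e (waveFun β 0) S :=
  h.congr hS fun z _ => (waveFun_zero β z).symm

lemma pow_of_wave (h : IsRegularizer A θ ν e) {β : ℝ} {S : X →L[ℂ] X}
    (hS : Represents A ν e (waveFun β 0) S) : Represents A ν e (powFun β) S :=
  h.congr hS fun z _ => waveFun_zero β z

lemma wave_unique (h : IsRegularizer A θ ν e) {β β' t t' : ℝ} (hβ : β = β') (ht : t = t')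
    {S S' : X →L[ℂ] X} (hS : Represents A ν e (waveFun β t) S)
    (hS' : Represents A ν e (waveFun β' t') S') : S = S' := by
  subst hβ ht
  exact h.unique hS hS'

variable [CompleteSpace X]

lemma wave_mul (h : IsRegularizer A θ ν e) {β β' t t' : ℝ} (hβ : 0 ≤ β) (hβ' : 0 ≤ β')
    {S S' : X →L[ℂ] X} (hS : Represents A ν e (waveFun β t) S)
    (hS' : Represents A ν e (waveFun β' t') S') :
    Represents A ν e (waveFun (β + β') (t + t')) (S ∘L S') :=
  h.congr (h.mul (expGrowth_waveFun h.le hβ t) (expGrowth_waveFun h.le hβ' t') hS hS')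
    fun _ hz => waveFun_mul h.le β β' t t' hz

/-- Continuity is local, and polynomial growth is bounded on the window of radius one around `t`. -/
lemma continuous_wave_comp (h : IsRegularizer A θ ν e) {β : ℝ} (hβ : 0 ≤ β)
    {S : ℝ → X →L[ℂ] X} (hS : ∀ t, Represents A ν e (waveFun β t) (S t)) {C α : ℝ} (hα : 0 < α)
    (hSb : ∀ t, ‖S t‖ ≤ C * (1 + |t|) ^ α) : Continuous fun t => S t ∘L resApprox A 1 := by
  have hC : 0 ≤ C := by
    have := (norm_nonneg _).trans (hSb 0)
    simpa using this
  rw [continuous_iff_continuousAt]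
  intro t
  have hc := h.continuousOn_wave_comp hβ (J := Ioo (t - 1) (t + 1)) (R := |t| + 1)
    (M := C * (1 + (|t| + 1)) ^ α) (S := S) ?_ ?_ (fun s _ => hS s) (h.pow_of_wave (hS 0))
  · exact hc.continuousAt (Ioo_mem_nhds (by linarith) (by linarith))
  all_goals
    intro s hs
    have hst : |s| ≤ |t| + 1 := by
      rw [abs_le]
      constructor <;> linarith [hs.1, hs.2, neg_abs_le t, le_abs_self t]
  · exact hst
  · refine (hSb s).trans ?_
    gcongr

/-- The factorization `r (r + A)⁻¹ = (1 + A)⁻¹ Y`. -/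
lemma exists_resApprox_eq (h : IsRegularizer A θ ν e) {r : ℝ} (hr : 0 < r) :
    ∃ Y : X →L[ℂ] X, resApprox A r = resApprox A 1 ∘L Y := by
  have g1 := expGrowth_powFun h.le zero_le_one
  have gr := h.expGrowth_resApprox hr
  have hr' := h.represents_resApprox hr
  have a := IsRegularizer.smul (r : ℂ) (IsRegularizer.one (A := A) (ν := ν) (e := e))
  have b := IsRegularizer.smul (1 - r : ℂ) hr'
  have ga := (ExpGrowth.const θ r).mul (ExpGrowth.const θ 1)
  have gb := (ExpGrowth.const θ (1 - r)).mul gr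
  refine ⟨_, h.unique hr' (h.congr (h.mul g1 (ga.add gb) h.represents_resApprox_one
    (h.add ga gb a b)) fun z hz => ?_)⟩
  have hz1 := one_add_ne_zero h.le hz
  have hz2 : (r : ℂ) + z ≠ 0 := fun h0 => by
    have := re_pos_of_mem_sector h.le_pi_div_two hz
    have h2 := congrArg Complex.re h0
    simp at h2; linarith
  rw [powFun_one]
  field_simp
  ring

/-- The operator `f(A)`, as the norm limit of `(f * g_ε)(A)`, for compactly supported `f`. -/
lemma exists_tendsto_mollify (h : IsRegularizer A θ ν e) {α β : ℝ} (hα : 0 < α) (hβ : 0 ≤ β)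
    {S : ℝ → X →L[ℂ] X} (hS : ∀ t, Represents A ν e (waveFun β t) (S t)) {C : ℝ}
    (hSb : ∀ t, ‖S t‖ ≤ C * (1 + |t|) ^ α) {f : ℝ → ℂ} (hf : Integrable f)
    (hc : HasCompactSupport f) (hft : ∀ j : ℕ, Integrable fun t =>
      (((1 + |t|) ^ α : ℝ) : ℂ) * ft (fun y => (1 + (y : ℂ)) ^ j * f y) t) :
    ∃ (U : ℝ → X →L[ℂ] X) (T T' : X →L[ℂ] X),
      (∀ ε, 0 < ε → Represents A ν e (gaussMollify f ε) (U ε)) ∧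
      Tendsto U (𝓝[>] 0) (𝓝 T) ∧ T = T' ∘L resApprox A 1 := by
  set L := resApprox A 1 with hL
  have hL1 : Represents A ν e (waveFun 1 0) L := h.wave_of_pow h.represents_resApprox_one
  -- The exponent splits as `m = (m - 2 - β) + β + 1 + 1`. The first part is at least `1` and gives
  -- the bounded power `P`, and `β` belongs to the wave operator. One resolvent makes it continuous;
  -- the other is split off on the right to give `T'`.
  set m : ℕ := ⌈β⌉₊ + 3 with hm
  have hδ : 1 ≤ (m : ℝ) - 2 - β := by
    have := Nat.le_ceil β
    rw [hm]; push_cast; linarith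
  obtain ⟨P, hP⟩ := h.exists_represents_powFun hδ
  replace hP := h.wave_of_pow hP
  have hSL := h.continuous_wave_comp hβ hS hα hSb
  have hC : 0 ≤ C := by
    have := (norm_nonneg _).trans (hSb 0)
    simpa using this
  set W : ℝ → X →L[ℂ] X := fun t => P ∘L (S t ∘L L) with hW
  have hWc : Continuous W := continuous_const.clm_comp hSL
  have hWb : ∀ t, ‖W t‖ ≤ (‖P‖ * (C * ‖L‖)) * (1 + |t|) ^ α := fun t => by
    calc ‖W t‖ ≤ ‖P‖ * (‖S t‖ * ‖L‖) :=
          (ContinuousLinearMap.opNorm_comp_le _ _).trans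
            (mul_le_mul_of_nonneg_left (ContinuousLinearMap.opNorm_comp_le _ _) (norm_nonneg _))
      _ ≤ ‖P‖ * ((C * (1 + |t|) ^ α) * ‖L‖) := by gcongr; exact hSb t
      _ = _ := by ring
  have hWLc : Continuous fun t => W t ∘L L := hWc.clm_comp continuous_const
  have hWLb : ∀ t, ‖W t ∘L L‖ ≤ (‖P‖ * (C * ‖L‖) * ‖L‖) * (1 + |t|) ^ α := fun t => by
    calc ‖W t ∘L L‖ ≤ ‖W t‖ * ‖L‖ := ContinuousLinearMap.opNorm_comp_le _ _
      _ ≤ ((‖P‖ * (C * ‖L‖)) * (1 + |t|) ^ α) * ‖L‖ := by gcongr; exact hWb t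
      _ = _ := by ring
  have hWL : ∀ t, Represents A ν e (waveFun m t) (W t ∘L L) := fun t => by
    have h1 := h.wave_mul (by linarith) (by linarith : (0 : ℝ) ≤ β + 1) hP
      (h.wave_mul hβ zero_le_one (hS t) hL1)
    have h2 := h.wave_mul (by linarith) zero_le_one h1 hL1
    have e1 : (m : ℝ) - 2 - β + (β + 1) + 1 = m := by ring
    have e2 : 0 + (t + 0) + 0 = t := by ring
    rwa [e1, e2] at h2
  set c : ℝ → ℂ := fun t => (2 * (Real.pi : ℂ))⁻¹ * ft (fun y => (1 + (y : ℂ)) ^ m * f y) t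
    with hcdef
  refine ⟨fun ε => ∫ t, mollWeight f m ε t • (W t ∘L L), ∫ t, c t • (W t ∘L L),
    ∫ t, c t • W t, fun ε hε => ?_, tendsto_mollify hWLc hWLb hf hc hft m, ?_⟩
  · refine h.congr (represents_mollify h (Nat.cast_nonneg m) hWL hWLc hα hWLb hf hc m hε)
      fun z hz => ?_
    have hz1 := one_add_ne_zero h.le hz
    rw [powFun, ofReal_natCast, cpow_neg, cpow_natCast, ← mul_assoc,
      inv_mul_cancel₀ (pow_ne_zero _ hz1), one_mul]
  · have hfm : Integrable fun y : ℝ => (1 + (y : ℂ)) ^ m * f y :=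
      integrable_pow_mul hf hc m
    have hcc : Continuous c := continuous_const.mul (continuous_ft hfm)
    have hi : Integrable fun t => c t • W t := by
      refine integrable_smul_of_growth hWc hWb hcc ?_
      refine ((hft m).const_mul (2 * (Real.pi : ℂ))⁻¹).congr (Eventually.of_forall fun t => ?_)
      simp only [hcdef]
      ring
    have := ((ContinuousLinearMap.compL ℂ X X X).flip L).integral_comp_comm hi
    simp only [ContinuousLinearMap.flip_apply, ContinuousLinearMap.compL_apply] at this
    rw [← this]
    refine integral_congr_ae (Eventually.of_forall fun t => ?_)
    simp only [ContinuousLinearMap.smul_comp]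

/-- Wave packet representation of `(1 + A)^{-β} f(A) (1 + A)⁻¹`. -/
lemma comp_limit_eq_integral (h : IsRegularizer A θ ν e) {α b : ℝ} (hα : 0 < α) (hb : 0 ≤ b)
    {B : X →L[ℂ] X} (hB : Represents A ν e (powFun b) B)
    {V : ℝ → X →L[ℂ] X} (hV : ∀ t, Represents A ν e (waveFun (b + 1) t) (V t))
    (hVc : Continuous V) {C : ℝ} (hVb : ∀ t, ‖V t‖ ≤ C * (1 + |t|) ^ α) {f : ℝ → ℂ}
    (hf : Integrable f) (hc : HasCompactSupport f) (hft : ∀ j : ℕ, Integrable fun t =>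
      (((1 + |t|) ^ α : ℝ) : ℂ) * ft (fun y => (1 + (y : ℂ)) ^ j * f y) t)
    {U : ℝ → X →L[ℂ] X} {T : X →L[ℂ] X}
    (hU : ∀ ε, 0 < ε → Represents A ν e (gaussMollify f ε) (U ε))
    (hT : Tendsto U (𝓝[>] 0) (𝓝 T)) :
    B ∘L T ∘L resApprox A 1 = ∫ t, ((2 * (Real.pi : ℂ))⁻¹ * ft f t) • V t := by
  have h1 := tendsto_mollify hVc hVb hf hc hft 0
  simp only [pow_zero, one_mul] at h1
  refine tendsto_nhds_unique ?_ h1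
  have h2 : Tendsto (fun ε => B ∘L U ε ∘L resApprox A 1) (𝓝[>] 0)
      (𝓝 (B ∘L T ∘L resApprox A 1)) :=
    ((continuous_const.clm_comp (continuous_id.clm_comp continuous_const)).tendsto T).comp hT
  refine h2.congr' ?_
  filter_upwards [self_mem_nhdsWithin] with ε hε
  obtain ⟨K, hK⟩ := exists_norm_gaussMollify_le h.le hf hc hε
  have gm : ExpGrowth θ (gaussMollify f ε) :=
    ExpGrowth.of_bounded (differentiable_gaussMollify hf hc ε).differentiableOn hK
  have g1 := expGrowth_powFun h.le zero_le_one
  refine h.unique (h.mul (expGrowth_powFun h.le hb) (gm.mul g1) hB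
    (h.mul gm g1 (hU ε hε) h.represents_resApprox_one)) (h.congr
    (represents_mollify h (by linarith) hV hVc hα hVb hf hc 0 hε) fun z hz => ?_)
  rw [← powFun_mul h.le b 1 hz, pow_zero, one_mul]
  ring

/-- Passage from `R ∘ (1 + A)⁻¹` to `R`. -/
lemma norm_comp_le_of_resApprox (h : IsRegularizer A θ ν e) {R R' : X →L[ℂ] X}
    (hR : R = R' ∘L resApprox A 1) {K D : ℝ} (hK : 0 ≤ K) (hD : 0 < D)
    (hDb : ∀ r, 0 < r → ‖resApprox A r‖ ≤ D)
    (hRL : ∀ w, ‖R (resApprox A 1 w)‖ ≤ K * ‖resApprox A 1 w‖) : ‖R‖ ≤ K * D := by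
  have h1 : ∀ r : ℝ, 0 < r → ‖R‖ ≤ K * D + ‖R'‖ * (r⁻¹ * ((1 + ‖resApprox A 1‖) * D)) := by
    intro r hr
    obtain ⟨Y, hY⟩ := h.exists_resApprox_eq hr
    -- The first term is controlled because the range of `resApprox A r` lies in that of `resApprox
    -- A 1`. The second is of order `r⁻¹` because `R` factors through the resolvent.
    have e1 : R = R ∘L resApprox A r +
        R' ∘L (resApprox A 1 - resApprox A 1 ∘L resApprox A r) := by
      rw [ContinuousLinearMap.comp_sub, ← ContinuousLinearMap.comp_assoc, ← hR]
      abel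
    have e2 : ‖R ∘L resApprox A r‖ ≤ K * D := by
      refine ContinuousLinearMap.opNorm_le_bound _ (by positivity) fun x => ?_
      have h2 : resApprox A r x = resApprox A 1 (Y x) := by rw [hY]; rfl
      rw [ContinuousLinearMap.comp_apply, h2]
      refine (hRL _).trans ?_
      rw [← h2, mul_assoc]
      exact mul_le_mul_of_nonneg_left (((resApprox A r).le_opNorm x).trans
        (mul_le_mul_of_nonneg_right (hDb r hr) (norm_nonneg _))) hK
    have e3 : ‖R' ∘L (resApprox A 1 - resApprox A 1 ∘L resApprox A r)‖ ≤
        ‖R'‖ * (r⁻¹ * ((1 + ‖resApprox A 1‖) * D)) := by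
      refine (ContinuousLinearMap.opNorm_comp_le _ _).trans
        (mul_le_mul_of_nonneg_left ((h.norm_resApprox_one_sub_le hr).trans ?_) (norm_nonneg _))
      have := hDb r hr
      gcongr
    calc ‖R‖ = ‖R ∘L resApprox A r +
          R' ∘L (resApprox A 1 - resApprox A 1 ∘L resApprox A r)‖ := by rw [← e1]
      _ ≤ _ := (norm_add_le _ _).trans (add_le_add e2 e3)
  have h2 : Tendsto (fun r : ℝ => K * D + ‖R'‖ * (r⁻¹ * ((1 + ‖resApprox A 1‖) * D))) atTop
      (𝓝 (K * D + ‖R'‖ * (0 * ((1 + ‖resApprox A 1‖) * D)))) :=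
    ((tendsto_inv_atTop_zero.mul_const _).const_mul _).const_add _
  have h3 := ge_of_tendsto h2 ((eventually_gt_atTop 0).mono h1)
  simpa using h3

end IsRegularizer

lemma norm_le_of_gaussNorm_le {τ : Set (X →L[ℂ] X)} {C : ℝ}
    (hτ : ∀ (n : ℕ) (T : Fin n → X →L[ℂ] X) (x : Fin n → X),
      (∀ k, T k ∈ τ) → gaussNorm (fun k => T k (x k)) ≤ C * gaussNorm x) (hC : 0 ≤ C)
    {T : X →L[ℂ] X} (hT : T ∈ τ) : ‖T‖ ≤ C := by
  refine ContinuousLinearMap.opNorm_le_bound _ hC fun x => ?_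
  have := hτ 1 (fun _ => T) (fun _ => x) fun _ => hT
  rw [gaussNorm_const, gaussNorm_const] at this
  simpa using this

end SmoothedCalculus

end

theorem proposition1 {X : Type*} [NormedAddCommGroup X] [NormedSpace ℂ X] [CompleteSpace X]
    (A : X →ₗ.[ℂ] X) (hA : IsZeroSectorial A)
    (α β₁ β₂ : ℝ) (hα : 0 < α) (hβ₁ : α ≤ β₁) (hβ₂ : α ≤ β₂)
    (S₁ S₂ : ℝ → X →L[ℂ] X)
    (hS₁ : ∀ t : ℝ, IsHolValue A (waveFun β₁ t) (S₁ t))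
    (hS₁_bound : ∃ C : ℝ, ∀ t : ℝ, ‖S₁ t‖ ≤ C * (1 + |t|) ^ α)
    (hS₂ : ∀ t ∈ Set.Icc (0 : ℝ) 1, IsHolValue A (waveFun β₂ t) (S₂ t))
    (hS₂_gamma : IsGammaBounded (S₂ '' Set.Icc (0 : ℝ) 1))
    (φ : ℝ → ℂ) (hφ : IsEquidistantPartition φ) :
    ∃ B : X →L[ℂ] X, IsHolValue A (powFun (β₁ + 2 * β₂)) B ∧
      ∃ C : ℝ, ∀ f : ℝ → ℂ, MemE φ α f → HasCompactSupport f → tsupport f ⊆ Set.Ioi 0 →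
        ∃ T : X →L[ℂ] X, IsFunValue A f T ∧ ‖B ∘L T‖ ≤ C * (eNormE φ α f).toReal := by
  obtain ⟨θ, ν, e, h⟩ := (hS₁ 0).exists_isRegularizer hA
  obtain ⟨C₁, hC₁⟩ := hS₁_bound
  obtain ⟨C₂, hC₂, hτ⟩ := hS₂_gamma
  obtain ⟨D, hD, hDb⟩ := hA.exists_norm_resApprox_le
  have hC₁0 : 0 ≤ C₁ := by
    have := (norm_nonneg _).trans (hC₁ 0)
    simpa using this
  have b₁ : 0 ≤ β₁ := hα.le.trans hβ₁
  have b₂ : 0 ≤ β₂ := hα.le.trans hβ₂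
  have w₁ : ∀ t, Represents A ν e (waveFun β₁ t) (S₁ t) := fun t =>
    h.of_isHolValue (expGrowth_waveFun h.le b₁ t) (hS₁ t)
  have w₂ : ∀ t ∈ Icc (0 : ℝ) 1, Represents A ν e (waveFun β₂ t) (S₂ t) := fun t ht =>
    h.of_isHolValue (expGrowth_waveFun h.le b₂ t) (hS₂ t ht)
  have h01 : (0 : ℝ) ∈ Icc (0 : ℝ) 1 := ⟨le_rfl, zero_le_one⟩
  set L := resApprox A 1 with hL
  have wL : Represents A ν e (waveFun 1 0) L := h.wave_of_pow h.represents_resApprox_one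
  -- At `t = 0` the wave operators are the powers of `1 + A`, so `S₁ 0 ∘L B₂` is the required `(1 +
  -- A)^(-β)`.
  set B₂ := S₂ 0 ∘L S₂ 0 with hB₂def
  have wB₂ : Represents A ν e (waveFun (β₂ + β₂) 0) B₂ := by
    have := h.wave_mul b₂ b₂ (w₂ 0 h01) (w₂ 0 h01)
    rwa [add_zero] at this
  have wB : Represents A ν e (powFun (β₁ + 2 * β₂)) (S₁ 0 ∘L B₂) := by
    have := h.wave_mul b₁ (by linarith) (w₁ 0) wB₂
    rw [add_zero, ← two_mul] at this
    exact h.pow_of_wave this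
  have hb : 0 ≤ β₁ + 2 * β₂ := by linarith
  set V : ℝ → X →L[ℂ] X := fun t => (S₁ t ∘L L) ∘L B₂ with hVdef
  have wV : ∀ t, Represents A ν e (waveFun (β₁ + 2 * β₂ + 1) t) (V t) := fun t => by
    have := h.wave_mul (by linarith) (by linarith) (h.wave_mul b₁ zero_le_one (w₁ t) wL) wB₂
    rwa [show β₁ + 1 + (β₂ + β₂) = β₁ + 2 * β₂ + 1 by ring,
      show t + 0 + 0 = t by ring] at this
  have hVc : Continuous V :=
    (h.continuous_wave_comp b₁ w₁ hα hC₁).clm_comp continuous_const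
  have hVb : ∀ t, ‖V t‖ ≤ (C₁ * ‖L‖ * ‖B₂‖) * (1 + |t|) ^ α := fun t => by
    calc ‖V t‖ ≤ (‖S₁ t‖ * ‖L‖) * ‖B₂‖ :=
          (ContinuousLinearMap.opNorm_comp_le _ _).trans
            (mul_le_mul_of_nonneg_right (ContinuousLinearMap.opNorm_comp_le _ _) (norm_nonneg _))
      _ ≤ ((C₁ * (1 + |t|) ^ α) * ‖L‖) * ‖B₂‖ := by gcongr; exact hC₁ t
      _ = _ := by ring
  have hhalf : ∀ s ∈ Icc (0 : ℝ) 2, s / 2 ∈ Icc (0 : ℝ) 1 := fun s hs =>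
    ⟨by linarith [hs.1], by linarith [hs.2]⟩
  have hn₂ : ∀ t ∈ Icc (0 : ℝ) 1, ‖S₂ t‖ ≤ C₂ := fun t ht =>
    norm_le_of_gaussNorm_le hτ hC₂ ⟨t, ht, rfl⟩
  -- Sums `x + y` range over `[0, 2]`, while `S₂` is given on `[0, 1]`. Halving the time yields the
  -- operator with exponent `2 β₂` on the larger interval.
  set Z : ℝ → X →L[ℂ] X := fun s => S₂ (s / 2) ∘L S₂ (s / 2) with hZdef
  have wZ : ∀ s ∈ Icc (0 : ℝ) 2, Represents A ν e (waveFun (β₂ + β₂) s) (Z s) := fun s hs => by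
    have := h.wave_mul b₂ b₂ (w₂ _ (hhalf s hs)) (w₂ _ (hhalf s hs))
    rwa [add_halves] at this
  have hZc : ContinuousOn (fun s => Z s ∘L L) (Icc (0 : ℝ) 2) := by
    refine h.continuousOn_wave_comp (by linarith) (R := 2) (M := C₂ * C₂) (fun t ht => ?_)
      (fun t ht => ?_) wZ (h.pow_of_wave wB₂)
    · rw [abs_of_nonneg ht.1]; exact ht.2
    · have := hn₂ _ (hhalf t ht)
      exact (ContinuousLinearMap.opNorm_comp_le _ _).trans
        (mul_le_mul this this (norm_nonneg _) hC₂)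
  set Q := 11 * C₁ * 3 ^ α * (2 * Real.pi * C₂ ^ 2 * sobolevNorm (quotBump φ)) with hQ
  have hQ0 : 0 ≤ Q := by have := sobolevNorm_nonneg (quotBump φ); positivity
  refine ⟨S₁ 0 ∘L B₂, h.isHolValue (differentiableOn_powFun h.le _)
    (fun z hz => norm_powFun_le h.le hb hz) wB, ‖(2 * (Real.pi : ℂ))⁻¹‖ * Q * D,
    fun f hf hc _ => ?_⟩
  have hfi : Integrable f :=
    (integrableOn_iff_integrable_of_support_subset (subset_tsupport f)).1
      (hf.locInt.integrableOn_isCompact hc)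
  have hft := integrable_ft_pow_mul hφ hα hfi hc hf.finite
  obtain ⟨U, T, T', hU, hUT, hT⟩ := h.exists_tendsto_mollify hα b₁ w₁ hC₁ hfi hc hft
  refine ⟨T, ⟨U, fun ε hε => ?_, fun x => ?_⟩, ?_⟩
  · obtain ⟨K, hK⟩ := exists_norm_gaussMollify_le h.le hfi hc hε
    exact h.isHolValue (differentiable_gaussMollify hfi hc ε).differentiableOn hK (hU ε hε)
  · exact ((ContinuousLinearMap.apply ℂ X x).continuous.tendsto T).comp hUT
  have hlim := h.comp_limit_eq_integral hα hb wB wV hVc hVb hfi hc hft hU hUT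
  have hi : Integrable fun t => ft f t • V t := by
    refine integrable_smul_of_growth hVc hVb (continuous_ft hfi) ?_
    simpa using hft 0
  have hR : (S₁ 0 ∘L B₂) ∘L T = ((S₁ 0 ∘L B₂) ∘L T') ∘L L := by
    rw [hT]
    rfl
  -- The estimate must be in terms of the norm of `L w` and not of `w`; only then can the auxiliary
  -- resolvent be removed.
  refine (h.norm_comp_le_of_resApprox hR (K := ‖(2 * (Real.pi : ℂ))⁻¹‖ * Q *
    (eNormE φ α f).toReal) (by positivity) hD hDb fun w => ?_).trans (le_of_eq (by ring))
  have hw : ((S₁ 0 ∘L B₂) ∘L T) (L w) = (2 * (Real.pi : ℂ))⁻¹ • ∫ t, ft f t • V t w := by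
    have h1 : ((S₁ 0 ∘L B₂) ∘L T) (L w) = ((S₁ 0 ∘L B₂) ∘L T ∘L L) w := rfl
    rw [h1, hlim]
    simp only [mul_smul]
    rw [integral_smul, smul_apply, ContinuousLinearMap.integral_apply hi]
    rfl
  rw [hw, norm_smul]
  -- The orbit of `L w` is known only on `[0, 2]`; a constant continuation makes it continuous on
  -- the line without affecting the values used.
  have hvc : Continuous (IccExtend (zero_le_two (α := ℝ))
      ((Icc (0 : ℝ) 2).domRestrict fun s => Z s (L w))) := by
    refine Continuous.Icc_extend' (continuousOn_iff_continuous_domRestrict.1 ?_)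
    exact (ContinuousLinearMap.apply ℂ X w).continuous.comp_continuousOn hZc
  have hve : ∀ s ∈ Icc (0 : ℝ) 2, IccExtend (zero_le_two (α := ℝ))
      ((Icc (0 : ℝ) 2).domRestrict fun s => Z s (L w)) s = Z s (L w) := fun s hs => by
    rw [IccExtend_of_mem _ _ hs]; rfl
  have key := norm_integral_ft_smul_le (S := S₂) hC₂ hτ (fun t ht => ⟨t, ht, rfl⟩) (x₀ := L w) hvc
    (fun x hx y hy => ?_) hφ hfi hα hf.finite hC₁0 hC₁ (V := fun t => V t w) (fun c u hu => ?_)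
    ((ContinuousLinearMap.apply ℂ X w).integrable_comp hi)
  · rw [mul_assoc, mul_assoc]
    refine mul_le_mul_of_nonneg_left (key.trans (le_of_eq (by ring))) (norm_nonneg _)
  · have hxy : x + y ∈ Icc (0 : ℝ) 2 := ⟨by linarith [hx.1, hy.1], by linarith [hx.2, hy.2]⟩
    rw [hve _ hxy, ← h.unique (h.wave_mul b₂ b₂ (w₂ x hx) (w₂ y hy)) (wZ _ hxy)]
    rfl
  · have hu2 : u ∈ Icc (0 : ℝ) 2 := ⟨hu.1, by linarith [hu.2]⟩
    rw [hve _ hu2]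
    have := h.wave_unique (by ring) (by ring) (wV (c + u))
      (h.wave_mul b₁ (by linarith : 0 ≤ β₂ + β₂ + 1) (w₁ c)
        (h.wave_mul (by linarith) zero_le_one (wZ u hu2) wL))
    rw [this]
    rfl
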